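/- Let $k$ be a field, $G$ a group, $J$ a set with a total order $\prec$, and let $(G,g_i,\chi_i;i\in J)$ be an element system with characters (ESC): $g_i\in Z(G)$ and $\chi_i:G\to k^\times$ is a character for every $i\in J$. Put $q_i=\chi_i(g_i)$. Let $N_i$ be the order of $q_i$ if $q_i\neq 1$ is a root of unity, and $N_i=\infty$ if $q_i$ is not a root of unity or $q_i=1$. The ESC is quantum weakly commutative if $\chi_i(g_j)\chi_j(g_i)=1$ for all $i\ne j$ in $J$. Let $Q$ be the quiver with vertex set $G$ and one arrow $a^{(i)}_{g_ix,x}:x\to g_ix$ for every $i\in J$, $x\in G$. The span $kQ_1$ of the arrows is a $kG$-Hopf bimodule by $h\cdot a^{(i)}_{g_ix,x}=a^{(i)}_{g_ihx,hx}$, $a^{(i)}_{g_ix,x}\cdot h=\chi_i(h)\,a^{(i)}_{g_ixh,xh}$, $\delta^-(a^{(i)}_{g_ix,x})=g_ix\otimes a^{(i)}_{g_ix,x}$, $\delta^+(a^{(i)}_{g_ix,x})=a^{(i)}_{g_ix,x}\otimes x$. Let $kQ^c$ be the path coalgebra of $Q$ (the cotensor coalgebra of $kQ_1$ over $kG$)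 with its (quantum shuffle) product, the one that makes it a graded Hopf algebra and extends the product of $kG$ and the bimodule structure of $kQ_1$. The multiple Taft algebra $kG[kQ_1^c]$ is the graded Hopf subalgebra of $kQ^c$ generated by $kG$ and $kQ_1$. The semi-path Hopf algebra $kQ^s$ is the tensor algebra $T_{kG}(kQ_1)$, with the graded Hopf algebra structure that extends the product and coproduct of $kG$ and satisfies $\Delta(a)=\delta^-(a)+\delta^+(a)$ for $a\in kQ_1$. Put $E_i=a^{(i)}_{g_i,1}$. For a graded Hopf algebra $H$ with $H_{(0)}=kG$ and projection $\pi_0:H\to kG$, the diagram is $diag(H)=\{h\in H\mid(\mathrm{id}\otimes\pi_0)\Delta(h)=h\otimes1\}$, a subalgebra of $H$, graded by the grading of $H$, with the $G$-action $g\rightharpoonup x=gxg^{-1}$, the coaction $\delta^-=(\pi_0\otimes\mathrm{id})\Delta$, the comultiplication $\Delta_R=(\omega\otimes\mathrm{id})\Delta$, where $\omega(h)=\sum h_{(1)}\,S(\pi_0(h_{(2)}))$, and the counit of $H$. A Nichols algebra is a graded braided Hopf algebra $R=\bigoplus_{n\ge0}R(n)$ in the category ${}^{kG}_{kG}\mathcal{YD}$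 of Yetter–Drinfeld modules over $kG$ with $R(0)=k$, whose space of primitive elements is $R(1)$, and which is generated by $R(1)$ as an algebra. For an ESC $(G,g_i,\chi_i;i\in J)$ the quantum tensor algebra $\mathcal T(G,g_i,\chi_i;i\in J)$ is the free algebra on $\{x_j\mid j\in J\}$, with $h\cdot x_j=\chi_j(h)x_j$, $\delta^-(x_j)=g_j\otimes x_j$, $\Delta(x_j)=x_j\otimes1+1\otimes x_j$, $\epsilon(x_j)=0$ and $x_j$ in degree $1$; these determine it as a graded braided Hopf algebra in ${}^{kG}_{kG}\mathcal{YD}$. The algebra $\mathcal R(G,g_i,\chi_i;i\in J)$ is the quotient of the free algebra by the relations $x_l^{N_l}=0$ for all $l$ with $N_l<\infty$ and $x_ix_j=\chi_j(g_i)x_jx_i$ for $i\ne j$; when these structure maps pass to the quotient, it is called the quantum linear space and carries the induced ones. Suppose first that the ESC is quantum weakly commutative. (iii$'$) $diag(kG[kQ_1^c])$ is a Nichols algebra in ${}^{kG}_{kG}\mathcal{YD}$. Suppose moreover that $\operatorname{char}k=0$ or that $q_i\neq1$ for all $i\in J$. Then: (i) $kG[kQ_1^c]$ has the $k$-basis consisting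 of the elements $g\cdot E_{\nu_1}^{m_1}E_{\nu_2}^{m_2}\cdots E_{\nu_t}^{m_t}$ with $g\in G$, $t\ge0$, $\nu_1\prec\cdots\prec\nu_t$ in $J$ and $0<m_j<N_{\nu_j}$. It is finite-dimensional if and only if $G$, $J$ and all $N_j$, $j\in J$, are finite, and then its dimension is $|G|\prod_{j\in J}N_j$. (ii) $diag(kG[kQ_1^c])$ has the $k$-basis consisting of the elements $E_{\nu_1}^{m_1}E_{\nu_2}^{m_2}\cdots E_{\nu_t}^{m_t}$ with $t\ge0$, $\nu_1\prec\cdots\prec\nu_t$ in $J$ and $0<m_j<N_{\nu_j}$. (iii) The structure maps of $\mathcal T(G,g_i,\chi_i^{-1};i\in J)$ pass to $\mathcal R(G,g_i,\chi_i^{-1};i\in J)$, and $\mathcal R(G,g_i,\chi_i^{-1};i\in J)\cong diag(kG[kQ_1^c])$ as graded braided Hopf algebras in ${}^{kG}_{kG}\mathcal{YD}$, by an isomorphism that sends $x_j$ to $E_j$ for every $j\in J$. For an arbitrary ESC, without quantum weak commutativity and over an arbitrary field: (iv) $diag(kQ^s)$ is a graded braided Hopf algebra in ${}^{kG}_{kG}\mathcal{YD}$,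 and $\mathcal T(G,g_i,\chi_i^{-1};i\in J)\cong diag(kQ^s)$ as graded braided Hopf algebras, by an isomorphism that sends $x_j$ to $E_j$ for every $j\in J$. (v) $kQ^s\cong\mathcal T(G,g_i,\chi_i^{-1};i\in J)\#kG$ (the biproduct, or bosonization) as graded Hopf algebras, and $kQ^s$ has the $k$-basis consisting of the elements $g\cdot E_{\nu_1}\otimes_{kG}E_{\nu_2}\otimes_{kG}\cdots\otimes_{kG}E_{\nu_t}$ with $g\in G$, $t\ge0$ and $\nu_1,\dots,\nu_t\in J$ (which is $g$ for $t=0$). -/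

import Mathlib

open scoped TensorProduct

noncomputable section

/-! ### Graded braided Hopf algebras in the category of Yetter-Drinfeld modules over `kG` -/

/-- Structure maps of a graded braided Hopf algebra over the group algebra `kG`, on an algebra `R`:
a left action of `G` (that is, of `kG`), a left coaction of `kG`, a comultiplication, a counit and
a grading.  The axioms are collected in `BraidedData.IsGradedBraidedHopf`. -/
structure BraidedData (k G R : Type*) [Field k] [Group G] [Ring R] [Algebra k R] where
  /-- the left action -/
  act : Representation k G R
  /-- the left coaction -/
  coact : R →ₗ[k] MonoidAlgebra k G ⊗[k] R
  /-- the comultiplication -/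
  comul : R →ₗ[k] R ⊗[k] R
  /-- the counit -/
  counit : R →ₗ[k] k
  /-- the homogeneous components -/
  deg : ℕ → Submodule k R

/-- Apply `f` to the two middle factors. -/
def midMap {k A B C B' C' D : Type*} [Field k]
    [AddCommGroup A] [AddCommGroup B] [AddCommGroup C] [AddCommGroup B'] [AddCommGroup C']
    [AddCommGroup D] [Module k A] [Module k B] [Module k C] [Module k B'] [Module k C'] [Module k D]
    (f : B ⊗[k] C →ₗ[k] C' ⊗[k] B') :
    (A ⊗[k] B) ⊗[k] (C ⊗[k] D) →ₗ[k] (A ⊗[k] C') ⊗[k] (B' ⊗[k] D) :=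
  (TensorProduct.assoc k A C' (B' ⊗[k] D)).symm.toLinearMap ∘ₗ
    ((TensorProduct.assoc k C' B' D).toLinearMap ∘ₗ f.rTensor D ∘ₗ
      (TensorProduct.assoc k B C D).symm.toLinearMap).lTensor A ∘ₗ
    (TensorProduct.assoc k A B (C ⊗[k] D)).toLinearMap

namespace BraidedData

variable {k G R : Type*} [Field k] [Group G] [Ring R] [Algebra k R] (D : BraidedData k G R)

/-- The action `b ⊗ x ↦ b · x` of the group algebra. -/
def actLin : MonoidAlgebra k G ⊗[k] R →ₗ[k] R :=
  TensorProduct.lift D.act.asAlgebraHom.toLinearMap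

/-- The braiding `x ⊗ y ↦ x₍₋₁₎ · y ⊗ x₍₀₎`. -/
def braiding : R ⊗[k] R →ₗ[k] R ⊗[k] R :=
  D.actLin.rTensor R ∘ₗ
    (TensorProduct.rightComm k (MonoidAlgebra k G) R R).toLinearMap ∘ₗ D.coact.rTensor R

/-- The product of the braided tensor product algebra `R ⊗ R`:
`(x ⊗ y) (x' ⊗ y') = x (y₍₋₁₎ · x') ⊗ y₍₀₎ y'`. -/
def braidedMul : (R ⊗[k] R) ⊗[k] (R ⊗[k] R) →ₗ[k] R ⊗[k] R :=
  TensorProduct.map (LinearMap.mul' k R) (LinearMap.mul' k R) ∘ₗ midMap D.braiding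

/-- The coaction on `R ⊗ R`: `x ⊗ y ↦ x₍₋₁₎ y₍₋₁₎ ⊗ (x₍₀₎ ⊗ y₍₀₎)`. -/
def coactTensor : R ⊗[k] R →ₗ[k] MonoidAlgebra k G ⊗[k] (R ⊗[k] R) :=
  (LinearMap.mul' k (MonoidAlgebra k G)).rTensor (R ⊗[k] R) ∘ₗ
    (TensorProduct.tensorTensorTensorComm k (MonoidAlgebra k G) R
      (MonoidAlgebra k G) R).toLinearMap ∘ₗ TensorProduct.map D.coact D.coact

/-- The subspace `⨁_{p + q = n} R(p) ⊗ R(q)` of `R ⊗ R`. -/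
def degTensor (n : ℕ) : Submodule k (R ⊗[k] R) :=
  ⨆ (p : ℕ × ℕ) (_ : p.1 + p.2 = n),
    LinearMap.range (TensorProduct.map (D.deg p.1).subtype (D.deg p.2).subtype)

/-- `R` is a graded braided Hopf algebra in the category of left-left Yetter-Drinfeld modules over
the group algebra `kG`. -/
structure IsGradedBraidedHopf : Prop where
  -- `R` is a left comodule
  coact_counit : ∀ x, TensorProduct.lid k R
    ((Coalgebra.counit (R := k) (A := MonoidAlgebra k G)).rTensor R (D.coact x)) = x
  coact_coassoc : ∀ x, TensorProduct.assoc k _ _ _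
    ((Coalgebra.comul (R := k) (A := MonoidAlgebra k G)).rTensor R (D.coact x)) =
      D.coact.lTensor (MonoidAlgebra k G) (D.coact x)
  -- the Yetter-Drinfeld condition `δ (h · x) = h x₍₋₁₎ h⁻¹ ⊗ h · x₍₀₎`, for group elements `h`
  yetterDrinfeld : ∀ h x, D.coact (D.act h x) =
    TensorProduct.map
      (LinearMap.mulLeftRight k
        (MonoidAlgebra.single h (1 : k), MonoidAlgebra.single h⁻¹ (1 : k)))
      (D.act h) (D.coact x)
  -- unit and multiplication are morphisms of modules and comodules
  act_one : ∀ h, D.act h 1 = 1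
  act_mul : ∀ h x y, D.act h (x * y) = D.act h x * D.act h y
  coact_one : D.coact 1 = 1
  coact_mul : ∀ x y, D.coact (x * y) = D.coact x * D.coact y
  -- counit and comultiplication are morphisms of modules and comodules
  act_counit : ∀ h x, D.counit (D.act h x) = D.counit x
  act_comul : ∀ h x, D.comul (D.act h x) = TensorProduct.map (D.act h) (D.act h) (D.comul x)
  counit_coact : ∀ x, D.counit.lTensor (MonoidAlgebra k G) (D.coact x) = 1 ⊗ₜ D.counit x
  comul_coact : ∀ x, D.comul.lTensor (MonoidAlgebra k G) (D.coact x) = D.coactTensor (D.comul x)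
  -- `R` is a coalgebra
  coassoc : ∀ x, TensorProduct.assoc k R R R (D.comul.rTensor R (D.comul x)) =
    D.comul.lTensor R (D.comul x)
  rTensor_counit : ∀ x, D.counit.rTensor R (D.comul x) = 1 ⊗ₜ x
  lTensor_counit : ∀ x, D.counit.lTensor R (D.comul x) = x ⊗ₜ 1
  -- counit and comultiplication are morphisms of (braided) algebras
  counit_one : D.counit 1 = 1
  counit_mul : ∀ x y, D.counit (x * y) = D.counit x * D.counit y
  comul_one : D.comul 1 = 1 ⊗ₜ 1
  comul_mul : ∀ x y, D.comul (x * y) = D.braidedMul (D.comul x ⊗ₜ D.comul y)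
  -- there is an antipode
  antipode : ∃ S : R →ₗ[k] R, ∀ x,
    LinearMap.mul' k R (S.rTensor R (D.comul x)) = algebraMap k R (D.counit x) ∧
    LinearMap.mul' k R (S.lTensor R (D.comul x)) = algebraMap k R (D.counit x)
  -- everything is graded
  isInternal : DirectSum.IsInternal D.deg
  one_deg : (1 : R) ∈ D.deg 0
  mul_deg : ∀ m n x y, x ∈ D.deg m → y ∈ D.deg n → x * y ∈ D.deg (m + n)
  act_deg : ∀ h n x, x ∈ D.deg n → D.act h x ∈ D.deg n
  coact_deg : ∀ n x, x ∈ D.deg n →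
    D.coact x ∈ LinearMap.range ((D.deg n).subtype.lTensor (MonoidAlgebra k G))
  counit_deg : ∀ n x, n ≠ 0 → x ∈ D.deg n → D.counit x = 0
  comul_deg : ∀ n x, x ∈ D.deg n → D.comul x ∈ D.degTensor n

/-- `R` is a Nichols algebra: it is a graded braided Hopf algebra whose degree zero part is the
ground field, whose primitive elements are exactly the elements of degree one, and which is
generated by them as an algebra (it is then the Nichols algebra of the Yetter-Drinfeld module
`R(1)`). -/
structure IsNicholsAlgebra : Prop extends D.IsGradedBraidedHopf where
  deg_zero : D.deg 0 = 1
  primitive_iff : ∀ x, D.comul x = x ⊗ₜ 1 + 1 ⊗ₜ x ↔ x ∈ D.deg 1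
  generated : Algebra.adjoin k (D.deg 1 : Set R) = ⊤

/-- The algebra isomorphism `f` is an isomorphism of graded braided Hopf algebras. -/
structure IsIso {R' : Type*} [Ring R'] [Algebra k R'] (D : BraidedData k G R)
    (D' : BraidedData k G R') (f : R ≃ₐ[k] R') : Prop where
  act : ∀ h x, f (D.act h x) = D'.act h (f x)
  coact : ∀ x, D'.coact (f x) = f.toLinearMap.lTensor (MonoidAlgebra k G) (D.coact x)
  comul : ∀ x, D'.comul (f x) = TensorProduct.map f.toLinearMap f.toLinearMap (D.comul x)
  counit : ∀ x, D'.counit (f x) = D.counit x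
  deg : ∀ n x, f x ∈ D'.deg n ↔ x ∈ D.deg n

/-- The structure maps `D'` are induced from `D` along the surjective algebra homomorphism `f`. -/
structure IsInduced {R' : Type*} [Ring R'] [Algebra k R'] (D : BraidedData k G R)
    (D' : BraidedData k G R') (f : R →ₐ[k] R') : Prop where
  surjective : Function.Surjective f
  act : ∀ h x, D'.act h (f x) = f (D.act h x)
  coact : ∀ x, D'.coact (f x) = f.toLinearMap.lTensor (MonoidAlgebra k G) (D.coact x)
  comul : ∀ x, D'.comul (f x) = TensorProduct.map f.toLinearMap f.toLinearMap (D.comul x)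
  counit : ∀ x, D'.counit (f x) = D.counit x
  deg : ∀ n, D'.deg n = (D.deg n).map f.toLinearMap

/-! ### The biproduct (bosonization) `R # kG` on the vector space `R ⊗ kG` -/

/-- `(r # b) (r' # b') = r (b₍₁₎ · r') # b₍₂₎ b'`. -/
def biprodMul : (R ⊗[k] MonoidAlgebra k G) ⊗[k] (R ⊗[k] MonoidAlgebra k G) →ₗ[k]
    R ⊗[k] MonoidAlgebra k G :=
  TensorProduct.map (LinearMap.mul' k R) (LinearMap.mul' k (MonoidAlgebra k G)) ∘ₗ
    midMap (D.actLin.rTensor (MonoidAlgebra k G) ∘ₗ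
      (TensorProduct.rightComm k (MonoidAlgebra k G) (MonoidAlgebra k G) R).toLinearMap ∘ₗ
      (Coalgebra.comul (R := k) (A := MonoidAlgebra k G)).rTensor R)

/-- `Δ (r # b) = (r⁽¹⁾ # (r⁽²⁾)₍₋₁₎ b₍₁₎) ⊗ ((r⁽²⁾)₍₀₎ # b₍₂₎)`. -/
def biprodComul : R ⊗[k] MonoidAlgebra k G →ₗ[k]
    (R ⊗[k] MonoidAlgebra k G) ⊗[k] (R ⊗[k] MonoidAlgebra k G) :=
  midMap ((LinearMap.mul' k (MonoidAlgebra k G)).rTensor R ∘ₗ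
      (TensorProduct.rightComm k (MonoidAlgebra k G) R (MonoidAlgebra k G)).toLinearMap ∘ₗ
      D.coact.rTensor (MonoidAlgebra k G)) ∘ₗ
    TensorProduct.map D.comul (Coalgebra.comul (R := k) (A := MonoidAlgebra k G))

/-- `ε (r # b) = ε r * ε b`. -/
def biprodCounit : R ⊗[k] MonoidAlgebra k G →ₗ[k] k :=
  LinearMap.mul' k k ∘ₗ
    TensorProduct.map D.counit (Coalgebra.counit (R := k) (A := MonoidAlgebra k G))

/-- The homogeneous components `R(n) ⊗ kG`. -/
def biprodDeg (n : ℕ) : Submodule k (R ⊗[k] MonoidAlgebra k G) :=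
  LinearMap.range ((D.deg n).subtype.rTensor (MonoidAlgebra k G))

end BraidedData

/-! ### The diagram of a graded Hopf algebra with degree zero part `kG` -/

/-- A bialgebra `H` with homogeneous components `deg n`, whose degree zero component is identified
with the group algebra `kG` by means of the inclusion `incl`; `proj` is the projection onto the
degree zero component. -/
structure GradedOver (k G H : Type*) [Field k] [Group G] [Ring H] [Bialgebra k H] where
  /-- the homogeneous components -/
  deg : ℕ → Submodule k H
  /-- the inclusion of the degree zero component -/
  incl : MonoidAlgebra k G →ₐc[k] H
  /-- the projection onto the degree zero component -/
  proj : H →ₐc[k] MonoidAlgebra k G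
  proj_incl : ∀ b, proj (incl b) = b
  range_incl : LinearMap.range (incl : MonoidAlgebra k G →ₗ[k] H) = deg 0
  proj_deg : ∀ n a, n ≠ 0 → a ∈ deg n → proj a = 0

namespace GradedOver

variable {k G H : Type*} [Field k] [Group G] [Ring H] [Bialgebra k H] (D : GradedOver k G H)

/-- The right coaction `δ⁺ = (id ⊗ π₀) Δ`. -/
def rcoact : H →ₐ[k] H ⊗[k] MonoidAlgebra k G :=
  (Algebra.TensorProduct.map (AlgHom.id k H) (D.proj : H →ₐ[k] MonoidAlgebra k G)).comp
    (Bialgebra.comulAlgHom k H)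

/-- The diagram: the algebra of right coinvariants `{h | δ⁺ h = h ⊗ 1}`. -/
def diag : Subalgebra k H := AlgHom.equalizer D.rcoact Algebra.TensorProduct.includeLeft

theorem mem_diag {h : H} : h ∈ D.diag ↔ D.rcoact h = h ⊗ₜ 1 := Iff.rfl

theorem rcoact_apply (h : H) : D.rcoact h =
    (D.proj : H →ₗ[k] MonoidAlgebra k G).lTensor H (Coalgebra.comul (R := k) h) := rfl

/-- The linear map `a ⊗ b ↦ a * S b`, where `S` is the antipode of the group algebra. -/
def mulAntipode : H ⊗[k] MonoidAlgebra k G →ₗ[k] H :=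
  LinearMap.mul' k H ∘ₗ
    ((D.incl : MonoidAlgebra k G →ₗ[k] H) ∘ₗ
      HopfAlgebra.antipode k (A := MonoidAlgebra k G)).lTensor H

/-- The projection `ω h = h₍₁₎ ι₀ (S (π₀ h₍₂₎))` onto the diagram. -/
def omega : H →ₗ[k] H := D.mulAntipode ∘ₗ D.rcoact.toLinearMap

theorem mulAntipode_tmul (a : H) (g : G) :
    D.mulAntipode (a ⊗ₜ MonoidAlgebra.single g 1) =
      a * D.incl (MonoidAlgebra.single g⁻¹ 1) := by
  simp [mulAntipode]

theorem rcoact_incl (b : G) : D.rcoact (D.incl (MonoidAlgebra.single b 1)) =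
    D.incl (MonoidAlgebra.single b 1) ⊗ₜ MonoidAlgebra.single b 1 := by
  rw [rcoact_apply, ← CoalgHomClass.map_comp_comul_apply]
  simp [D.proj_incl]

theorem rcoact_rcoact (h : H) :
    D.rcoact.toLinearMap.rTensor (MonoidAlgebra k G) (D.rcoact h) =
      (TensorProduct.assoc k _ _ _).symm
        ((Coalgebra.comul (R := k) (A := MonoidAlgebra k G)).lTensor H (D.rcoact h)) := by
  have h1 : (TensorProduct.map (D.proj : H →ₗ[k] MonoidAlgebra k G)
      (D.proj : H →ₗ[k] MonoidAlgebra k G)) ∘ₗ Coalgebra.comul (R := k) =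
      Coalgebra.comul (R := k) ∘ₗ (D.proj : H →ₗ[k] MonoidAlgebra k G) :=
    LinearMap.ext fun a => CoalgHomClass.map_comp_comul_apply D.proj a
  have h2 : D.rcoact.toLinearMap.rTensor (MonoidAlgebra k G) ∘ₗ
      (D.proj : H →ₗ[k] MonoidAlgebra k G).lTensor H =
      TensorProduct.map ((D.proj : H →ₗ[k] MonoidAlgebra k G).lTensor H)
        (D.proj : H →ₗ[k] MonoidAlgebra k G) ∘ₗ (Coalgebra.comul (R := k)).rTensor H :=
    TensorProduct.ext' fun a b => by simp [rcoact_apply]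
  have h3 : TensorProduct.map ((D.proj : H →ₗ[k] MonoidAlgebra k G).lTensor H)
        (D.proj : H →ₗ[k] MonoidAlgebra k G) ∘ₗ (TensorProduct.assoc k H H H).symm.toLinearMap =
      (TensorProduct.assoc k _ _ _).symm.toLinearMap ∘ₗ
        (TensorProduct.map (D.proj : H →ₗ[k] MonoidAlgebra k G)
          (D.proj : H →ₗ[k] MonoidAlgebra k G)).lTensor H :=
    TensorProduct.ext_threefold' fun a b c => by simp
  rw [rcoact_apply, ← LinearMap.comp_apply, h2, LinearMap.comp_apply,
    ← Coalgebra.coassoc_symm_apply, ← LinearEquiv.coe_toLinearMap, ← LinearMap.comp_apply, h3,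
    LinearMap.comp_apply, ← LinearMap.lTensor_comp_apply, h1, LinearMap.lTensor_comp_apply]
  rfl

theorem rcoact_mulAntipode (X : H ⊗[k] MonoidAlgebra k G) :
    LinearMap.mul' k (H ⊗[k] MonoidAlgebra k G) ((TensorProduct.map D.rcoact.toLinearMap
      (D.rcoact.toLinearMap ∘ₗ (D.incl : MonoidAlgebra k G →ₗ[k] H) ∘ₗ
        HopfAlgebra.antipode k (A := MonoidAlgebra k G))) X) = D.rcoact (D.mulAntipode X) := by
  induction X with
  | zero => simp
  | add a b h1 h2 => simp only [map_add, h1, h2]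
  | tmul a b => simp [mulAntipode]

theorem omega_mem (h : H) : D.omega h ∈ D.diag := by
  rw [mem_diag, omega, LinearMap.comp_apply, AlgHom.toLinearMap_apply, ← rcoact_mulAntipode]
  have h1 : ∀ Y : H ⊗[k] MonoidAlgebra k G,
      LinearMap.mul' k (H ⊗[k] MonoidAlgebra k G) (TensorProduct.map
        LinearMap.id
        (D.rcoact.toLinearMap ∘ₗ (D.incl : MonoidAlgebra k G →ₗ[k] H) ∘ₗ
          HopfAlgebra.antipode k (A := MonoidAlgebra k G))
        ((TensorProduct.assoc k _ _ _).symm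
        ((Coalgebra.comul (R := k) (A := MonoidAlgebra k G)).lTensor H Y))) =
      D.mulAntipode Y ⊗ₜ 1 := by
    intro Y
    induction Y with
    | zero => simp
    | add a b h1 h2 => simp only [map_add, h1, h2, TensorProduct.add_tmul]
    | tmul a b =>
      induction b using MonoidAlgebra.induction_linear with
      | zero => simp
      | add b c h1 h2 => simp only [map_add, h1, h2, TensorProduct.add_tmul, TensorProduct.tmul_add]
      | single g r =>
        have : MonoidAlgebra.single g r = r • MonoidAlgebra.single g (1 : k) := by simp
        rw [this, TensorProduct.tmul_smul]
        simp only [map_smul]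
        rw [← TensorProduct.smul_tmul']
        congr 1
        rw [mulAntipode_tmul]
        simp [rcoact_incl, MonoidAlgebra.one_def]
  rw [← h1, ← rcoact_rcoact]
  congr 1
  rw [← LinearMap.comp_apply, LinearMap.map_comp_rTensor, LinearMap.id_comp]

theorem omega_eq_self {h : H} (hh : h ∈ D.diag) : D.omega h = h := by
  rw [mem_diag] at hh
  rw [omega, LinearMap.comp_apply, AlgHom.toLinearMap_apply, hh, MonoidAlgebra.one_def,
    mulAntipode_tmul]
  simp [← MonoidAlgebra.one_def]

/-- The projection `ω` as a map onto the diagram. -/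
def omegaR : H →ₗ[k] D.diag := D.omega.codRestrict (Subalgebra.toSubmodule D.diag) D.omega_mem

theorem lTensor_omega {h : H} (hh : h ∈ D.diag) :
    D.omega.lTensor H (Coalgebra.comul (R := k) h) = Coalgebra.comul (R := k) h := by
  have h1 : ∀ X : H ⊗[k] H, D.mulAntipode.lTensor H (D.rcoact.toLinearMap.lTensor H X) =
      D.omega.lTensor H X := fun X => by rw [omega, LinearMap.lTensor_comp_apply]
  have h2 : D.rcoact.toLinearMap.lTensor H (Coalgebra.comul (R := k) h) =
      TensorProduct.assoc k _ _ _
        ((Coalgebra.comul (R := k)).rTensor (MonoidAlgebra k G) (D.rcoact h)) := by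
    have h3 : ∀ X : H ⊗[k] H, TensorProduct.assoc k _ _ _
        ((Coalgebra.comul (R := k)).rTensor (MonoidAlgebra k G)
          ((D.proj : H →ₗ[k] MonoidAlgebra k G).lTensor H X)) =
        ((D.proj : H →ₗ[k] MonoidAlgebra k G).lTensor H).lTensor H
          (TensorProduct.assoc k _ _ _ ((Coalgebra.comul (R := k)).rTensor H X)) := by
      intro X
      induction X with
      | zero => simp
      | add a b h1 h2 => simp only [map_add, h1, h2]
      | tmul a b =>
        simp only [LinearMap.lTensor_tmul, LinearMap.rTensor_tmul]
        induction Coalgebra.comul (R := k) a with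
        | zero => simp
        | add a b h1 h2 => simp only [map_add, h1, h2, TensorProduct.add_tmul]
        | tmul a b => simp
    rw [rcoact_apply, h3, Coalgebra.coassoc_apply, ← LinearMap.lTensor_comp_apply]
    rfl
  rw [← h1, h2, (D.mem_diag.1 hh), LinearMap.rTensor_tmul]
  generalize Coalgebra.comul (R := k) h = X
  induction X with
  | zero => simp
  | add a b h1 h2 => simp only [map_add, h1, h2, TensorProduct.add_tmul]
  | tmul a b =>
    rw [TensorProduct.assoc_tmul, LinearMap.lTensor_tmul, MonoidAlgebra.one_def, mulAntipode_tmul,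
      inv_one, ← MonoidAlgebra.one_def, map_one, mul_one]

theorem adjoint_mem (g : G) {h : H} (hh : h ∈ D.diag) :
    D.incl (MonoidAlgebra.single g 1) * h * D.incl (MonoidAlgebra.single g⁻¹ 1) ∈ D.diag := by
  rw [mem_diag] at hh ⊢
  rw [map_mul, map_mul, hh, rcoact_incl, rcoact_incl]
  simp [MonoidAlgebra.one_def]

/-- The structure maps on the diagram `R`: the adjoint action `g ⇀ x = g x g⁻¹`, the coaction
`δ⁻ x = π₀ x₍₁₎ ⊗ x₍₂₎`, the comultiplication `Δ_R = (ω ⊗ id) Δ`, the counit of `H` and the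
grading induced by that of `H`.  As `Δ R ⊆ H ⊗ R` and `ω` is the identity on `R`,
the projection `ω` may be applied to the right tensor factor in order to obtain maps
with values in `kG ⊗ R` and in `R ⊗ R`; see `diagData_coact` and `diagData_comul`. -/
def diagData : BraidedData k G D.diag where
  act :=
    { toFun g :=
        { toFun x := ⟨D.incl (MonoidAlgebra.single g 1) * x *
            D.incl (MonoidAlgebra.single g⁻¹ 1), D.adjoint_mem g x.2⟩
          map_add' x y := by ext; simp [mul_add, add_mul]
          map_smul' r x := by ext; simp }
      map_one' := by ext x; simp [← MonoidAlgebra.one_def]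
      map_mul' g h := by
        ext x
        have h1 : MonoidAlgebra.single (g * h) (1 : k) =
          MonoidAlgebra.single g 1 * MonoidAlgebra.single h 1 := by simp
        have h2 : MonoidAlgebra.single (g * h)⁻¹ (1 : k) =
          MonoidAlgebra.single h⁻¹ 1 * MonoidAlgebra.single g⁻¹ 1 := by simp
        simp only [h1, h2, map_mul, mul_assoc, LinearMap.coe_mk, AddHom.coe_mk, Module.End.mul_apply] }
  coact := TensorProduct.map (D.proj : H →ₗ[k] MonoidAlgebra k G) D.omegaR ∘ₗ
    Coalgebra.comul ∘ₗ D.diag.val.toLinearMap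
  comul := TensorProduct.map D.omegaR D.omegaR ∘ₗ Coalgebra.comul ∘ₗ D.diag.val.toLinearMap
  counit := Coalgebra.counit ∘ₗ D.diag.val.toLinearMap
  deg n := (D.deg n).comap D.diag.val.toLinearMap

theorem diagData_coact (x : D.diag) :
    D.diag.val.toLinearMap.lTensor (MonoidAlgebra k G) (D.diagData.coact x) =
      (D.proj : H →ₗ[k] MonoidAlgebra k G).rTensor H (Coalgebra.comul (R := k) (x : H)) := by
  conv_rhs => rw [← D.lTensor_omega x.2]
  have h1 : D.diag.val.toLinearMap ∘ₗ D.omegaR = D.omega := rfl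
  rw [← h1, diagData, LinearMap.comp_apply, ← LinearMap.comp_apply _ (TensorProduct.map _ _),
    LinearMap.lTensor_comp_map, ← LinearMap.comp_apply _ (LinearMap.lTensor _ _),
    LinearMap.rTensor_comp_lTensor]
  rfl

theorem diagData_comul (x : D.diag) :
    TensorProduct.map D.diag.val.toLinearMap D.diag.val.toLinearMap (D.diagData.comul x) =
      D.omega.rTensor H (Coalgebra.comul (R := k) (x : H)) := by
  conv_rhs => rw [← D.lTensor_omega x.2]
  have h1 : D.diag.val.toLinearMap ∘ₗ D.omegaR = D.omega := rfl
  rw [diagData, LinearMap.comp_apply, ← LinearMap.comp_apply _ (TensorProduct.map _ _),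
    ← TensorProduct.map_comp, h1, ← LinearMap.comp_apply _ (LinearMap.lTensor _ _),
    LinearMap.rTensor_comp_lTensor]
  rfl

/-- The linear isomorphism `f` from the biproduct `R # kG` to `H` is an isomorphism of graded
Hopf algebras. -/
structure IsBiprodIso {R : Type*} [Ring R] [Algebra k R] (D : GradedOver k G H)
    (B : BraidedData k G R) (f : (R ⊗[k] MonoidAlgebra k G) ≃ₗ[k] H) : Prop where
  one : f (1 ⊗ₜ 1) = 1
  mul : ∀ x y, f (B.biprodMul (x ⊗ₜ y)) = f x * f y
  comul : ∀ x, Coalgebra.comul (R := k) (f x) =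
    TensorProduct.map f.toLinearMap f.toLinearMap (B.biprodComul x)
  counit : ∀ x, Coalgebra.counit (R := k) (f x) = B.biprodCounit x
  deg : ∀ n x, f x ∈ D.deg n ↔ x ∈ B.biprodDeg n

end GradedOver

/-! ### Sub-bialgebras -/

/-- If an algebra `A` embeds into a bialgebra `H` and the comultiplication of `H` restricts to `A`,
then `A` is a bialgebra. -/
abbrev bialgebraOfInjective {k A H : Type*} [Field k] [Ring A] [Algebra k A] [Ring H]
    [Bialgebra k H] (i : A →ₐ[k] H) (hi : Function.Injective i) (Δ : A →ₐ[k] A ⊗[k] A)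
    (hΔ : ∀ a, TensorProduct.map i.toLinearMap i.toLinearMap (Δ a) =
      Coalgebra.comul (R := k) (i a)) : Bialgebra k A :=
  Bialgebra.ofAlgHom Δ ((Bialgebra.counitAlgHom k H).comp i)
    (by
      ext a
      have inj3 : Function.Injective (TensorProduct.map i.toLinearMap
          (TensorProduct.map i.toLinearMap i.toLinearMap)) :=
        TensorProduct.map_injective_of_flat_flat _ _ hi
          (TensorProduct.map_injective_of_flat_flat _ _ hi hi)
      apply inj3
      have h1 : ∀ X : A ⊗[k] A, TensorProduct.map i.toLinearMap
          (TensorProduct.map i.toLinearMap i.toLinearMap)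
          (TensorProduct.assoc k A A A (TensorProduct.map Δ.toLinearMap LinearMap.id X)) =
          TensorProduct.assoc k H H H ((Coalgebra.comul (R := k)).rTensor H
            (TensorProduct.map i.toLinearMap i.toLinearMap X)) := by
        intro X
        induction X with
        | zero => simp only [map_zero]
        | add x y h1 h2 => simp only [map_add, h1, h2]
        | tmul x y =>
          simp only [TensorProduct.map_tmul, LinearMap.rTensor_tmul, AlgHom.toLinearMap_apply]
          rw [← hΔ]
          induction Δ x with
          | zero => simp only [map_zero, TensorProduct.zero_tmul]
          | add x y h1 h2 => simp only [map_add, TensorProduct.add_tmul, h1, h2]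
          | tmul x z => simp
      have h2 : ∀ X : A ⊗[k] A, TensorProduct.map i.toLinearMap
          (TensorProduct.map i.toLinearMap i.toLinearMap)
          (TensorProduct.map LinearMap.id Δ.toLinearMap X) =
          (Coalgebra.comul (R := k)).lTensor H
            (TensorProduct.map i.toLinearMap i.toLinearMap X) := by
        intro X
        induction X with
        | zero => simp only [map_zero]
        | add x y h1 h2 => simp only [map_add, h1, h2]
        | tmul x y =>
          simp only [LinearMap.lTensor_tmul, AlgHom.toLinearMap_apply, TensorProduct.map_tmul]
          rw [← hΔ]
          rfl
      refine (h1 (Δ a)).trans (Eq.trans ?_ (h2 (Δ a)).symm)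
      rw [hΔ, Coalgebra.coassoc_apply])
    (by
      ext a
      have inj' : Function.Injective (i.toLinearMap.lTensor k) :=
        Module.Flat.lTensor_preserves_injective_linearMap _ hi
      apply inj'
      have h1 : ∀ X : A ⊗[k] A, i.toLinearMap.lTensor k (Algebra.TensorProduct.map
          ((Bialgebra.counitAlgHom k H).comp i) (AlgHom.id k A) X) =
          (Coalgebra.counit (R := k)).rTensor H
            (TensorProduct.map i.toLinearMap i.toLinearMap X) := by
        intro X
        induction X with
        | zero => simp only [map_zero]
        | add x y h1 h2 => simp only [map_add, h1, h2]
        | tmul x y => simp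
      refine (h1 (Δ a)).trans ?_
      rw [hΔ, Coalgebra.rTensor_counit_comul]
      simp)
    (by
      ext a
      have inj' : Function.Injective (i.toLinearMap.rTensor k) :=
        Module.Flat.rTensor_preserves_injective_linearMap _ hi
      apply inj'
      have h1 : ∀ X : A ⊗[k] A, i.toLinearMap.rTensor k (Algebra.TensorProduct.map
          (AlgHom.id k A) ((Bialgebra.counitAlgHom k H).comp i) X) =
          (Coalgebra.counit (R := k)).lTensor H
            (TensorProduct.map i.toLinearMap i.toLinearMap X) := by
        intro X
        induction X with
        | zero => simp only [map_zero]
        | add x y h1 h2 => simp only [map_add, h1, h2]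
        | tmul x y => simp
      refine (h1 (Δ a)).trans ?_
      rw [hΔ, Coalgebra.lTensor_counit_comul]
      simp)

section SubBialgebra

variable {k H : Type*} [Field k] [Ring H] [Bialgebra k H] (A : Subalgebra k H)

theorem subalgebra_map_injective :
    Function.Injective (Algebra.TensorProduct.map A.val A.val) :=
  TensorProduct.map_injective_of_flat_flat A.val.toLinearMap A.val.toLinearMap
    Subtype.val_injective Subtype.val_injective

/-- The restriction of the comultiplication to a subalgebra `A` with `Δ A ⊆ A ⊗ A`. -/
def subComul (hA : ∀ a ∈ A, Coalgebra.comul (R := k) a ∈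
    (Algebra.TensorProduct.map A.val A.val).range) : A →ₐ[k] A ⊗[k] A :=
  (AlgEquiv.ofInjective _ (subalgebra_map_injective A)).symm.toAlgHom.comp
    (((Bialgebra.comulAlgHom k H).comp A.val).codRestrict
      (Algebra.TensorProduct.map A.val A.val).range fun a => hA a a.2)

theorem map_subComul (hA : ∀ a ∈ A, Coalgebra.comul (R := k) a ∈
    (Algebra.TensorProduct.map A.val A.val).range) (a : A) :
    TensorProduct.map A.val.toLinearMap A.val.toLinearMap (subComul A hA a) =
      Coalgebra.comul (R := k) (a : H) :=
  congrArg Subtype.val ((AlgEquiv.ofInjective _ (subalgebra_map_injective A)).apply_symm_apply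
    ⟨Coalgebra.comul (R := k) (a : H), hA a a.2⟩)

/-- A subalgebra `A` of a bialgebra `H` over a field with `Δ A ⊆ A ⊗ A` is a bialgebra, with the
restrictions of the structure maps of `H`. -/
abbrev subBialgebra (hA : ∀ a ∈ A, Coalgebra.comul (R := k) a ∈
    (Algebra.TensorProduct.map A.val A.val).range) : Bialgebra k A :=
  bialgebraOfInjective A.val Subtype.val_injective (subComul A hA) (map_subComul A hA)

end SubBialgebra

/-- An element system with characters: central elements `g i` and characters `χ i`. -/
structure ESC (k G J : Type*) [Field k] [Group G] where
  /-- the family of group elements -/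
  g : J → G
  g_central : ∀ i, g i ∈ Subgroup.center G
  /-- the family of characters -/
  χ : J → (G →* kˣ)

namespace ESC

variable {k G J : Type*} [Field k] [Group G] (E : ESC k G J)

/-- `q i = χ i (g i)`. -/
def q (i : J) : kˣ := E.χ i (E.g i)

open Classical in
/-- The order of `q i`, taken to be infinite if `q i` is not a root of unity or `q i = 1`. -/
def N (i : J) : ℕ∞ :=
  if orderOf (E.q i) = 0 ∨ E.q i = 1 then ⊤ else (orderOf (E.q i) : ℕ∞)

/-- Quantum weak commutativity. -/
def IsQuantumWeaklyCommutative : Prop :=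
  ∀ i j, i ≠ j → E.χ i (E.g j) * E.χ j (E.g i) = 1

/-- The system `(G, g i, (χ i)⁻¹)`. -/
def inv : ESC k G J where
  g := E.g
  g_central := E.g_central
  χ i := (E.χ i)⁻¹

theorem g_comm (i : J) (x : G) : E.g i * x = x * E.g i :=
  ((Subgroup.mem_center_iff.1 (E.g_central i)) x).symm

/-! ### The co-path Hopf algebra

The Hopf quiver has vertex set `G` and, for every `x : G` and `i : J`, one arrow
`a i x : x ⟶ g i * x`.  A path is encoded by its start vertex `x` and the list
`[iₙ, …, i₁]` of the labels of its arrows, the last arrow first.  The `kG`-Hopf bimodule structure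
on the span of the arrows is
`h · a i x = a i (h x)`, `a i x · h = χ i h • a i (x h)`,
`δ⁻ (a i x) = g i x ⊗ a i x`, `δ⁺ (a i x) = a i x ⊗ x`. -/

/-- The end vertex of a path. -/
def target : List J → G → G
  | [], x => x
  | i :: u, x => E.g i * target u x

theorem target_nil (x : G) : E.target [] x = x := rfl

theorem target_cons (i : J) (u : List J) (x : G) :
    E.target (i :: u) x = E.g i * E.target u x := rfl

/-- The vector space with basis the paths of the Hopf quiver of `E`: the underlying space of the
path coalgebra, i.e. of the cotensor coalgebra of the arrow bicomodule. -/
def CoPath (_E : ESC k G J) : Type _ := (List J × G) →₀ k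

namespace CoPath

instance : AddCommGroup E.CoPath := inferInstanceAs (AddCommGroup ((List J × G) →₀ k))
instance : Module k E.CoPath := inferInstanceAs (Module k ((List J × G) →₀ k))

/-- The basis of paths. -/
def basis : Module.Basis (List J × G) k E.CoPath := Finsupp.basisSingleOne

/-- A path, as an element of the path coalgebra. -/
def path (u : List J) (x : G) : E.CoPath := basis E (u, x)

/-- Linear extension of a function on paths. -/
def lift {M : Type*} [AddCommGroup M] [Module k M] (f : List J → G → M) : E.CoPath →ₗ[k] M :=
  (basis E).constr k fun p => f p.1 p.2

@[simp] theorem lift_path {M : Type*} [AddCommGroup M] [Module k M] (f : List J → G → M)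
    (u : List J) (x : G) : lift E f (path E u x) = f u x := by
  simp [lift, path]

variable {E} in
theorem ext {M : Type*} [AddCommGroup M] [Module k M] {f f' : E.CoPath →ₗ[k] M}
    (h : ∀ u x, f (path E u x) = f' (path E u x)) : f = f' :=
  (basis E).ext fun p => h p.1 p.2

/-- Composition of a path with the arrow labelled `i` starting at its end vertex. -/
def cons (i : J) : E.CoPath →ₗ[k] E.CoPath := lift E fun u x => path E (i :: u) x

@[simp] theorem cons_path (i : J) (u : List J) (x : G) :
    cons E i (path E u x) = path E (i :: u) x := by simp [cons]

/-- The product of two paths: the two paths are shuffled in all possible ways, the arrows of each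
of them being moved by the (left or right) action of the vertices of the other one.
The last arrow of a summand is either the last arrow of the left path, acted upon from the right
by the end vertex of the right path, or the last arrow of the right path, acted upon from the left
by the end vertex of the left path.  This is the product for which the path coalgebra is a graded
bialgebra and which restricts to the product of `kG` and to the bimodule structure on the arrows. -/
def mulPath : List J → G → List J → G → E.CoPath
  | [], x, v, y => path E v (x * y)
  | i :: u, x, [], y => (E.χ i y : k) • cons E i (mulPath u x [] y)
  | i :: u, x, j :: v, y =>
      (E.χ i (E.target (j :: v) y) : k) • cons E i (mulPath u x (j :: v) y) +
        cons E j (mulPath (i :: u) x v y)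
termination_by u _ v _ => u.length + v.length

/-- The product of the co-path Hopf algebra, as a bilinear map. -/
def mulBilin : E.CoPath →ₗ[k] E.CoPath →ₗ[k] E.CoPath :=
  lift E fun u x => lift E fun v y => mulPath E u x v y

instance : Mul E.CoPath := ⟨fun a b => mulBilin E a b⟩
instance : One E.CoPath := ⟨path E [] 1⟩

theorem mul_def (a b : E.CoPath) : a * b = mulBilin E a b := rfl
theorem one_def : (1 : E.CoPath) = path E [] 1 := rfl

theorem path_mul_path (u : List J) (x : G) (v : List J) (y : G) :
    path E u x * path E v y = mulPath E u x v y := by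
  simp [mul_def, mulBilin]

/-- The action of the character `χ i` at the end vertex. -/
def twist (i : J) : E.CoPath →ₗ[k] E.CoPath :=
  lift E fun u x => (E.χ i (E.target u x) : k) • path E u x

theorem twist_path (i : J) (u : List J) (x : G) :
    twist E i (path E u x) = (E.χ i (E.target u x) : k) • path E u x := by simp [twist]

theorem twist_cons (i j : J) (a : E.CoPath) :
    twist E i (cons E j a) = (E.χ i (E.g j) : k) • cons E j (twist E i a) := by
  suffices h : twist E i ∘ₗ cons E j = (E.χ i (E.g j) : k) • cons E j ∘ₗ twist E i from
    LinearMap.congr_fun h a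
  refine ext fun u x => ?_
  simp [twist_path, target, mul_smul]

theorem add_mul' (a b c : E.CoPath) : (a + b) * c = a * c + b * c := by simp [mul_def]
theorem mul_add' (a b c : E.CoPath) : a * (b + c) = a * b + a * c := by simp [mul_def]
theorem smul_mul' (r : k) (a c : E.CoPath) : (r • a) * c = r • (a * c) := by simp [mul_def]
theorem mul_smul' (r : k) (a c : E.CoPath) : a * (r • c) = r • (a * c) := by simp [mul_def]

variable {E} in
@[elab_as_elim]
theorem ind {P : E.CoPath → Prop} (a : E.CoPath) (h0 : P 0)
    (ha : ∀ a b, P a → P b → P (a + b)) (hs : ∀ (r : k) a, P a → P (r • a))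
    (hp : ∀ u x, P (path E u x)) : P a := by
  have : a ∈ Submodule.span k (Set.range (basis E)) := by rw [(basis E).span_eq]; trivial
  induction this using Submodule.span_induction with
  | mem x h => obtain ⟨p, rfl⟩ := h; exact hp p.1 p.2
  | zero => exact h0
  | add a b _ _ h1 h2 => exact ha a b h1 h2
  | smul r a _ h => exact hs r a h

theorem vertex_mul_cons (x : G) (j : J) (b : E.CoPath) :
    path E [] x * cons E j b = cons E j (path E [] x * b) := by
  induction b using ind with
  | h0 => simp [mul_def]
  | ha a b h1 h2 => simp only [mul_add', map_add, h1, h2]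
  | hs r a h => simp only [mul_smul', map_smul, h]
  | hp v y => simp [path_mul_path, mulPath]

theorem cons_mul_vertex (i : J) (a : E.CoPath) (y : G) :
    cons E i a * path E [] y = (E.χ i y : k) • cons E i (a * path E [] y) := by
  induction a using ind with
  | h0 => simp [mul_def]
  | ha a b h1 h2 => simp only [add_mul', map_add, h1, h2, smul_add]
  | hs r a h => simp only [smul_mul', map_smul, h, smul_comm r]
  | hp v y => simp [path_mul_path, mulPath]

theorem cons_mul_cons (i j : J) (a b : E.CoPath) :
    cons E i a * cons E j b =
      cons E i (a * twist E i (cons E j b)) + cons E j (cons E i a * b) := by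
  induction a using ind with
  | h0 => simp [mul_def]
  | ha a b h1 h2 => simp only [add_mul', map_add, h1, h2]; abel
  | hs r a h => simp only [smul_mul', map_smul, h, smul_add]
  | hp u x =>
    induction b using ind with
    | h0 => simp [mul_def]
    | ha a b h1 h2 => simp only [mul_add', map_add, h1, h2]; abel
    | hs r a h => simp only [mul_smul', map_smul, h, smul_add]
    | hp v y =>
      simp only [cons_path, path_mul_path, twist_path, mul_smul', map_smul]
      rw [mulPath]

theorem vertex_mul_path (x : G) (v : List J) (y : G) :
    path E [] x * path E v y = path E v (x * y) := by
  rw [path_mul_path, mulPath]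

theorem target_mul (x : G) (v : List J) (y : G) :
    E.target v (x * y) = x * E.target v y := by
  induction v with
  | nil => rfl
  | cons i v ih => rw [target, ih, target, ← mul_assoc, ← mul_assoc, E.g_comm]

theorem twist_mul (l : J) (a b : E.CoPath) :
    twist E l (a * b) = twist E l a * twist E l b := by
  induction a using ind with
  | h0 => simp [mul_def]
  | ha a b h1 h2 => simp only [add_mul', map_add, h1, h2]
  | hs r a h => simp only [smul_mul', map_smul, h]
  | hp u x =>
  induction u generalizing b with
  | nil =>
    induction b using ind with
    | h0 => simp [mul_def]
    | ha a b h1 h2 => simp only [mul_add', map_add, h1, h2]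
    | hs r a h => simp only [mul_smul', map_smul, h]
    | hp v y =>
      simp only [vertex_mul_path, twist_path, target_mul, smul_mul', mul_smul', smul_smul, target,
        map_mul, Units.val_mul, mul_comm]
  | cons i u ih =>
    induction b using ind with
    | h0 => simp [mul_def]
    | ha a b h1 h2 => simp only [mul_add', map_add, h1, h2]
    | hs r a h => simp only [mul_smul', map_smul, h]
    | hp v y =>
      induction v with
      | nil =>
        have h := ih (path E [] y)
        rw [← cons_path, cons_mul_vertex, map_smul, twist_cons, h, twist_cons, twist_path E l [],
          smul_mul', mul_smul', mul_smul', cons_mul_vertex]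
        simp only [map_smul, smul_smul]
        congr 1
        ring
      | cons j v ihv =>
        have h := ih (twist E i (path E (j :: v) y))
        have hc : ∀ c, twist E l (twist E i c) = twist E i (twist E l c) := by
          intro c
          induction c using ind with
          | h0 => simp
          | ha a b h1 h2 => simp only [map_add, h1, h2]
          | hs r a h => simp only [map_smul, h]
          | hp v y => simp only [twist_path, map_smul, smul_smul, mul_comm]
        simp only [← cons_path] at h ihv ⊢
        rw [cons_mul_cons, map_add, twist_cons, h, twist_cons E l j, ihv]
        simp only [twist_cons, smul_mul', mul_smul', map_smul, cons_mul_cons, smul_add, smul_smul,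
          hc]
        congr 2
        ring

theorem vertex_assoc (x : G) (b c : E.CoPath) :
    path E [] x * b * c = path E [] x * (b * c) := by
  induction b using ind with
  | h0 => simp [mul_def]
  | ha a b h1 h2 => simp only [mul_add', add_mul', h1, h2]
  | hs r a h => simp only [smul_mul', mul_smul', h]
  | hp v y =>
    induction v generalizing c with
    | nil =>
      induction c using ind with
      | h0 => simp [mul_def]
      | ha a b h1 h2 => simp only [mul_add', h1, h2]
      | hs r a h => simp only [mul_smul', h]
      | hp w z => simp only [vertex_mul_path, mul_assoc]
    | cons j v ih =>
      induction c using ind with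
      | h0 => simp [mul_def]
      | ha a b h1 h2 => simp only [mul_add', h1, h2]
      | hs r a h => simp only [mul_smul', h]
      | hp w z =>
        induction w with
        | nil =>
          rw [← cons_path, vertex_mul_cons, cons_mul_vertex, cons_mul_vertex, mul_smul',
            vertex_mul_cons, ih]
        | cons l w ihw =>
          simp only [← cons_path] at ihw ⊢
          rw [vertex_mul_cons, cons_mul_cons, cons_mul_cons, mul_add',
            vertex_mul_cons, vertex_mul_cons, ih, ← ihw, vertex_mul_cons E x j (path E v y)]

theorem mul_assoc' (a b c : E.CoPath) : a * b * c = a * (b * c) := by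
  induction a using ind with
  | h0 => simp [mul_def]
  | ha a b h1 h2 => simp only [add_mul', h1, h2]
  | hs r a h => simp only [smul_mul', h]
  | hp u x =>
  induction u generalizing b c with
  | nil => exact vertex_assoc E x b c
  | cons i u ih =>
  induction b using ind with
  | h0 => simp [mul_def]
  | ha a b h1 h2 => simp only [add_mul', mul_add', h1, h2]
  | hs r a h => simp only [smul_mul', mul_smul', h]
  | hp v y =>
  induction v generalizing c with
  | nil =>
    induction c using ind with
    | h0 => simp [mul_def]
    | ha a b h1 h2 => simp only [mul_add', h1, h2]
    | hs r a h => simp only [mul_smul', h]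
    | hp w z =>
    induction w with
    | nil =>
      rw [← cons_path, cons_mul_vertex, smul_mul', cons_mul_vertex, ih, vertex_mul_path,
        cons_mul_vertex, smul_smul, MonoidHom.map_mul, Units.val_mul, mul_comm]
    | cons l w ihw =>
      simp only [← cons_path] at ihw ⊢
      rw [cons_mul_vertex, smul_mul', cons_mul_cons, ih,
        vertex_mul_cons, cons_mul_cons, smul_add, ← map_smul (cons E l), ← smul_mul',
        ← cons_mul_vertex, ihw, ← vertex_mul_cons, twist_mul, twist_path, smul_mul',
        mul_smul', map_smul]
      rfl
  | cons j v ihv =>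
    induction c using ind with
    | h0 => simp [mul_def]
    | ha a b h1 h2 => simp only [mul_add', h1, h2]
    | hs r a h => simp only [mul_smul', h]
    | hp w z =>
    induction w with
    | nil =>
      have h2 := ihv (path E [] z)
      rw [← cons_path] at h2 ⊢
      rw [← cons_path E j, cons_mul_cons, add_mul', cons_mul_vertex,
        cons_mul_vertex, ih, h2, cons_mul_vertex, mul_smul', cons_mul_cons, smul_add]
      congr 1
      have h3 : (E.χ i z : k) • (twist E i (cons E j (path E v y)) * path E [] z) =
          (E.χ j z : k) • twist E i (cons E j (path E v y * path E [] z)) := by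
        rw [← map_smul (twist E i), ← cons_mul_vertex, twist_mul, twist_path, mul_smul']
        rfl
      have h4 := congrArg (fun t => cons E i (path E u x * t)) h3
      simp only [mul_smul', map_smul] at h4 ⊢
      exact h4
    | cons l w ihw =>
      have h2 := ihv (twist E j (cons E l (path E w z)))
      simp only [← cons_path] at h2 ihw ⊢
      rw [cons_mul_cons E i j, add_mul', cons_mul_cons, cons_mul_cons, ih, h2,
        cons_mul_cons E j l, mul_add', cons_mul_cons, cons_mul_cons E i l, ← ihw,
        cons_mul_cons E i j, add_mul', map_add, ← twist_mul, cons_mul_cons E j l, map_add (twist E i),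
        mul_add', map_add (cons E i)]
      abel

instance : Ring E.CoPath where
  __ := (inferInstance : AddCommGroup E.CoPath)
  left_distrib := mul_add' E
  right_distrib := add_mul' E
  zero_mul a := by simp [mul_def]
  mul_zero a := by simp [mul_def]
  mul_assoc := mul_assoc' E
  one_mul a := by
    induction a using ind with
    | h0 => simp [mul_def]
    | ha a b h1 h2 => simp only [mul_add', h1, h2]
    | hs r a h => simp only [mul_smul', h]
    | hp w z => rw [one_def, vertex_mul_path, one_mul]
  mul_one a := by
    induction a using ind with
    | h0 => simp [mul_def]
    | ha a b h1 h2 => simp only [add_mul', h1, h2]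
    | hs r a h => simp only [smul_mul', h]
    | hp w z =>
      induction w with
      | nil => rw [one_def, vertex_mul_path, mul_one]
      | cons i w ih =>
        rw [← cons_path, one_def, cons_mul_vertex, ← one_def, ih, map_one, Units.val_one, one_smul]

instance : Algebra k E.CoPath :=
  Algebra.ofModule (smul_mul' E) fun r a b => mul_smul' E r a b

/-- The comultiplication of a path: all ways of cutting it into two pieces. -/
def comulPath : List J → G → E.CoPath ⊗[k] E.CoPath
  | [], x => path E [] x ⊗ₜ path E [] x
  | i :: u, x =>
      path E [] (E.target (i :: u) x) ⊗ₜ path E (i :: u) x +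
        (cons E i).rTensor E.CoPath (comulPath u x)

/-- The comultiplication of the path coalgebra. -/
def comulLin : E.CoPath →ₗ[k] E.CoPath ⊗[k] E.CoPath := lift E (comulPath E)

open Classical in
/-- The counit of the path coalgebra. -/
def counitLin : E.CoPath →ₗ[k] k := lift E fun u _ => if u = [] then 1 else 0

theorem comulLin_vertex (x : G) :
    comulLin E (path E [] x) = path E [] x ⊗ₜ path E [] x := by
  simp [comulLin, comulPath]

theorem comulLin_cons_path (i : J) (u : List J) (x : G) :
    comulLin E (cons E i (path E u x)) =
      path E [] (E.g i * E.target u x) ⊗ₜ cons E i (path E u x) +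
        (cons E i).rTensor E.CoPath (comulLin E (path E u x)) := by
  simp [comulLin, comulPath, target]

/-- The span of the paths with a given end vertex. -/
def tgt (h : G) : Submodule k E.CoPath :=
  Submodule.span k {a | ∃ u x, E.target u x = h ∧ path E u x = a}

theorem path_mem_tgt (u : List J) (x : G) : path E u x ∈ tgt E (E.target u x) :=
  Submodule.subset_span ⟨u, x, rfl, rfl⟩

theorem cons_mem_tgt {i : J} {a : E.CoPath} {h : G} (ha : a ∈ tgt E h) :
    cons E i a ∈ tgt E (E.g i * h) := by
  induction ha using Submodule.span_induction with
  | mem x hx =>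
    obtain ⟨u, x, rfl, rfl⟩ := hx
    rw [cons_path]
    exact path_mem_tgt E (i :: u) x
  | zero => simp
  | add a b _ _ h1 h2 => rw [map_add]; exact add_mem h1 h2
  | smul r a _ h => rw [map_smul]; exact Submodule.smul_mem _ _ h

theorem mulPath_mem_tgt (u : List J) (x : G) (v : List J) (y : G) :
    mulPath E u x v y ∈ tgt E (E.target u x * E.target v y) := by
  fun_induction mulPath E u x v y with
  | case1 x v y => rw [target, ← target_mul]; exact path_mem_tgt E v (x * y)
  | case2 i u x y ih =>
    refine Submodule.smul_mem _ _ ?_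
    rw [target_cons, mul_assoc]
    exact cons_mem_tgt E ih
  | case3 i u x j v y ih1 ih2 =>
    refine add_mem (Submodule.smul_mem _ _ ?_) ?_
    · rw [target_cons, mul_assoc]
      exact cons_mem_tgt E ih1
    · rw [E.target_cons j v, ← mul_assoc, ← E.g_comm, mul_assoc]
      exact cons_mem_tgt E ih2

theorem comulLin_cons {i : J} {a : E.CoPath} {h : G} (ha : a ∈ tgt E h) :
    comulLin E (cons E i a) =
      path E [] (E.g i * h) ⊗ₜ cons E i a + (cons E i).rTensor E.CoPath (comulLin E a) := by
  induction ha using Submodule.span_induction with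
  | mem x hx =>
    obtain ⟨u, x, rfl, rfl⟩ := hx
    exact comulLin_cons_path E i u x
  | zero => simp
  | add a b _ _ h1 h2 => simp only [map_add, h1, h2, TensorProduct.tmul_add]; abel
  | smul r a _ h => simp only [map_smul, h, TensorProduct.tmul_smul, smul_add]

theorem comulLin_path_mem (u : List J) (x : G) :
    comulLin E (path E u x) ∈ Submodule.span k
      {z : E.CoPath ⊗[k] E.CoPath | ∃ v y w, E.target v y = E.target u x ∧
        path E v y ⊗ₜ w = z} := by
  induction u with
  | nil =>
    rw [comulLin_vertex]
    exact Submodule.subset_span ⟨[], x, _, rfl, rfl⟩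
  | cons i u ih =>
    rw [← cons_path, comulLin_cons_path]
    refine add_mem (Submodule.subset_span ⟨[], _, _, rfl, rfl⟩) ?_
    revert ih
    generalize comulLin E (path E u x) = X
    intro ih
    induction ih using Submodule.span_induction with
    | mem z hz =>
      obtain ⟨v, y, w, h, rfl⟩ := hz
      exact Submodule.subset_span ⟨i :: v, y, w, by simp [target, h], by simp⟩
    | zero => simp
    | add a b _ _ h1 h2 => rw [map_add]; exact add_mem h1 h2
    | smul r a _ h => rw [map_smul]; exact Submodule.smul_mem _ _ h

theorem rTensor_twist_comul (i : J) (u : List J) (x : G) :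
    (twist E i).rTensor E.CoPath (comulLin E (path E u x)) =
      (E.χ i (E.target u x) : k) • comulLin E (path E u x) := by
  have hm := comulLin_path_mem E u x
  revert hm
  generalize comulLin E (path E u x) = X
  intro hm
  induction hm using Submodule.span_induction with
  | mem z hz =>
    obtain ⟨v, y, w, h, rfl⟩ := hz
    rw [LinearMap.rTensor_tmul, twist_path, h, TensorProduct.smul_tmul']
  | zero => simp
  | add a b _ _ h1 h2 => rw [map_add, h1, h2, smul_add]
  | smul r a _ h => rw [map_smul, h, smul_comm]

theorem rTensor_comul_cons (i : J) (u : List J) (x : G) :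
    (comulLin E ∘ₗ cons E i).rTensor E.CoPath (comulLin E (path E u x)) =
      (TensorProduct.assoc k _ _ _).symm
        (path E [] (E.g i * E.target u x) ⊗ₜ
          (cons E i).rTensor E.CoPath (comulLin E (path E u x))) +
      ((cons E i).rTensor E.CoPath).rTensor E.CoPath
        ((comulLin E).rTensor E.CoPath (comulLin E (path E u x))) := by
  have hm := comulLin_path_mem E u x
  revert hm
  generalize comulLin E (path E u x) = X
  intro hm
  induction hm using Submodule.span_induction with
  | mem z hz =>
    obtain ⟨v, y, w, h, rfl⟩ := hz
    simp only [LinearMap.rTensor_tmul, LinearMap.comp_apply, comulLin_cons_path, h,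
      TensorProduct.add_tmul, TensorProduct.assoc_symm_tmul]
  | zero => simp
  | add a b _ _ h1 h2 => simp only [map_add, h1, h2, TensorProduct.tmul_add]; abel
  | smul r a _ h => simp only [map_smul, h, TensorProduct.tmul_smul, smul_add]

theorem coassoc_path (u : List J) (x : G) :
    TensorProduct.assoc k _ _ _ ((comulLin E).rTensor E.CoPath (comulLin E (path E u x))) =
      (comulLin E).lTensor E.CoPath (comulLin E (path E u x)) := by
  induction u with
  | nil => simp [comulLin_vertex]
  | cons i u ih =>
    have hl : ∀ z : (E.CoPath ⊗[k] E.CoPath) ⊗[k] E.CoPath,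
        TensorProduct.assoc k _ _ _ (((cons E i).rTensor E.CoPath).rTensor E.CoPath z) =
          (cons E i).rTensor _ (TensorProduct.assoc k _ _ _ z) := by
      intro z
      have : (TensorProduct.assoc k _ _ _).toLinearMap ∘ₗ
          ((cons E i).rTensor E.CoPath).rTensor E.CoPath =
          (cons E i).rTensor _ ∘ₗ (TensorProduct.assoc k _ _ _).toLinearMap :=
        TensorProduct.ext_threefold fun a b c => by simp
      exact LinearMap.congr_fun this z
    rw [← cons_path, comulLin_cons_path, map_add, map_add, ← LinearMap.rTensor_comp_apply,
      rTensor_comul_cons, map_add, hl, ih, map_add, LinearMap.rTensor_tmul, LinearMap.lTensor_tmul,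
      comulLin_vertex, comulLin_cons_path, TensorProduct.tmul_add, LinearEquiv.apply_symm_apply,
      TensorProduct.assoc_tmul, add_assoc, ← LinearMap.comp_apply _ ((comulLin E).lTensor E.CoPath),
      LinearMap.rTensor_comp_lTensor, ← LinearMap.comp_apply ((comulLin E).lTensor E.CoPath),
      LinearMap.lTensor_comp_rTensor]

theorem counit_cons (i : J) (a : E.CoPath) : counitLin E (cons E i a) = 0 := by
  suffices h : counitLin E ∘ₗ cons E i = 0 from LinearMap.congr_fun h a
  exact ext fun u x => by simp [counitLin]

theorem counit_vertex (x : G) : counitLin E (path E [] x) = 1 := by simp [counitLin]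

instance : Coalgebra k E.CoPath where
  comul := comulLin E
  counit := counitLin E
  coassoc := ext fun u x => coassoc_path E u x
  rTensor_counit_comp_comul := ext fun u x => by
    induction u with
    | nil => simp [comulLin_vertex, counit_vertex]
    | cons i u ih =>
      have hc : counitLin E ∘ₗ cons E i = 0 := LinearMap.ext (counit_cons E i)
      rw [← cons_path, LinearMap.comp_apply, comulLin_cons_path, map_add,
        ← LinearMap.rTensor_comp_apply, hc, LinearMap.rTensor_tmul, counit_vertex]
      simp
  lTensor_counit_comp_comul := ext fun u x => by
    induction u with
    | nil => simp [comulLin_vertex, counit_vertex]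
    | cons i u ih =>
      rw [LinearMap.comp_apply] at ih
      rw [← cons_path, LinearMap.comp_apply, comulLin_cons_path, map_add, LinearMap.lTensor_tmul,
        counit_cons, ← LinearMap.comp_apply, LinearMap.lTensor_comp_rTensor,
        ← LinearMap.rTensor_comp_lTensor, LinearMap.comp_apply, ih]
      simp

theorem comul_def (a : E.CoPath) : Coalgebra.comul (R := k) a = comulLin E a := rfl

theorem counit_def (a : E.CoPath) : Coalgebra.counit (R := k) a = counitLin E a := rfl

theorem rTensor_cons_mul (i j : J) (X Y : E.CoPath ⊗[k] E.CoPath) :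
    (cons E i).rTensor E.CoPath X * (cons E j).rTensor E.CoPath Y =
      (cons E i).rTensor E.CoPath
        (X * (twist E i).rTensor E.CoPath ((cons E j).rTensor E.CoPath Y)) +
      (cons E j).rTensor E.CoPath ((cons E i).rTensor E.CoPath X * Y) := by
  induction X with
  | zero => simp
  | add a b h1 h2 => simp only [map_add, add_mul, h1, h2]; abel
  | tmul a b =>
    induction Y with
    | zero => simp
    | add a b h1 h2 => simp only [map_add, mul_add, h1, h2]; abel
    | tmul c d =>
      simp only [LinearMap.rTensor_tmul, Algebra.TensorProduct.tmul_mul_tmul, cons_mul_cons,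
        TensorProduct.add_tmul]

theorem rTensor_cons_mul_vertex (i : J) (y : G) (b : E.CoPath) (X : E.CoPath ⊗[k] E.CoPath) :
    (cons E i).rTensor E.CoPath X * (path E [] y ⊗ₜ b) =
      (E.χ i y : k) • (cons E i).rTensor E.CoPath (X * (path E [] y ⊗ₜ b)) := by
  induction X with
  | zero => simp
  | add a b h1 h2 => simp only [map_add, add_mul, h1, h2, smul_add]
  | tmul c d =>
    simp only [LinearMap.rTensor_tmul, Algebra.TensorProduct.tmul_mul_tmul, cons_mul_vertex,
      TensorProduct.smul_tmul']

theorem vertex_mul_rTensor_cons (j : J) (x : G) (a : E.CoPath) (Y : E.CoPath ⊗[k] E.CoPath) :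
    (path E [] x ⊗ₜ a) * (cons E j).rTensor E.CoPath Y =
      (cons E j).rTensor E.CoPath ((path E [] x ⊗ₜ a) * Y) := by
  induction Y with
  | zero => simp
  | add a b h1 h2 => simp only [map_add, mul_add, h1, h2]
  | tmul c d =>
    simp only [LinearMap.rTensor_tmul, Algebra.TensorProduct.tmul_mul_tmul, vertex_mul_cons]

theorem mul_mem_tgt {a b : E.CoPath} {s t : G} (ha : a ∈ tgt E s) (hb : b ∈ tgt E t) :
    a * b ∈ tgt E (s * t) := by
  induction ha using Submodule.span_induction with
  | mem a h =>
    obtain ⟨u, x, rfl, rfl⟩ := h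
    induction hb using Submodule.span_induction with
    | mem b h =>
      obtain ⟨v, y, rfl, rfl⟩ := h
      rw [path_mul_path]
      exact mulPath_mem_tgt E u x v y
    | zero => simp
    | add a b _ _ h1 h2 => rw [mul_add]; exact add_mem h1 h2
    | smul r a _ h => rw [mul_smul_comm]; exact Submodule.smul_mem _ _ h
  | zero => simp
  | add a b _ _ h1 h2 => rw [add_mul]; exact add_mem h1 h2
  | smul r a _ h => rw [smul_mul_assoc]; exact Submodule.smul_mem _ _ h

theorem comul_mul (a b : E.CoPath) :
    comulLin E (a * b) = comulLin E a * comulLin E b := by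
  induction a using ind with
  | h0 => simp
  | ha a b h1 h2 => simp only [add_mul, map_add, h1, h2]
  | hs r a h => simp only [smul_mul_assoc, map_smul, h]
  | hp u x =>
  induction u generalizing b with
  | nil =>
    induction b using ind with
    | h0 => simp
    | ha a b h1 h2 => simp only [mul_add, map_add, h1, h2]
    | hs r a h => simp only [mul_smul_comm, map_smul, h]
    | hp v y =>
    induction v with
    | nil => simp only [vertex_mul_path, comulLin_vertex, Algebra.TensorProduct.tmul_mul_tmul]
    | cons j v ih =>
      rw [← cons_path, vertex_mul_cons,
        comulLin_cons E (mul_mem_tgt E (path_mem_tgt E [] x) (path_mem_tgt E v y)), ih,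
        comulLin_cons_path, mul_add, comulLin_vertex, vertex_mul_rTensor_cons,
        Algebra.TensorProduct.tmul_mul_tmul, vertex_mul_cons, vertex_mul_path, target_nil,
        vertex_mul_path, ← mul_assoc, ← mul_assoc, E.g_comm]
  | cons i u ih =>
    induction b using ind with
    | h0 => simp
    | ha a b h1 h2 => simp only [mul_add, map_add, h1, h2]
    | hs r a h => simp only [mul_smul_comm, map_smul, h]
    | hp v y =>
    induction v with
    | nil =>
      rw [← cons_path, cons_mul_vertex, map_smul,
        comulLin_cons E (mul_mem_tgt E (path_mem_tgt E u x) (path_mem_tgt E [] y)), ih,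
        comulLin_cons_path, add_mul, comulLin_vertex, rTensor_cons_mul_vertex,
        Algebra.TensorProduct.tmul_mul_tmul, cons_mul_vertex, vertex_mul_path, target_nil, smul_add,
        TensorProduct.tmul_smul, mul_assoc]
    | cons j v ihv =>
      have h1 := path_mem_tgt E u x
      have h2 := path_mem_tgt E v y
      have h3 : twist E i (cons E j (path E v y)) ∈ tgt E (E.g j * E.target v y) := by
        rw [cons_path, twist_path]
        exact Submodule.smul_mem _ _ (path_mem_tgt E (j :: v) y)
      have h4 : comulLin E (twist E i (cons E j (path E v y))) =
          (E.χ i (E.g j * E.target v y) : k) •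
            (path E [] (E.g j * E.target v y) ⊗ₜ[k] cons E j (path E v y)) +
          (twist E i).rTensor E.CoPath
            ((cons E j).rTensor E.CoPath (comulLin E (path E v y))) := by
        have h5 := rTensor_twist_comul E i (j :: v) y
        rw [← cons_path, comulLin_cons_path, map_add, smul_add, LinearMap.rTensor_tmul,
          twist_path] at h5
        rw [cons_path, twist_path, map_smul, ← cons_path, comulLin_cons_path, smul_add, ← h5,
          TensorProduct.smul_tmul']
        rfl
      simp only [← cons_path] at ihv ⊢
      have e1 : E.g j * (E.g i * E.target u x * E.target v y) =
          E.g i * E.target u x * (E.g j * E.target v y) := by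
        rw [← mul_assoc, E.g_comm, mul_assoc]
      rw [cons_mul_cons, map_add, comulLin_cons E (mul_mem_tgt E h1 h3), ih, h4,
        comulLin_cons E (mul_mem_tgt E (cons_mem_tgt E h1) h2), ihv, comulLin_cons_path E i u x,
        comulLin_cons_path E j v y, e1, ← mul_assoc]
      simp only [mul_add, add_mul, map_add, rTensor_cons_mul_vertex, vertex_mul_rTensor_cons,
        rTensor_cons_mul, Algebra.TensorProduct.tmul_mul_tmul, vertex_mul_path, cons_mul_cons,
        TensorProduct.tmul_add, mul_smul_comm, map_smul, mul_assoc]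
      abel

instance : Bialgebra k E.CoPath :=
  Bialgebra.mk' k E.CoPath
    (by rw [one_def]; exact counit_vertex E 1)
    (by
      intro a b
      change counitLin E (a * b) = counitLin E a * counitLin E b
      induction a using ind with
      | h0 => simp
      | ha a b h1 h2 => simp only [add_mul, map_add, h1, h2]
      | hs r a h => simp only [smul_mul_assoc, map_smul, h, smul_eq_mul]; ring
      | hp u x =>
      induction b using ind with
      | h0 => simp
      | ha a b h1 h2 => simp only [mul_add, map_add, h1, h2]
      | hs r a h => simp only [mul_smul_comm, map_smul, h, smul_eq_mul]; ring
      | hp v y =>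
      cases u with
      | nil =>
        rw [vertex_mul_path, counit_vertex, one_mul]
        simp [counitLin]
      | cons i u =>
        cases v with
        | nil =>
          rw [← cons_path, cons_mul_vertex, map_smul, counit_cons, counit_cons]; simp
        | cons j v =>
          rw [← cons_path, ← cons_path, cons_mul_cons, map_add, counit_cons, counit_cons,
            counit_cons]; simp)
    (by
      rw [one_def]
      exact comulLin_vertex E 1)
    (fun {a b} => comul_mul E a b)

/-- The span of the paths of length `n`. -/
def deg (n : ℕ) : Submodule k E.CoPath :=
  Submodule.span k {a | ∃ u x, u.length = n ∧ path E u x = a}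

end CoPath

/-! ### Multiple Taft algebras -/

namespace CoPath

/-- The vertices of the quiver, as group-like elements of the co-path Hopf algebra. -/
def vertex : G →* E.CoPath where
  toFun x := path E [] x
  map_one' := rfl
  map_mul' x y := (vertex_mul_path E x [] y).symm

/-- The inclusion of the degree zero part `kG`. -/
def incl : MonoidAlgebra k G →ₐc[k] E.CoPath :=
  BialgHom.ofAlgHom (MonoidAlgebra.lift k E.CoPath G (vertex E))
    (MonoidAlgebra.algHom_ext (fun x => by
      simpa [vertex, counit_def] using counit_vertex E x) (by ext))
    (MonoidAlgebra.algHom_ext (fun x => by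
      simpa [vertex, comul_def] using (comulLin_vertex E x).symm) (by ext))

theorem incl_single (x : G) (r : k) : incl E (MonoidAlgebra.single x r) = r • path E [] x := by
  change MonoidAlgebra.lift k E.CoPath G (vertex E) (MonoidAlgebra.single x r) = _
  simp [vertex]

open Classical in
/-- The projection onto the degree zero part `kG`, as a linear map. -/
def projLin : E.CoPath →ₗ[k] MonoidAlgebra k G :=
  lift E fun u x => if u = [] then MonoidAlgebra.single x 1 else 0

theorem projLin_vertex (x : G) : projLin E (path E [] x) = MonoidAlgebra.single x 1 := by
  simp [projLin]

theorem projLin_cons (i : J) (a : E.CoPath) : projLin E (cons E i a) = 0 := by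
  suffices h : projLin E ∘ₗ cons E i = 0 from LinearMap.congr_fun h a
  exact ext fun u x => by simp [projLin]

theorem projLin_mul (a b : E.CoPath) : projLin E (a * b) = projLin E a * projLin E b := by
  induction a using ind with
  | h0 => simp
  | ha a b h1 h2 => simp only [add_mul, map_add, h1, h2]
  | hs r a h => simp only [smul_mul_assoc, map_smul, h]
  | hp u x =>
  induction b using ind with
  | h0 => simp
  | ha a b h1 h2 => simp only [mul_add, map_add, h1, h2]
  | hs r a h => simp only [mul_smul_comm, map_smul, h]
  | hp v y =>
  cases u with
  | nil =>
    cases v with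
    | nil => rw [vertex_mul_path]; simp [projLin_vertex]
    | cons j v => rw [← cons_path, vertex_mul_cons, projLin_cons, projLin_cons, mul_zero]
  | cons i u =>
    cases v with
    | nil => rw [← cons_path, cons_mul_vertex, map_smul, projLin_cons, projLin_cons, zero_mul,
        smul_zero]
    | cons j v => rw [← cons_path, ← cons_path, cons_mul_cons, map_add, projLin_cons, projLin_cons,
        projLin_cons, zero_mul, add_zero]

/-- The projection onto the degree zero part `kG`. -/
def proj : E.CoPath →ₐc[k] MonoidAlgebra k G :=
  BialgHom.ofAlgHom (AlgHom.ofLinearMap (projLin E) (projLin_vertex E 1) (projLin_mul E))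
    (AlgHom.toLinearMap_injective <| ext fun u x => by
      cases u with
      | nil =>
        have h := counit_vertex E x
        simp only [AlgHom.comp_toLinearMap, LinearMap.comp_apply, AlgHom.toLinearMap_apply,
          AlgHom.ofLinearMap_apply, projLin_vertex]
        simpa [counit_def] using h.symm
      | cons i u =>
        have h := counit_cons E i (path E u x)
        rw [← cons_path]
        simp only [AlgHom.comp_toLinearMap, LinearMap.comp_apply, AlgHom.toLinearMap_apply,
          AlgHom.ofLinearMap_apply, projLin_cons]
        simpa [counit_def] using h.symm)
    (AlgHom.toLinearMap_injective <| ext fun u x => by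
      have hm : ∀ X : E.CoPath ⊗[k] E.CoPath, Algebra.TensorProduct.map
          (AlgHom.ofLinearMap (projLin E) (projLin_vertex E 1) (projLin_mul E))
          (AlgHom.ofLinearMap (projLin E) (projLin_vertex E 1) (projLin_mul E)) X =
          TensorProduct.map (projLin E) (projLin E) X := fun _ => rfl
      simp only [AlgHom.comp_toLinearMap, LinearMap.comp_apply, AlgHom.toLinearMap_apply,
          AlgHom.ofLinearMap_apply, hm, Bialgebra.comulAlgHom_apply, comul_def]
      cases u with
      | nil => rw [comulLin_vertex]; simp [projLin_vertex]
      | cons i u =>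
        have hc : projLin E ∘ₗ cons E i = 0 := LinearMap.ext (projLin_cons E i)
        rw [← cons_path, comulLin_cons_path, projLin_cons, map_add, TensorProduct.map_tmul,
          projLin_cons, ← LinearMap.comp_apply, LinearMap.map_comp_rTensor, hc]
        simp)

theorem proj_apply (a : E.CoPath) : proj E a = projLin E a := rfl

end CoPath

open CoPath

/-- The multiple Taft algebra of `E`: the subalgebra of the co-path Hopf algebra that is generated
by the vertices and the arrows. -/
def Taft : Subalgebra k E.CoPath :=
  Algebra.adjoin k (Set.range (fun x : G => path E [] x) ∪
    Set.range (fun p : J × G => path E [p.1] p.2))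

namespace Taft

theorem vertex_mem (x : G) : path E [] x ∈ E.Taft :=
  Algebra.subset_adjoin (Or.inl ⟨x, rfl⟩)

theorem arrow_mem (i : J) (x : G) : path E [i] x ∈ E.Taft :=
  Algebra.subset_adjoin (Or.inr ⟨(i, x), rfl⟩)

theorem comul_mem (a : E.CoPath) (ha : a ∈ E.Taft) : Coalgebra.comul (R := k) a ∈
    (Algebra.TensorProduct.map E.Taft.val E.Taft.val).range := by
  suffices h : E.Taft ≤ ((Algebra.TensorProduct.map E.Taft.val E.Taft.val).range).comap
    (Bialgebra.comulAlgHom k E.CoPath) from h ha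
  refine Algebra.adjoin_le ?_
  rintro _ (⟨x, rfl⟩ | ⟨⟨i, x⟩, rfl⟩)
  · exact ⟨⟨_, vertex_mem E x⟩ ⊗ₜ ⟨_, vertex_mem E x⟩, (comulLin_vertex E x).symm⟩
  · refine ⟨⟨_, vertex_mem E (E.g i * x)⟩ ⊗ₜ ⟨_, arrow_mem E i x⟩ +
      ⟨_, arrow_mem E i x⟩ ⊗ₜ ⟨_, vertex_mem E x⟩, ?_⟩
    have h := comulLin_cons_path E i [] x
    rw [comulLin_vertex, cons_path, LinearMap.rTensor_tmul, cons_path] at h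
    refine Eq.trans ?_ h.symm
    simp [target]

instance : Bialgebra k E.Taft := subBialgebra E.Taft (comul_mem E)

/-- The vertex `x`, i.e. the group element `x`, in the multiple Taft algebra. -/
def vertex : G →* E.Taft where
  toFun x := ⟨path E [] x, vertex_mem E x⟩
  map_one' := rfl
  map_mul' x y := Subtype.ext (vertex_mul_path E x [] y).symm

/-- The arrow `E i : 1 ⟶ g i` in the multiple Taft algebra. -/
def arrow (i : J) : E.Taft := ⟨path E [i] 1, arrow_mem E i 1⟩

theorem map_comul (a : E.Taft) :
    TensorProduct.map E.Taft.val.toLinearMap E.Taft.val.toLinearMap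
      (Coalgebra.comul (R := k) a) = Coalgebra.comul (R := k) (a : E.CoPath) :=
  map_subComul E.Taft (comul_mem E) a

theorem counit_eq (a : E.Taft) :
    Coalgebra.counit (R := k) a = Coalgebra.counit (R := k) (a : E.CoPath) := rfl

/-- The inclusion into the co-path Hopf algebra. -/
def val : E.Taft →ₐc[k] E.CoPath :=
  BialgHom.ofAlgHom E.Taft.val rfl (AlgHom.ext fun a => map_comul E a)

/-- The inclusion of the group algebra. -/
def incl : MonoidAlgebra k G →ₐc[k] E.Taft :=
  BialgHom.ofAlgHom (MonoidAlgebra.lift k E.Taft G (vertex E))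
    (MonoidAlgebra.algHom_ext (fun x => by
      have h := counit_vertex E x
      simpa [vertex, counit_eq, counit_def] using h) (by ext))
    (MonoidAlgebra.algHom_ext (fun x => by
      apply subalgebra_map_injective E.Taft
      have h := map_comul E (vertex E x)
      refine Eq.trans ?_ (Eq.trans (comulLin_vertex E x).symm (Eq.trans h.symm ?_))
      · simp [vertex]
      · simp
        rfl) (by ext))

theorem val_incl (b : MonoidAlgebra k G) : (incl E b : E.CoPath) = CoPath.incl E b := by
  have : (E.Taft.val.comp (incl E : MonoidAlgebra k G →ₐ[k] E.Taft)) =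
      (CoPath.incl E : MonoidAlgebra k G →ₐ[k] E.CoPath) :=
    MonoidAlgebra.algHom_ext (fun x => by
      change E.Taft.val (MonoidAlgebra.lift k E.Taft G (vertex E) (MonoidAlgebra.single x 1)) =
        MonoidAlgebra.lift k E.CoPath G (CoPath.vertex E) (MonoidAlgebra.single x 1)
      simp [vertex, CoPath.vertex]) (by ext)
  exact AlgHom.congr_fun this b

/-- The multiple Taft algebra as a graded Hopf algebra with degree zero part `kG`;
the grading is the grading by the length of paths. -/
def graded : GradedOver k G E.Taft where
  deg n := (CoPath.deg E n).comap E.Taft.val.toLinearMap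
  incl := incl E
  proj := (CoPath.proj E).comp (val E)
  proj_incl b := by
    change CoPath.proj E (incl E b : E.CoPath) = b
    rw [val_incl]
    have : (CoPath.proj E : E.CoPath →ₐ[k] MonoidAlgebra k G).comp
        (CoPath.incl E : MonoidAlgebra k G →ₐ[k] E.CoPath) = AlgHom.id k _ :=
      MonoidAlgebra.algHom_ext (fun x => by
        change projLin E (CoPath.incl E (MonoidAlgebra.single x 1)) = _
        rw [incl_single, one_smul, projLin_vertex]
        rfl) (by ext)
    exact AlgHom.congr_fun this b
  range_incl := by
    ext a
    constructor
    · rintro ⟨b, rfl⟩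
      change (incl E b : E.CoPath) ∈ CoPath.deg E 0
      rw [val_incl]
      induction b using MonoidAlgebra.induction_linear with
      | zero => simp
      | add b c h1 h2 => rw [map_add]; exact add_mem h1 h2
      | single x r =>
        rw [incl_single]
        exact Submodule.smul_mem _ _ (Submodule.subset_span ⟨[], x, rfl, rfl⟩)
    · intro ha
      change (a : E.CoPath) ∈ CoPath.deg E 0 at ha
      have h : ∀ c ∈ CoPath.deg E 0, ∃ b, CoPath.incl E b = c := by
        intro c hc
        induction hc using Submodule.span_induction with
        | mem c h =>
          obtain ⟨u, x, hu, rfl⟩ := h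
          rw [List.length_eq_zero_iff] at hu
          subst hu
          exact ⟨MonoidAlgebra.single x 1, by rw [incl_single, one_smul]⟩
        | zero => exact ⟨0, map_zero _⟩
        | add c d _ _ h1 h2 =>
          obtain ⟨b1, rfl⟩ := h1
          obtain ⟨b2, rfl⟩ := h2
          exact ⟨b1 + b2, map_add _ _ _⟩
        | smul r c _ h =>
          obtain ⟨b, rfl⟩ := h
          exact ⟨r • b, map_smul _ _ _⟩
      obtain ⟨b, hb⟩ := h a ha
      exact ⟨b, Subtype.ext ((val_incl E b).trans hb)⟩
  proj_deg n a hn ha := by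
    change (a : E.CoPath) ∈ CoPath.deg E n at ha
    change projLin E (a : E.CoPath) = 0
    generalize (a : E.CoPath) = c at ha
    induction ha using Submodule.span_induction with
    | mem c h =>
      obtain ⟨u, x, hu, rfl⟩ := h
      cases u with
      | nil => exact absurd hu.symm hn
      | cons i u => rw [← cons_path, projLin_cons]
    | zero => simp
    | add c d _ _ h1 h2 => rw [map_add, h1, h2, add_zero]
    | smul r c _ h => rw [map_smul, h, smul_zero]

end Taft

end ESC

/-! ### The tensor algebra of a bimodule -/

section BimodTensor

variable {k A M : Type*} [Field k] [Ring A] [Algebra k A] [AddCommGroup M] [Module k M]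
  (l : A →ₐ[k] Module.End k M) (r : A →ₐ[k] (Module.End k M)ᵐᵒᵖ)

/-- The defining relations of the tensor algebra of the `A`-bimodule `M` with left action `l` and
right action `r`. -/
inductive BimodTensorRel : TensorAlgebra k (A × M) → TensorAlgebra k (A × M) → Prop
  | one : BimodTensorRel (TensorAlgebra.ι k (1, 0)) 1
  | mul (a b : A) : BimodTensorRel (TensorAlgebra.ι k (a * b, 0))
      (TensorAlgebra.ι k (a, 0) * TensorAlgebra.ι k (b, 0))
  | left (a : A) (m : M) : BimodTensorRel (TensorAlgebra.ι k (0, l a m))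
      (TensorAlgebra.ι k (a, 0) * TensorAlgebra.ι k (0, m))
  | right (m : M) (a : A) : BimodTensorRel (TensorAlgebra.ι k (0, (r a).unop m))
      (TensorAlgebra.ι k (0, m) * TensorAlgebra.ι k (a, 0))

/-- The tensor algebra `T_A(M)` of the `A`-bimodule `M`: the `k`-algebra generated by the algebra
`A` and the bimodule `M`. -/
def BimodTensorAlgebra : Type _ := RingQuot (BimodTensorRel l r)

namespace BimodTensorAlgebra

instance : Ring (BimodTensorAlgebra l r) := inferInstanceAs (Ring (RingQuot (BimodTensorRel l r)))
instance : Algebra k (BimodTensorAlgebra l r) :=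
  inferInstanceAs (Algebra k (RingQuot (BimodTensorRel l r)))

/-- The quotient map. -/
def mk : TensorAlgebra k (A × M) →ₐ[k] BimodTensorAlgebra l r :=
  RingQuot.mkAlgHom k (BimodTensorRel l r)

theorem mk_rel {x y : TensorAlgebra k (A × M)} (h : BimodTensorRel l r x y) :
    mk l r x = mk l r y := RingQuot.mkAlgHom_rel k h

/-- The inclusion of the degree zero part. -/
def ofAlg : A →ₐ[k] BimodTensorAlgebra l r :=
  AlgHom.ofLinearMap ((mk l r).toLinearMap ∘ₗ TensorAlgebra.ι k ∘ₗ LinearMap.inl k A M)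
    ((mk_rel l r .one).trans (map_one _))
    fun a b => (mk_rel l r (.mul a b)).trans (map_mul _ _ _)

/-- The inclusion of the degree one part. -/
def ofMod : M →ₗ[k] BimodTensorAlgebra l r :=
  (mk l r).toLinearMap ∘ₗ TensorAlgebra.ι k ∘ₗ LinearMap.inr k A M

theorem ofAlg_mul_ofMod (a : A) (m : M) : ofAlg l r a * ofMod l r m = ofMod l r (l a m) :=
  ((mk_rel l r (.left a m)).trans (map_mul _ _ _)).symm

theorem ofMod_mul_ofAlg (m : M) (a : A) :
    ofMod l r m * ofAlg l r a = ofMod l r ((r a).unop m) :=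
  ((mk_rel l r (.right m a)).trans (map_mul _ _ _)).symm

variable {C : Type*} [Ring C] [Algebra k C]

/-- The universal property of the tensor algebra of a bimodule. -/
def lift (f : A →ₐ[k] C) (φ : M →ₗ[k] C) (hl : ∀ a m, φ (l a m) = f a * φ m)
    (hr : ∀ m a, φ ((r a).unop m) = φ m * f a) : BimodTensorAlgebra l r →ₐ[k] C :=
  RingQuot.liftAlgHom k ⟨TensorAlgebra.lift k (LinearMap.coprod f.toLinearMap φ), by
    intro x y h
    induction h with
    | one => simp
    | mul a b => simp
    | left a m => simp [hl]
    | right m a => simp [hr]⟩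

theorem lift_mk (f : A →ₐ[k] C) (φ : M →ₗ[k] C) (hl : ∀ a m, φ (l a m) = f a * φ m)
    (hr : ∀ m a, φ ((r a).unop m) = φ m * f a) (x : TensorAlgebra k (A × M)) :
    lift l r f φ hl hr (mk l r x) =
      TensorAlgebra.lift k (LinearMap.coprod f.toLinearMap φ) x :=
  RingQuot.liftAlgHom_mkAlgHom_apply k _ _ _

theorem lift_ofAlg (f : A →ₐ[k] C) (φ : M →ₗ[k] C) (hl : ∀ a m, φ (l a m) = f a * φ m)
    (hr : ∀ m a, φ ((r a).unop m) = φ m * f a) (a : A) :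
    lift l r f φ hl hr (ofAlg l r a) = f a :=
  (lift_mk l r f φ hl hr _).trans (by simp)

theorem lift_ofMod (f : A →ₐ[k] C) (φ : M →ₗ[k] C) (hl : ∀ a m, φ (l a m) = f a * φ m)
    (hr : ∀ m a, φ ((r a).unop m) = φ m * f a) (m : M) :
    lift l r f φ hl hr (ofMod l r m) = φ m :=
  (lift_mk l r f φ hl hr _).trans (by simp)

variable {l r} in
theorem hom_ext {f g : BimodTensorAlgebra l r →ₐ[k] C} (h0 : ∀ a, f (ofAlg l r a) = g (ofAlg l r a))
    (h1 : ∀ m, f (ofMod l r m) = g (ofMod l r m)) : f = g := by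
  refine RingQuot.ringQuot_ext' _ _ _ (TensorAlgebra.hom_ext (LinearMap.prod_ext ?_ ?_))
  · exact LinearMap.ext h0
  · exact LinearMap.ext h1

end BimodTensorAlgebra

end BimodTensor

namespace ESC

variable {k G J : Type*} [Field k] [Group G] (E : ESC k G J)

/-! ### The semi-path Hopf algebra -/

/-- The vector space with basis the arrows of the Hopf quiver; the pair `(i, x)` stands for the
arrow labelled `i` from `x` to `g i * x`. -/
abbrev ArrowSpace (_E : ESC k G J) : Type _ := (J × G) →₀ k

/-- The left action `h · a i x = a i (h x)`. -/
def arrowLeft : MonoidAlgebra k G →ₐ[k] Module.End k E.ArrowSpace :=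
  MonoidAlgebra.lift k _ G
    { toFun h := Finsupp.lmapDomain k k fun p => (p.1, h * p.2)
      map_one' := by
        refine Finsupp.lhom_ext fun p b => ?_
        simp
      map_mul' h h' := by
        refine Finsupp.lhom_ext fun p b => ?_
        simp [mul_assoc] }

/-- The right action `a i x · h = χ i h • a i (x h)` of a group element. -/
def arrowRightLin (h : G) : Module.End k E.ArrowSpace :=
  Finsupp.linearCombination k fun p => (E.χ p.1 h : k) • Finsupp.single (p.1, p.2 * h) 1

theorem arrowRightLin_single (h : G) (i : J) (x : G) :
    E.arrowRightLin h (Finsupp.single (i, x) 1) =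
      (E.χ i h : k) • Finsupp.single (i, x * h) 1 := by
  rw [arrowRightLin, Finsupp.linearCombination_single, one_smul]

/-- The right action of `kG` on the span of the arrows. -/
def arrowRight : MonoidAlgebra k G →ₐ[k] (Module.End k E.ArrowSpace)ᵐᵒᵖ :=
  MonoidAlgebra.lift k _ G
    { toFun h := MulOpposite.op (E.arrowRightLin h)
      map_one' := by
        refine MulOpposite.unop_injective (Finsupp.basisSingleOne.ext fun p => ?_)
        obtain ⟨i, x⟩ := p
        rw [Finsupp.coe_basisSingleOne, MulOpposite.unop_op, arrowRightLin_single]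
        simp
      map_mul' h h' := by
        refine MulOpposite.unop_injective (Finsupp.basisSingleOne.ext fun p => ?_)
        obtain ⟨i, x⟩ := p
        rw [Finsupp.coe_basisSingleOne, MulOpposite.unop_op, MulOpposite.unop_mul,
          MulOpposite.unop_op, MulOpposite.unop_op, Module.End.mul_apply, arrowRightLin_single,
          arrowRightLin_single, map_smul, arrowRightLin_single, smul_smul, map_mul, Units.val_mul,
          mul_assoc] }

theorem arrowLeft_single (h : G) (i : J) (x : G) :
    E.arrowLeft (MonoidAlgebra.single h 1) (Finsupp.single (i, x) 1) =
      Finsupp.single (i, h * x) 1 := by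
  simp [arrowLeft]

theorem arrowRight_single (h : G) (i : J) (x : G) :
    (E.arrowRight (MonoidAlgebra.single h 1)).unop (Finsupp.single (i, x) 1) =
      (E.χ i h : k) • Finsupp.single (i, x * h) 1 := by
  rw [← arrowRightLin_single]
  simp [arrowRight]

/-- The semi-path Hopf algebra of `E`: the tensor algebra over `kG` of the arrow bimodule. -/
def SemiPath : Type _ := BimodTensorAlgebra E.arrowLeft E.arrowRight

namespace SemiPath

instance : Ring E.SemiPath := inferInstanceAs (Ring (BimodTensorAlgebra E.arrowLeft E.arrowRight))
instance : Algebra k E.SemiPath :=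
  inferInstanceAs (Algebra k (BimodTensorAlgebra E.arrowLeft E.arrowRight))

/-- The inclusion of the degree zero part. -/
def ofAlg : MonoidAlgebra k G →ₐ[k] E.SemiPath := BimodTensorAlgebra.ofAlg _ _

/-- The inclusion of the degree one part. -/
def ofMod : E.ArrowSpace →ₗ[k] E.SemiPath := BimodTensorAlgebra.ofMod _ _

/-- The group element `x` in the semi-path Hopf algebra. -/
def vertex : G →* E.SemiPath := (ofAlg E : _ →* _).comp (MonoidAlgebra.of k G)

/-- The arrow labelled `i` from `x` to `g i * x`. -/
def arr (i : J) (x : G) : E.SemiPath := ofMod E (Finsupp.single (i, x) 1)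

/-- The arrow `E i : 1 ⟶ g i`. -/
def arrow (i : J) : E.SemiPath := arr E i 1

theorem vertex_apply (x : G) : vertex E x = ofAlg E (MonoidAlgebra.single x 1) := rfl

theorem vertex_mul_arr (h : G) (i : J) (x : G) : vertex E h * arr E i x = arr E i (h * x) :=
  (BimodTensorAlgebra.ofAlg_mul_ofMod _ _ _ _).trans
    (congrArg (ofMod E) (E.arrowLeft_single h i x))

theorem arr_mul_vertex (i : J) (x h : G) :
    arr E i x * vertex E h = (E.χ i h : k) • arr E i (x * h) :=
  ((BimodTensorAlgebra.ofMod_mul_ofAlg _ _ _ _).trans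
    (congrArg (ofMod E) (E.arrowRight_single h i x))).trans (map_smul _ _ _)

variable {C : Type*} [Ring C] [Algebra k C]

/-- The universal property, in terms of vertices and arrows. -/
def lift (f : G →* C) (φ : J → G → C) (hl : ∀ h i x, φ i (h * x) = f h * φ i x)
    (hr : ∀ i x h, φ i x * f h = (E.χ i h : k) • φ i (x * h)) : E.SemiPath →ₐ[k] C :=
  BimodTensorAlgebra.lift E.arrowLeft E.arrowRight (MonoidAlgebra.lift k C G f)
    (Finsupp.linearCombination k fun p => φ p.1 p.2)
    (by
      intro a m
      induction a using MonoidAlgebra.induction_linear with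
      | zero => simp
      | add a b h1 h2 => simp only [map_add, LinearMap.add_apply, add_mul, h1, h2]
      | single g c =>
        have : MonoidAlgebra.single g c = c • MonoidAlgebra.single g (1 : k) := by simp
        rw [this, map_smul, map_smul, LinearMap.smul_apply, map_smul, smul_mul_assoc]
        congr 1
        induction m using Finsupp.induction_linear with
        | zero => simp
        | add a b h1 h2 => simp only [map_add, mul_add, h1, h2]
        | single p c =>
          have : Finsupp.single p c = c • Finsupp.single p (1 : k) := by simp
          rw [this, map_smul, map_smul, map_smul, mul_smul_comm]
          congr 1
          rw [arrowLeft_single]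
          simp [hl])
    (by
      intro m a
      induction a using MonoidAlgebra.induction_linear with
      | zero => simp
      | add a b h1 h2 =>
        simp only [map_add, MulOpposite.unop_add, LinearMap.add_apply, mul_add, h1, h2]
      | single g c =>
        have : MonoidAlgebra.single g c = c • MonoidAlgebra.single g (1 : k) := by simp
        rw [this, map_smul, map_smul, MulOpposite.unop_smul, LinearMap.smul_apply, map_smul,
          mul_smul_comm]
        congr 1
        induction m using Finsupp.induction_linear with
        | zero => simp
        | add a b h1 h2 => simp only [map_add, add_mul, h1, h2]
        | single p c =>
          have : Finsupp.single p c = c • Finsupp.single p (1 : k) := by simp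
          rw [this, map_smul, map_smul, map_smul, smul_mul_assoc]
          congr 1
          rw [arrowRight_single]
          simp [hr])

theorem lift_vertex (f : G →* C) (φ : J → G → C) (hl : ∀ h i x, φ i (h * x) = f h * φ i x)
    (hr : ∀ i x h, φ i x * f h = (E.χ i h : k) • φ i (x * h)) (x : G) :
    lift E f φ hl hr (vertex E x) = f x :=
  (BimodTensorAlgebra.lift_ofAlg _ _ _ _ _ _ _).trans (by simp)

theorem lift_arr (f : G →* C) (φ : J → G → C) (hl : ∀ h i x, φ i (h * x) = f h * φ i x)
    (hr : ∀ i x h, φ i x * f h = (E.χ i h : k) • φ i (x * h)) (i : J) (x : G) :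
    lift E f φ hl hr (arr E i x) = φ i x :=
  (BimodTensorAlgebra.lift_ofMod _ _ _ _ _ _ _).trans (by simp)

variable {E} in
theorem hom_ext {f g : E.SemiPath →ₐ[k] C} (h0 : ∀ x, f (vertex E x) = g (vertex E x))
    (h1 : ∀ i x, f (arr E i x) = g (arr E i x)) : f = g := by
  have h0' : ∀ a, f (ofAlg E a) = g (ofAlg E a) := by
    intro a
    induction a using MonoidAlgebra.induction_linear with
    | zero => simp
    | add a b h1 h2 => simp only [map_add, h1, h2]
    | single x c =>
      have : MonoidAlgebra.single x c = c • MonoidAlgebra.single x (1 : k) := by simp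
      rw [this, map_smul, map_smul, map_smul]
      exact congrArg (c • ·) (h0 x)
  have h1' : ∀ m, f (ofMod E m) = g (ofMod E m) := by
    intro m
    induction m using Finsupp.induction_linear with
    | zero => simp
    | add a b h1 h2 => simp only [map_add, h1, h2]
    | single p c =>
      have : Finsupp.single p c = c • Finsupp.single p (1 : k) := by simp
      rw [this, map_smul, map_smul, map_smul]
      exact congrArg (c • ·) (h1 p.1 p.2)
  exact BimodTensorAlgebra.hom_ext h0' h1'

/-- The comultiplication: vertices are group-like, and
`Δ a = δ⁻ a + δ⁺ a = t(a) ⊗ a + a ⊗ s(a)` for every arrow `a`. -/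
def comulHom : E.SemiPath →ₐ[k] E.SemiPath ⊗[k] E.SemiPath :=
  lift E
    { toFun x := vertex E x ⊗ₜ vertex E x
      map_one' := by simp [Algebra.TensorProduct.one_def]
      map_mul' x y := by simp }
    (fun i x => vertex E (E.g i * x) ⊗ₜ arr E i x + arr E i x ⊗ₜ vertex E x)
    (fun h i x => by
      change _ = (vertex E h ⊗ₜ vertex E h) * _
      rw [mul_add, Algebra.TensorProduct.tmul_mul_tmul, Algebra.TensorProduct.tmul_mul_tmul,
        vertex_mul_arr, ← map_mul, ← map_mul, ← mul_assoc, ← mul_assoc, E.g_comm])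
    (fun i x h => by
      change _ * (vertex E h ⊗ₜ vertex E h) = _
      rw [add_mul, Algebra.TensorProduct.tmul_mul_tmul, Algebra.TensorProduct.tmul_mul_tmul,
        arr_mul_vertex, ← map_mul, ← map_mul, mul_assoc, smul_add, TensorProduct.tmul_smul,
        ← TensorProduct.smul_tmul'])

/-- The counit. -/
def counitHom : E.SemiPath →ₐ[k] k := lift E 1 (fun _ _ => 0) (by simp) (by simp)

theorem comulHom_vertex (x : G) : comulHom E (vertex E x) = vertex E x ⊗ₜ vertex E x :=
  lift_vertex E _ _ _ _ x

theorem comulHom_arr (i : J) (x : G) : comulHom E (arr E i x) =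
    vertex E (E.g i * x) ⊗ₜ arr E i x + arr E i x ⊗ₜ vertex E x := lift_arr E _ _ _ _ i x

theorem counitHom_vertex (x : G) : counitHom E (vertex E x) = 1 := lift_vertex E _ _ _ _ x

theorem counitHom_arr (i : J) (x : G) : counitHom E (arr E i x) = 0 := lift_arr E _ _ _ _ i x

instance : Bialgebra k E.SemiPath :=
  Bialgebra.ofAlgHom (comulHom E) (counitHom E)
    (hom_ext (fun x => by simp [comulHom_vertex])
      (fun i x => by
        simp [comulHom_vertex, comulHom_arr, TensorProduct.add_tmul, TensorProduct.tmul_add,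
          add_assoc]))
    (hom_ext (fun x => by simp [comulHom_vertex, counitHom_vertex])
      (fun i x => by simp [comulHom_arr, counitHom_vertex, counitHom_arr]))
    (hom_ext (fun x => by simp [comulHom_vertex, counitHom_vertex])
      (fun i x => by simp [comulHom_arr, counitHom_vertex, counitHom_arr]))

theorem comul_def (a : E.SemiPath) : Coalgebra.comul (R := k) a = comulHom E a := rfl
theorem counit_def (a : E.SemiPath) : Coalgebra.counit (R := k) a = counitHom E a := rfl

/-- The antipode, as an algebra homomorphism into the opposite algebra: `S x = x⁻¹` for vertices
and `S a = - t(a)⁻¹ a s(a)⁻¹` for arrows. -/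
def antipodeHom : E.SemiPath →ₐ[k] E.SemiPathᵐᵒᵖ :=
  lift E
    { toFun x := MulOpposite.op (vertex E x⁻¹)
      map_one' := by simp
      map_mul' x y := by simp [← MulOpposite.op_mul] }
    (fun i x => - MulOpposite.op (vertex E (E.g i * x)⁻¹ * arr E i x * vertex E x⁻¹))
    (fun h i x => by
      change _ = MulOpposite.op (vertex E h⁻¹) * - _
      rw [mul_neg, ← MulOpposite.op_mul, ← vertex_mul_arr, mul_inv_rev h x, map_mul (vertex E) x⁻¹,
        ← mul_assoc, ← mul_assoc, ← map_mul]
      congr 6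
      simp [E.g_comm, mul_assoc])
    (fun i x h => by
      change (- _) * MulOpposite.op (vertex E h⁻¹) = _
      rw [neg_mul, ← MulOpposite.op_mul, smul_neg, ← MulOpposite.op_smul]
      congr 2
      have h1 := arr_mul_vertex E i x h
      have h2 : (E.g i * (x * h))⁻¹ = h⁻¹ * (E.g i * x)⁻¹ := by simp [mul_assoc]
      have h3 : vertex E h * vertex E (x * h)⁻¹ = vertex E x⁻¹ := by rw [← map_mul]; simp
      rw [← smul_mul_assoc, ← mul_smul_comm, ← h1, h2, map_mul]
      simp only [mul_assoc, h3])

theorem antipodeHom_vertex (x : G) :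
    antipodeHom E (vertex E x) = MulOpposite.op (vertex E x⁻¹) := lift_vertex E _ _ _ _ x

theorem antipodeHom_arr (i : J) (x : G) : antipodeHom E (arr E i x) =
    - MulOpposite.op (vertex E (E.g i * x)⁻¹ * arr E i x * vertex E x⁻¹) := lift_arr E _ _ _ _ i x

/-- The antipode, as a linear map. -/
def antipodeLin : E.SemiPath →ₗ[k] E.SemiPath :=
  (MulOpposite.opLinearEquiv k).symm.toLinearMap ∘ₗ (antipodeHom E).toLinearMap

theorem antipodeLin_mul (a b : E.SemiPath) :
    antipodeLin E (a * b) = antipodeLin E b * antipodeLin E a := by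
  simp [antipodeLin]

theorem antipodeLin_vertex (x : G) : antipodeLin E (vertex E x) = vertex E x⁻¹ := by
  simp [antipodeLin, antipodeHom_vertex]

theorem antipodeLin_arr (i : J) (x : G) : antipodeLin E (arr E i x) =
    - (vertex E (E.g i * x)⁻¹ * arr E i x * vertex E x⁻¹) := by
  simp [antipodeLin, antipodeHom_arr]

/-- The semi-path Hopf algebra is generated by vertices and arrows. -/
theorem mem_of_generators (U : Subalgebra k E.SemiPath) (h0 : ∀ x, vertex E x ∈ U)
    (h1 : ∀ i x, arr E i x ∈ U) (a : E.SemiPath) : a ∈ U := by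
  let F : E.SemiPath →ₐ[k] U := lift E
    { toFun x := ⟨vertex E x, h0 x⟩
      map_one' := Subtype.ext (map_one _)
      map_mul' x y := Subtype.ext (map_mul _ _ _) }
    (fun i x => ⟨arr E i x, h1 i x⟩)
    (fun h i x => Subtype.ext (vertex_mul_arr E h i x).symm)
    (fun i x h => Subtype.ext (arr_mul_vertex E i x h))
  have hF : U.val.comp F = AlgHom.id k _ :=
    hom_ext (fun x => congrArg U.val (lift_vertex E _ _ _ _ x))
      (fun i x => congrArg U.val (lift_arr E _ _ _ _ i x))
  have := AlgHom.congr_fun hF a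
  rw [AlgHom.id_apply] at this
  rw [← this]
  exact (F a).2

theorem antipode_left (a : E.SemiPath) (Y : E.SemiPath ⊗[k] E.SemiPath) :
    LinearMap.mul' k _ ((antipodeLin E).rTensor _ (comulHom E a * Y)) =
      counitHom E a • LinearMap.mul' k _ ((antipodeLin E).rTensor _ Y) := by
  refine mem_of_generators E
    { carrier := {a | ∀ Y, LinearMap.mul' k _ ((antipodeLin E).rTensor _ (comulHom E a * Y)) =
        counitHom E a • LinearMap.mul' k _ ((antipodeLin E).rTensor _ Y)}
      mul_mem' := fun {a b} ha hb Y => by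
        rw [map_mul (comulHom E), mul_assoc, ha, hb, map_mul, smul_smul]
      add_mem' := fun {a b} ha hb Y => by
        simp only [map_add, add_mul, ha Y, hb Y, add_smul]
      algebraMap_mem' := fun r Y => by
        rw [AlgHom.commutes, AlgHom.commutes, ← Algebra.smul_def, map_smul, map_smul]
        rfl } (fun x Y => ?_) (fun i x Y => ?_) a Y
  · induction Y with
    | zero => simp only [mul_zero, map_zero, smul_zero]
    | add a b h1 h2 => simp only [mul_add, map_add, smul_add, h1, h2]
    | tmul c d =>
      rw [comulHom_vertex, counitHom_vertex, Algebra.TensorProduct.tmul_mul_tmul,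
        LinearMap.rTensor_tmul, LinearMap.rTensor_tmul, LinearMap.mul'_apply, LinearMap.mul'_apply,
        antipodeLin_mul, antipodeLin_vertex, mul_assoc, ← mul_assoc (vertex E x⁻¹), ← map_mul,
        inv_mul_cancel, map_one, one_mul, one_smul]
  · induction Y with
    | zero => simp only [mul_zero, map_zero, smul_zero]
    | add a b h1 h2 => simp only [mul_add, map_add, smul_add, h1, h2]
    | tmul c d =>
      have h1 : vertex E x⁻¹ * (vertex E x * d) = d := by
        rw [← mul_assoc, ← map_mul, inv_mul_cancel, map_one, one_mul]
      simp only [comulHom_arr, counitHom_arr, add_mul, Algebra.TensorProduct.tmul_mul_tmul,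
        map_add, LinearMap.rTensor_tmul, LinearMap.mul'_apply, antipodeLin_mul, antipodeLin_vertex,
        antipodeLin_arr, mul_neg, neg_mul, mul_assoc, h1, zero_smul, add_neg_cancel]

theorem antipode_right (a : E.SemiPath) (Y : E.SemiPath ⊗[k] E.SemiPath) :
    LinearMap.mul' k _ ((antipodeLin E).lTensor _ (Y * comulHom E a)) =
      counitHom E a • LinearMap.mul' k _ ((antipodeLin E).lTensor _ Y) := by
  refine mem_of_generators E
    { carrier := {a | ∀ Y, LinearMap.mul' k _ ((antipodeLin E).lTensor _ (Y * comulHom E a)) =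
        counitHom E a • LinearMap.mul' k _ ((antipodeLin E).lTensor _ Y)}
      mul_mem' := fun {a b} ha hb Y => by
        rw [map_mul (comulHom E), ← mul_assoc, hb, ha, map_mul, smul_smul, mul_comm]
      add_mem' := fun {a b} ha hb Y => by
        simp only [map_add, mul_add, ha Y, hb Y, add_smul]
      algebraMap_mem' := fun r Y => by
        rw [AlgHom.commutes, AlgHom.commutes, ← Algebra.commutes, ← Algebra.smul_def, map_smul,
          map_smul]
        rfl } (fun x Y => ?_) (fun i x Y => ?_) a Y
  · induction Y with
    | zero => simp only [zero_mul, map_zero, smul_zero]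
    | add a b h1 h2 => simp only [add_mul, map_add, smul_add, h1, h2]
    | tmul c d =>
      rw [comulHom_vertex, counitHom_vertex, Algebra.TensorProduct.tmul_mul_tmul,
        LinearMap.lTensor_tmul, LinearMap.lTensor_tmul, LinearMap.mul'_apply, LinearMap.mul'_apply,
        antipodeLin_mul, antipodeLin_vertex, mul_assoc, ← mul_assoc (vertex E x), ← map_mul,
        mul_inv_cancel, map_one, one_mul, one_smul]
  · induction Y with
    | zero => simp only [zero_mul, map_zero, smul_zero]
    | add a b h1 h2 => simp only [add_mul, map_add, smul_add, h1, h2]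
    | tmul c d =>
      have h1 : ∀ e, vertex E (E.g i * x) * (vertex E (E.g i * x)⁻¹ * e) = e := fun e => by
        rw [← mul_assoc, ← map_mul, mul_inv_cancel, map_one, one_mul]
      simp only [comulHom_arr, counitHom_arr, mul_add, Algebra.TensorProduct.tmul_mul_tmul,
        map_add, LinearMap.lTensor_tmul, LinearMap.mul'_apply, antipodeLin_mul, antipodeLin_vertex,
        antipodeLin_arr, mul_neg, neg_mul, mul_assoc, h1, zero_smul, neg_add_cancel]

instance : HopfAlgebra k E.SemiPath where
  antipode := antipodeLin E
  mul_antipode_rTensor_comul := LinearMap.ext fun a => by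
    have h := antipode_left E a 1
    rw [mul_one] at h
    refine h.trans ?_
    rw [Algebra.TensorProduct.one_def, LinearMap.rTensor_tmul, LinearMap.mul'_apply, mul_one,
      ← map_one (vertex E), antipodeLin_vertex, inv_one, map_one, ← Algebra.algebraMap_eq_smul_one]
    rfl
  mul_antipode_lTensor_comul := LinearMap.ext fun a => by
    have h := antipode_right E a 1
    rw [one_mul] at h
    refine h.trans ?_
    rw [Algebra.TensorProduct.one_def, LinearMap.lTensor_tmul, LinearMap.mul'_apply, one_mul,
      ← map_one (vertex E), antipodeLin_vertex, inv_one, map_one, ← Algebra.algebraMap_eq_smul_one]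
    rfl

/-- The projection onto the degree zero part `kG`, as an algebra homomorphism. -/
def projHom : E.SemiPath →ₐ[k] MonoidAlgebra k G :=
  lift E (MonoidAlgebra.of k G) (fun _ _ => 0) (by simp) (by simp)

theorem projHom_vertex (x : G) : projHom E (vertex E x) = MonoidAlgebra.single x 1 :=
  lift_vertex E _ _ _ _ x

theorem projHom_arr (i : J) (x : G) : projHom E (arr E i x) = 0 := lift_arr E _ _ _ _ i x

/-- The semi-path Hopf algebra as a graded Hopf algebra with degree zero part `kG`: its component
of degree `n` is spanned by the products of an element of `kG` and `n` arrows. -/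
def graded : GradedOver k G E.SemiPath where
  deg n := LinearMap.range (ofAlg E).toLinearMap * LinearMap.range (ofMod E) ^ n
  incl := BialgHom.ofAlgHom (ofAlg E)
    (MonoidAlgebra.algHom_ext (fun x => by
      have h := counitHom_vertex E x
      rw [vertex_apply] at h
      simpa [counit_def] using h) (by ext))
    (MonoidAlgebra.algHom_ext (fun x => by
      have h := comulHom_vertex E x
      rw [vertex_apply] at h
      simpa [comul_def] using h.symm) (by ext))
  proj := BialgHom.ofAlgHom (projHom E)
    (hom_ext (fun x => by simp [projHom_vertex, counit_def, counitHom_vertex])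
      (fun i x => by simp [projHom_arr, counit_def, counitHom_arr]))
    (hom_ext (fun x => by simp [projHom_vertex, comul_def, comulHom_vertex])
      (fun i x => by simp [projHom_arr, comul_def, comulHom_arr]))
  proj_incl b := by
    have : (projHom E).comp (ofAlg E) = AlgHom.id k _ :=
      MonoidAlgebra.algHom_ext (fun x => by
        have h := projHom_vertex E x
        rw [vertex_apply] at h
        simpa using h) (by ext)
    exact AlgHom.congr_fun this b
  range_incl := by
    rw [pow_zero, mul_one]
    rfl
  proj_deg n a hn ha := by
    have h0 : (LinearMap.range (ofMod E)).map (projHom E).toLinearMap = ⊥ := by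
      rw [eq_bot_iff, Submodule.map_le_iff_le_comap]
      rintro _ ⟨m, rfl⟩
      change projHom E (ofMod E m) = 0
      induction m using Finsupp.induction_linear with
      | zero => simp
      | add a b h1 h2 => rw [map_add, map_add, h1, h2, add_zero]
      | single p c =>
        have : Finsupp.single p c = c • Finsupp.single p (1 : k) := by simp
        rw [this, map_smul, map_smul]
        exact (congrArg (c • ·) (projHom_arr E p.1 p.2)).trans (smul_zero c)
    have h1 : projHom E a ∈ (LinearMap.range (ofAlg E).toLinearMap *
        LinearMap.range (ofMod E) ^ n).map (projHom E).toLinearMap :=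
      Submodule.mem_map_of_mem ha
    rw [Submodule.map_mul, Submodule.map_pow, h0, Submodule.bot_pow hn, Submodule.mul_bot] at h1
    exact h1

end SemiPath

/-! ### Quantum tensor algebras and quantum linear spaces -/

/-- The action of `h : G` on the free algebra: `h · x j = χ j h • x j`. -/
def tensorAct (h : G) : FreeAlgebra k J →ₐ[k] FreeAlgebra k J :=
  FreeAlgebra.lift k fun j => (E.χ j h : k) • FreeAlgebra.ι k j

/-- Left multiplication by `Δ (x j) = x j ⊗ 1 + 1 ⊗ x j` in the braided tensor product:
`Δ (x j) (a ⊗ b) = x j a ⊗ b + (g j · a) ⊗ x j b`. -/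
def tensorComulGen (j : J) : Module.End k (FreeAlgebra k J ⊗[k] FreeAlgebra k J) :=
  (LinearMap.mulLeft k (FreeAlgebra.ι k j)).rTensor (FreeAlgebra k J) +
    TensorProduct.map (E.tensorAct (E.g j)).toLinearMap (LinearMap.mulLeft k (FreeAlgebra.ι k j))

/-- The quantum tensor algebra of `E`: the free algebra on generators `x j`, with
`h · x j = χ j h • x j`, `δ⁻ (x j) = g j ⊗ x j`, `Δ (x j) = x j ⊗ 1 + 1 ⊗ x j`, `ε (x j) = 0`,
where `h ·`, `δ⁻` and `ε` are algebra homomorphisms, and where `Δ` is the algebra homomorphism to the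
braided tensor product, i.e. `Δ (x j a) = Δ (x j) Δ a`; it is graded by the length of words. -/
def tensorData : BraidedData k G (FreeAlgebra k J) where
  act :=
    { toFun h := (E.tensorAct h).toLinearMap
      map_one' := by
        have : E.tensorAct 1 = AlgHom.id k _ := FreeAlgebra.hom_ext (by ext j; simp [tensorAct])
        rw [this]; rfl
      map_mul' h h' := by
        have : E.tensorAct (h * h') = (E.tensorAct h).comp (E.tensorAct h') :=
          FreeAlgebra.hom_ext (by ext j; simp [tensorAct, smul_smul, mul_comm])
        rw [this]; rfl }
  coact := (FreeAlgebra.lift k fun j =>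
    (MonoidAlgebra.single (E.g j) (1 : k) ⊗ₜ[k] FreeAlgebra.ι k j :
      MonoidAlgebra k G ⊗[k] FreeAlgebra k J)).toLinearMap
  comul := LinearMap.applyₗ (1 ⊗ₜ 1) ∘ₗ (FreeAlgebra.lift k E.tensorComulGen).toLinearMap
  counit := (FreeAlgebra.lift k fun _ : J => (0 : k)).toLinearMap
  deg n := Submodule.span k (Set.range (FreeAlgebra.ι k)) ^ n

theorem tensorData_comul_ι_mul (j : J) (a : FreeAlgebra k J) :
    E.tensorData.comul (FreeAlgebra.ι k j * a) = E.tensorComulGen j (E.tensorData.comul a) := by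
  simp [tensorData]

/-- The defining relations of the quantum linear space. -/
inductive QuantumLinearRel : FreeAlgebra k J → FreeAlgebra k J → Prop
  | pow (l : J) (h : E.N l ≠ ⊤) : QuantumLinearRel (FreeAlgebra.ι k l ^ (E.N l).toNat) 0
  | comm (i j : J) (h : i ≠ j) : QuantumLinearRel (FreeAlgebra.ι k i * FreeAlgebra.ι k j)
      ((E.χ j (E.g i) : k) • (FreeAlgebra.ι k j * FreeAlgebra.ι k i))

/-- The algebra underlying the quantum linear space of `E`: generators `x j`, relations
`x l ^ N l = 0` if `N l < ∞` and `x i x j = χ j (g i) • x j x i` for `i ≠ j`. -/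
abbrev QuantumLinear : Type _ := RingQuot E.QuantumLinearRel

/-- The quotient map from the quantum tensor algebra. -/
abbrev toQuantumLinear : FreeAlgebra k J →ₐ[k] E.QuantumLinear :=
  RingQuot.mkAlgHom k E.QuantumLinearRel

/-! ### Monomials -/

/-- The exponents of the PBW monomials: finitely supported functions `m` with `m j < N j`. -/
abbrev Exponent : Type _ := {m : J →₀ ℕ // ∀ j, (m j : ℕ∞) < E.N j}

/-- The monomial `E ν₁ ^ m ν₁ * ⋯ * E νₜ ^ m νₜ` in the multiple Taft algebra, where
`ν₁ < ⋯ < νₜ` are the elements of the support of `m`. -/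
def Taft.monomial [LinearOrder J] (m : J →₀ ℕ) : E.Taft :=
  ((m.support.sort).map fun j => Taft.arrow E j ^ m j).prod

end ESC

end

/-! All braided algebras in the statement have the same shape, captured by `BraidedData.IsDiagonal`.
They are spanned by words in generators `x j` on which `G` acts by the characters `χ j` and which
have degree `g j` in `G`. Each structure map has a prescribed rule for left multiplication by a
generator. These rules alone give the braided bialgebra axioms by induction on words, whatever
relations hold among the generators. Since the `g j` are central, the degree and the character of a
word depend only on its multiset of letters, and every term `v ⊗ w` in the comultiplication of a
word merely distributes its letters. The antipode is a geometric series for the convolution inverse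
of the identity. For the same reason an algebra homomorphism that matches generators respects all
structure maps (`isInduced`, `isIso`).

Both `kQ^s` and the multiple Taft algebra are generated by `kG` and skew primitive elements `E j`
with `h E_j = χ_j(h)⁻¹ E_j h`; this is where the inverse characters come from. In a Hopf algebra of
this kind (`GradedOver.IsGenerated`) the projection `ω` is left linear over the diagram and erases
group elements on the right. Hence the diagram is spanned by the words in the `E j` and is of
diagonal type (`diagData_isDiagonal`).

For `kQ^s`, a regular representation on the space with basis `G × List J` shows that the elements `x
* E_u` are independent. So the free algebra embeds, its image is the diagram, and multiplication
identifies the biproduct with `kQ^s`.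

For the multiple Taft algebra the main tool is the family of maps `CoPath.tail`, which strip the
last arrow of a path. An element vanishes as soon as its degree zero part and all its tails vanish
(`eq_zero_of_tail`), and in a product with `E i` on the left `tail` behaves as a skew derivation. On
powers of `E i` it produces the `q`-integers `1 + q + ⋯ + q^m`. These vanish at `m + 1 = N i`, which
yields the power relations; comparing tails yields the commutation relations. Below `N i` the
`q`-integers are nonzero in characteristic zero or when every `q i ≠ 1`, so the ordered monomials do
not vanish (`listMonomial_ne_zero`). Shuffling only permutes labels, so monomials with different
exponents or group elements involve disjoint sets of paths and are independent. The relations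
rewrite every word into ordered monomials, which gives the bases. The quantum linear space is
spanned by the same monomials, so its map to the diagram is bijective and its structure maps can be
transported back.

For the Nichols property, `tail` agrees up to a twist with the skew derivation `r ↦ ψ(r⁽¹⁾) r⁽²⁾`
attached to the coefficient `ψ` of `E i` (`Taft.tail_eq`). On a primitive element this derivation is
a scalar and the counit is zero. So all tails are scalars and the element is a combination of
arrows. -/

noncomputable section

/-! ### Braided Hopf algebras of diagonal type -/

namespace ESC

variable {k G J : Type*} [Field k] [Group G] (E : ESC k G J)

/-- The degree in `G` of a word. -/
def wordG (u : List J) : G := (u.map E.g).prod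

/-- The character of a word. -/
def wordχ (u : List J) (h : G) : kˣ := (u.map fun j => E.χ j h).prod

@[simp] theorem wordG_nil : E.wordG [] = 1 := rfl
@[simp] theorem wordG_cons (j : J) (u : List J) : E.wordG (j :: u) = E.g j * E.wordG u := by
  simp [wordG]
@[simp] theorem wordχ_nil (h : G) : E.wordχ [] h = 1 := rfl
@[simp] theorem wordχ_cons (j : J) (u : List J) (h : G) :
    E.wordχ (j :: u) h = E.χ j h * E.wordχ u h := by
  simp [wordχ]
theorem wordχ_append (u v : List J) (h : G) : E.wordχ (u ++ v) h = E.wordχ u h * E.wordχ v h := by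
  simp [wordχ]

theorem wordG_comm (u : List J) (x : G) : E.wordG u * x = x * E.wordG u := by
  induction u with
  | nil => simp
  | cons j u ih => rw [wordG_cons, mul_assoc, ih, ← mul_assoc, E.g_comm, mul_assoc]

theorem wordG_append (u v : List J) : E.wordG (u ++ v) = E.wordG u * E.wordG v := by
  rw [wordG, List.map_append, List.prod_append]; rfl

/-- Centrality of the `g i` makes the `G`-degree of a word independent of the order of its letters.
This is what makes the comultiplication colinear. -/
theorem wordG_perm {u v : List J} (h : u.Perm v) : E.wordG u = E.wordG v := by
  induction h with
  | nil => rfl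
  | cons j _ ih => rw [wordG_cons, wordG_cons, ih]
  | swap i j u => simp only [wordG_cons, ← mul_assoc, E.g_comm i]
  | trans _ _ h1 h2 => exact h1.trans h2

theorem wordχ_perm {u v : List J} (h : u.Perm v) (x : G) : E.wordχ u x = E.wordχ v x :=
  (h.map _).prod_eq

end ESC

/-- The product of the elements `x j`, where `j` runs through the word `u`. -/
def wordProd {J R : Type*} [Ring R] (x : J → R) (u : List J) : R := (u.map x).prod

theorem wordProd_cons {J R : Type*} [Ring R] (x : J → R) (j : J) (u : List J) :
    wordProd x (j :: u) = x j * wordProd x u := by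
  simp [wordProd]

@[simp] theorem wordProd_nil {J R : Type*} [Ring R] (x : J → R) : wordProd x [] = 1 := rfl

theorem map_wordProd {k J R R' : Type*} [Field k] [Ring R] [Algebra k R] [Ring R'] [Algebra k R']
    {x : J → R} {x' : J → R'} (f : R →ₐ[k] R') (hf : ∀ j, f (x j) = x' j) (u : List J) :
    f (wordProd x u) = wordProd x' u := by
  induction u with
  | nil => simp
  | cons j u ih => rw [wordProd_cons, map_mul, hf, ih, wordProd_cons]

@[simp] theorem midMap_tmul {k A B C B' C' D : Type*} [Field k]
    [AddCommGroup A] [AddCommGroup B] [AddCommGroup C] [AddCommGroup B'] [AddCommGroup C']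
    [AddCommGroup D] [Module k A] [Module k B] [Module k C] [Module k B'] [Module k C'] [Module k D]
    (f : B ⊗[k] C →ₗ[k] C' ⊗[k] B') (a : A) (b : B) (c : C) (d : D) :
    midMap f ((a ⊗ₜ b) ⊗ₜ (c ⊗ₜ d)) =
      (TensorProduct.assoc k A C' (B' ⊗[k] D)).symm
        (a ⊗ₜ (TensorProduct.assoc k C' B' D (f (b ⊗ₜ c) ⊗ₜ d))) := rfl

namespace BraidedData

variable {k G J R : Type*} [Field k] [Group G] [Ring R] [Algebra k R]

/-- The structure maps `D` on the algebra `R` are those determined by generators `x j` on which `G`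
acts by the characters `χ j`, which have degree `g j` in `G`, and which are primitive of
degree `1`. -/
structure IsDiagonal (D : BraidedData k G R) (E : ESC k G J) (x : J → R) : Prop where
  span_word : ∀ r, r ∈ Submodule.span k (Set.range (wordProd x))
  act_one : ∀ h, D.act h 1 = 1
  act_gen_mul : ∀ h j r, D.act h (x j * r) = (E.χ j h : k) • (x j * D.act h r)
  coact_one : D.coact 1 = 1
  coact_gen_mul : ∀ j r,
    D.coact (x j * r) = (MonoidAlgebra.single (E.g j) 1 ⊗ₜ x j) * D.coact r
  comul_one : D.comul 1 = 1 ⊗ₜ 1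
  comul_gen_mul : ∀ j r, D.comul (x j * r) =
    ((LinearMap.mulLeft k (x j)).rTensor R +
      TensorProduct.map (D.act (E.g j)) (LinearMap.mulLeft k (x j))) (D.comul r)
  counit_one : D.counit 1 = 1
  counit_gen_mul : ∀ j r, D.counit (x j * r) = 0
  deg_eq : ∀ n, D.deg n = Submodule.span k {a | ∃ u : List J, u.length = n ∧ wordProd x u = a}

namespace IsDiagonal

variable {D : BraidedData k G R} {E : ESC k G J} {x : J → R} (hD : D.IsDiagonal E x)
include hD

/-- Words span but may be dependent, so linear maps can be compared on them although they cannot be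
defined on them. -/
theorem ext {M : Type*} [AddCommGroup M] [Module k M] {f f' : R →ₗ[k] M}
    (h : ∀ u, f (wordProd x u) = f' (wordProd x u)) : f = f' := by
  refine LinearMap.ext fun r => ?_
  have := hD.span_word r
  induction this using Submodule.span_induction with
  | mem r hr => obtain ⟨u, rfl⟩ := hr; exact h u
  | zero => simp
  | add a b _ _ h1 h2 => rw [map_add, map_add, h1, h2]
  | smul c a _ h => rw [map_smul, map_smul, h]

theorem act_word (h : G) (u : List J) :
    D.act h (wordProd x u) = (E.wordχ u h : k) • wordProd x u := by
  induction u with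
  | nil => simp [hD.act_one]
  | cons j u ih => simp only [wordProd_cons, hD.act_gen_mul, ih, mul_smul_comm, smul_smul]; simp

theorem coact_word (u : List J) :
    D.coact (wordProd x u) = MonoidAlgebra.single (E.wordG u) 1 ⊗ₜ wordProd x u := by
  induction u with
  | nil => simp [hD.coact_one, MonoidAlgebra.one_def, Algebra.TensorProduct.one_def]
  | cons j u ih => rw [wordProd_cons, hD.coact_gen_mul, ih]; simp

theorem counit_word (u : List J) (hu : u ≠ []) : D.counit (wordProd x u) = 0 := by
  cases u with
  | nil => exact absurd rfl hu
  | cons j u => rw [wordProd_cons, hD.counit_gen_mul]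

theorem act_mul (h : G) (a b : R) : D.act h (a * b) = D.act h a * D.act h b := by
  suffices hs : D.act h ∘ₗ LinearMap.mulRight k b =
      LinearMap.mulRight k (D.act h b) ∘ₗ D.act h from LinearMap.congr_fun hs a
  refine hD.ext fun u => ?_
  simp only [LinearMap.comp_apply, LinearMap.mulRight_apply]
  induction u with
  | nil => simp [hD.act_one]
  | cons j u ih =>
    rw [wordProd_cons, mul_assoc, hD.act_gen_mul, hD.act_gen_mul, ih, smul_mul_assoc, mul_assoc]

theorem coact_mul (a b : R) : D.coact (a * b) = D.coact a * D.coact b := by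
  suffices hs : D.coact ∘ₗ LinearMap.mulRight k b =
      LinearMap.mulRight k (D.coact b) ∘ₗ D.coact from LinearMap.congr_fun hs a
  refine hD.ext fun u => ?_
  simp only [LinearMap.comp_apply, LinearMap.mulRight_apply]
  induction u with
  | nil => simp [hD.coact_one]
  | cons j u ih =>
    rw [wordProd_cons, mul_assoc, hD.coact_gen_mul, hD.coact_gen_mul, ih, mul_assoc]

theorem counit_mul (a b : R) : D.counit (a * b) = D.counit a * D.counit b := by
  suffices hs : D.counit ∘ₗ LinearMap.mulRight k b =
      LinearMap.mulRight k (D.counit b) ∘ₗ D.counit from LinearMap.congr_fun hs a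
  refine hD.ext fun u => ?_
  simp only [LinearMap.comp_apply, LinearMap.mulRight_apply]
  cases u with
  | nil => simp [hD.counit_one]
  | cons j u => rw [wordProd_cons, mul_assoc, hD.counit_gen_mul, hD.counit_gen_mul, zero_mul]

/-- Prepending a letter `j` puts it into the left tensor factor, or into the right one at the cost
of a character value. So each term distributes the letters of `u` over two words. -/
theorem comul_word_mem (u : List J) : D.comul (wordProd x u) ∈ Submodule.span k
    {z : R ⊗[k] R | ∃ v w : List J, (v ++ w).Perm u ∧ wordProd x v ⊗ₜ wordProd x w = z} := by
  induction u with
  | nil =>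
    rw [wordProd_nil, hD.comul_one]
    exact Submodule.subset_span ⟨[], [], by simp, by simp⟩
  | cons j u ih =>
    rw [wordProd_cons, hD.comul_gen_mul]
    generalize D.comul (wordProd x u) = X at ih ⊢
    induction ih using Submodule.span_induction with
    | mem z hz =>
      obtain ⟨v, w, h, rfl⟩ := hz
      simp only [LinearMap.add_apply, LinearMap.rTensor_tmul, TensorProduct.map_tmul,
        LinearMap.mulLeft_apply, hD.act_word, ← TensorProduct.smul_tmul', ← wordProd_cons]
      refine add_mem (Submodule.subset_span ⟨j :: v, w, by simpa using h, rfl⟩)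
        (Submodule.smul_mem _ _ (Submodule.subset_span ⟨v, j :: w, ?_, rfl⟩))
      exact List.perm_middle.trans (h.cons j)
    | zero => simp
    | add a b _ _ h1 h2 => rw [map_add]; exact add_mem h1 h2
    | smul c a _ h => rw [map_smul]; exact Submodule.smul_mem _ _ h

/-- Linear maps that agree on the homogeneous pure tensors occurring in the comultiplication of a
word agree on the comultiplication of that word. -/
theorem comul_word_ext {M : Type*} [AddCommGroup M] [Module k M] {f f' : R ⊗[k] R →ₗ[k] M}
    (u : List J) (h : ∀ v w : List J, (v ++ w).Perm u →
      f (wordProd x v ⊗ₜ wordProd x w) = f' (wordProd x v ⊗ₜ wordProd x w)) :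
    f (D.comul (wordProd x u)) = f' (D.comul (wordProd x u)) := by
  refine LinearMap.eqOn_span (s := {z : R ⊗[k] R | ∃ v w : List J, (v ++ w).Perm u ∧
    wordProd x v ⊗ₜ wordProd x w = z}) ?_ (hD.comul_word_mem u)
  rintro _ ⟨v, w, hvw, rfl⟩
  exact h v w hvw

/-- All terms `v ⊗ w` in the comultiplication of a word `u` carry the letters of `u`, hence the same
character. -/
theorem act_comul (h : G) (a : R) :
    D.comul (D.act h a) = TensorProduct.map (D.act h) (D.act h) (D.comul a) := by
  suffices hs : D.comul ∘ₗ D.act h = TensorProduct.map (D.act h) (D.act h) ∘ₗ D.comul from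
    LinearMap.congr_fun hs a
  refine hD.ext fun u => ?_
  rw [LinearMap.comp_apply, LinearMap.comp_apply, hD.act_word, map_smul]
  symm
  refine hD.comul_word_ext (f' := (E.wordχ u h : k) • LinearMap.id) u fun v w hvw => ?_
  rw [TensorProduct.map_tmul, hD.act_word, hD.act_word, TensorProduct.smul_tmul_smul,
    ← E.wordχ_perm hvw, E.wordχ_append]
  simp

theorem comul_coact (a : R) :
    D.comul.lTensor (MonoidAlgebra k G) (D.coact a) = D.coactTensor (D.comul a) := by
  suffices hs : D.comul.lTensor (MonoidAlgebra k G) ∘ₗ D.coact = D.coactTensor ∘ₗ D.comul from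
    LinearMap.congr_fun hs a
  refine hD.ext fun u => ?_
  rw [LinearMap.comp_apply, LinearMap.comp_apply, hD.coact_word, LinearMap.lTensor_tmul]
  refine hD.comul_word_ext
    (f := TensorProduct.mk k _ _ (MonoidAlgebra.single (E.wordG u) (1 : k))) u fun v w hvw => ?_
  simp [coactTensor, hD.coact_word, ← E.wordG_perm hvw, E.wordG_append]

/-- Both iterated comultiplications turn left multiplication by `x j` into one and the same operator
on the threefold tensor power, so they agree on words by induction. -/
theorem coassoc (a : R) : TensorProduct.assoc k R R R (D.comul.rTensor R (D.comul a)) =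
    D.comul.lTensor R (D.comul a) := by
  suffices hs : (TensorProduct.assoc k R R R).toLinearMap ∘ₗ D.comul.rTensor R ∘ₗ D.comul =
    D.comul.lTensor R ∘ₗ D.comul from LinearMap.congr_fun hs a
  refine hD.ext fun u => ?_
  simp only [LinearMap.comp_apply]
  induction u with
  | nil => simp [hD.comul_one]
  | cons j u ih =>
    let L : Module.End k (R ⊗[k] R) := (LinearMap.mulLeft k (x j)).rTensor R +
      TensorProduct.map (D.act (E.g j)) (LinearMap.mulLeft k (x j))
    -- This is left multiplication by `x ⊗ 1 ⊗ 1 + 1 ⊗ x ⊗ 1 + 1 ⊗ 1 ⊗ x` in the braided threefold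
    -- product, where `g j` acts on every factor that `x` passes.
    let L3 : Module.End k (R ⊗[k] (R ⊗[k] R)) := (LinearMap.mulLeft k (x j)).rTensor _ +
      TensorProduct.map (D.act (E.g j)) L
    have hL : ∀ a, D.comul (x j * a) = L (D.comul a) := hD.comul_gen_mul j
    have h1 : ∀ X, (TensorProduct.assoc k R R R).toLinearMap (D.comul.rTensor R (L X)) =
        L3 ((TensorProduct.assoc k R R R).toLinearMap (D.comul.rTensor R X)) := by
      intro X
      induction X with
      | zero => simp
      | add a b h1 h2 => simp only [map_add, h1, h2]
      | tmul a b =>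
        change (TensorProduct.assoc k R R R).toLinearMap (D.comul.rTensor R
          ((x j * a) ⊗ₜ b + D.act (E.g j) a ⊗ₜ (x j * b))) = _
        rw [map_add, LinearMap.rTensor_tmul, LinearMap.rTensor_tmul, LinearMap.rTensor_tmul, hL,
          hD.act_comul]
        generalize D.comul a = Y
        induction Y with
        | zero => simp
        | add a b h1 h2 =>
          simp only [map_add, TensorProduct.add_tmul] at h1 h2 ⊢
          rw [← h1, ← h2]; abel
        | tmul c d => simp [L, L3, TensorProduct.add_tmul, TensorProduct.tmul_add, add_assoc]
    have h2 : ∀ X, D.comul.lTensor R (L X) = L3 (D.comul.lTensor R X) := by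
      intro X
      induction X with
      | zero => simp
      | add a b h1 h2 => simp only [map_add, h1, h2]
      | tmul a b =>
        change D.comul.lTensor R ((x j * a) ⊗ₜ b + D.act (E.g j) a ⊗ₜ (x j * b)) = _
        rw [map_add, LinearMap.lTensor_tmul, LinearMap.lTensor_tmul, LinearMap.lTensor_tmul, hL]
        rfl
    rw [wordProd_cons, hL, h1, ih, h2]

/-- The counit kills the summand with `x j` on the left and does not see the action of `g j` in the
other one, so prepending `x j` only affects the right factor. -/
theorem rTensor_counit (a : R) : D.counit.rTensor R (D.comul a) = 1 ⊗ₜ a := by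
  suffices hs : D.counit.rTensor R ∘ₗ D.comul = TensorProduct.mk k k R 1 from
    LinearMap.congr_fun hs a
  refine hD.ext fun u => ?_
  simp only [LinearMap.comp_apply, TensorProduct.mk_apply]
  induction u with
  | nil => simp [hD.comul_one, hD.counit_one]
  | cons j u ih =>
    have h1 : ∀ X, D.counit.rTensor R (((LinearMap.mulLeft k (x j)).rTensor R +
      TensorProduct.map (D.act (E.g j)) (LinearMap.mulLeft k (x j))) X) =
        (LinearMap.mulLeft k (x j)).lTensor k (D.counit.rTensor R X) := by
      have h2 : D.counit ∘ₗ LinearMap.mulLeft k (x j) = 0 :=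
        LinearMap.ext fun a => hD.counit_gen_mul j a
      have h3 : D.counit ∘ₗ D.act (E.g j) = D.counit := hD.ext fun u => by
        rw [LinearMap.comp_apply, hD.act_word, map_smul]
        cases u with
        | nil => simp
        | cons j u => rw [hD.counit_word _ (by simp), smul_zero]
      intro X
      induction X with
      | zero => simp
      | add a b h1 h2 => simp only [map_add, h1, h2]
      | tmul a b =>
        have h4 := LinearMap.congr_fun h2 a
        have h5 := LinearMap.congr_fun h3 a
        simp only [LinearMap.comp_apply, LinearMap.mulLeft_apply, LinearMap.zero_apply] at h4 h5
        simp [h4, h5]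
    rw [wordProd_cons, hD.comul_gen_mul, h1, ih]
    simp

theorem act_counit (h : G) (a : R) : D.counit (D.act h a) = D.counit a := by
  suffices hs : D.counit ∘ₗ D.act h = D.counit from LinearMap.congr_fun hs a
  refine hD.ext fun u => ?_
  rw [LinearMap.comp_apply, hD.act_word, map_smul]
  cases u with
  | nil => simp
  | cons j u => rw [hD.counit_word _ (by simp), smul_zero]

theorem lTensor_counit (a : R) : D.counit.lTensor R (D.comul a) = a ⊗ₜ 1 := by
  suffices hs : D.counit.lTensor R ∘ₗ D.comul = (TensorProduct.mk k R k).flip 1 from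
    LinearMap.congr_fun hs a
  refine hD.ext fun u => ?_
  simp only [LinearMap.comp_apply, LinearMap.flip_apply, TensorProduct.mk_apply]
  induction u with
  | nil => simp [hD.comul_one, hD.counit_one]
  | cons j u ih =>
    have h1 : ∀ X, D.counit.lTensor R (((LinearMap.mulLeft k (x j)).rTensor R +
      TensorProduct.map (D.act (E.g j)) (LinearMap.mulLeft k (x j))) X) =
        (LinearMap.mulLeft k (x j)).rTensor k (D.counit.lTensor R X) := by
      intro X
      induction X with
      | zero => simp
      | add a b h1 h2 => simp only [map_add, h1, h2]
      | tmul a b => simp [hD.counit_gen_mul]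
    rw [wordProd_cons, hD.comul_gen_mul, h1, ih]
    simp

/-- A word is homogeneous for the coaction, so the braiding past it is just the action of its
degree. -/
theorem braidedMul_tmul_word (a : R) (w : List J) (c d : R) :
    D.braidedMul ((a ⊗ₜ wordProd x w) ⊗ₜ (c ⊗ₜ d)) =
      (a * D.act (E.wordG w) c) ⊗ₜ (wordProd x w * d) := by
  simp [braidedMul, braiding, hD.coact_word, actLin]

/-- Induction on the left factor: multiplying by `x j` on the left commutes with the braided product
because the degree of `j :: w` acts as `g j` followed by nothing but the degree of `w`, and `g j`
acts by algebra automorphisms. -/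
theorem comul_mul (a b : R) : D.comul (a * b) = D.braidedMul (D.comul a ⊗ₜ D.comul b) := by
  suffices hs : D.comul ∘ₗ LinearMap.mulRight k b =
      D.braidedMul ∘ₗ (TensorProduct.mk k _ _).flip (D.comul b) ∘ₗ D.comul from
    LinearMap.congr_fun hs a
  refine hD.ext fun u => ?_
  simp only [LinearMap.comp_apply, LinearMap.mulRight_apply]
  induction u with
  | nil =>
    simp only [wordProd_nil, one_mul, hD.comul_one, LinearMap.flip_apply,
      TensorProduct.mk_apply]
    generalize D.comul b = X
    induction X with
    | zero => simp
    | add a b h1 h2 => simp only [TensorProduct.tmul_add, map_add, ← h1, ← h2]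
    | tmul c d =>
      have := hD.braidedMul_tmul_word 1 [] c d
      simp only [wordProd_nil] at this
      simp [this]
  | cons j u ih =>
    rw [wordProd_cons, mul_assoc, hD.comul_gen_mul, hD.comul_gen_mul, ih]
    refine hD.comul_word_ext
      (f := ((LinearMap.mulLeft k (x j)).rTensor R +
        TensorProduct.map (D.act (E.g j)) (LinearMap.mulLeft k (x j))) ∘ₗ D.braidedMul ∘ₗ
          (TensorProduct.mk k _ _).flip (D.comul b))
      (f' := D.braidedMul ∘ₗ (TensorProduct.mk k _ _).flip (D.comul b) ∘ₗ
        ((LinearMap.mulLeft k (x j)).rTensor R +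
          TensorProduct.map (D.act (E.g j)) (LinearMap.mulLeft k (x j)))) u fun v w _ => ?_
    simp only [LinearMap.comp_apply, LinearMap.flip_apply, TensorProduct.mk_apply]
    generalize D.comul b = X
    induction X with
    | zero => simp
    | add a b h1 h2 => simp only [TensorProduct.tmul_add, map_add, h1, h2]
    | tmul c d =>
      simp only [LinearMap.add_apply, LinearMap.rTensor_tmul, TensorProduct.map_tmul,
        LinearMap.mulLeft_apply, TensorProduct.add_tmul, map_add, hD.braidedMul_tmul_word,
        ← wordProd_cons]
      rw [hD.act_mul, E.wordG_cons, map_mul]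
      simp [mul_assoc, wordProd_cons]

theorem word_mem_deg (u : List J) : wordProd x u ∈ D.deg u.length := by
  rw [hD.deg_eq]
  exact Submodule.subset_span ⟨u, rfl, rfl⟩

theorem comul_deg (n : ℕ) (a : R) (ha : a ∈ D.deg n) : D.comul a ∈ D.degTensor n := by
  rw [hD.deg_eq] at ha
  induction ha using Submodule.span_induction with
  | mem a h =>
    obtain ⟨u, hu, rfl⟩ := h
    refine Submodule.span_le.2 ?_ (hD.comul_word_mem u)
    rintro _ ⟨v, w, hvw, rfl⟩
    refine Submodule.mem_iSup_of_mem (v.length, w.length) (Submodule.mem_iSup_of_mem ?_ ?_)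
    · simpa [hu] using hvw.length_eq
    · exact ⟨⟨_, hD.word_mem_deg v⟩ ⊗ₜ ⟨_, hD.word_mem_deg w⟩, rfl⟩
  | zero => simp
  | add a b _ _ h1 h2 => rw [map_add]; exact add_mem h1 h2
  | smul c a _ h => rw [map_smul]; exact Submodule.smul_mem _ _ h

theorem deg_zero : D.deg 0 = 1 := by
  rw [hD.deg_eq, Submodule.one_eq_span]
  congr 1
  ext a
  simp [eq_comm]

theorem iSup_deg : ⨆ n, D.deg n = ⊤ := by
  refine eq_top_iff.2 fun r _ => Submodule.span_le.2 ?_ (hD.span_word r)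
  rintro _ ⟨u, rfl⟩
  exact Submodule.mem_iSup_of_mem u.length (hD.word_mem_deg u)

end IsDiagonal

end BraidedData

/-! ### Antipode, braided Hopf axioms and morphisms in the diagonal case -/

namespace BraidedData.IsDiagonal

variable {k G J R : Type*} [Field k] [Group G] [Ring R] [Algebra k R]
  {D : BraidedData k G R} {E : ESC k G J} {x : J → R} (hD : D.IsDiagonal E x)
include hD

/-- The underlying coalgebra. -/
abbrev coalgebra : Coalgebra k R where
  comul := D.comul
  counit := D.counit
  coassoc := LinearMap.ext hD.coassoc
  rTensor_counit_comp_comul := LinearMap.ext hD.rTensor_counit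
  lTensor_counit_comp_comul := LinearMap.ext hD.lTensor_counit

/-- In the convolution algebra `id = 1 - p`, where `p` vanishes at the unit and is therefore locally
nilpotent. The inverse is the geometric series in `p`, cut off according to the degree. -/
theorem exists_antipode (hi : DirectSum.IsInternal D.deg) : ∃ S : R →ₗ[k] R, ∀ a,
    LinearMap.mul' k R (S.rTensor R (D.comul a)) = algebraMap k R (D.counit a) ∧
    LinearMap.mul' k R (S.lTensor R (D.comul a)) = algebraMap k R (D.counit a) := by
  let _ := hD.coalgebra
  have one_apply : ∀ a, (1 : WithConv (R →ₗ[k] R)) a = algebraMap k R (D.counit a) := fun a => rfl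
  have mul_apply : ∀ (f g : WithConv (R →ₗ[k] R)) (a : R),
      (f * g) a = LinearMap.mul' k R (TensorProduct.map f.ofConv g.ofConv (D.comul a)) :=
    fun f g a => rfl
  let p : WithConv (R →ₗ[k] R) := 1 - WithConv.toConv LinearMap.id
  have hp1 : p 1 = 0 := by
    change (1 : WithConv (R →ₗ[k] R)) 1 - 1 = 0
    rw [one_apply, hD.counit_one, map_one, sub_self]
  -- In a term `v ⊗ w`, either `w` is empty and `p` kills it, or `v` is shorter than `u` and the
  -- induction hypothesis applies.
  have hp : ∀ n (u : List J), u.length < n → (p ^ n) (wordProd x u) = 0 := by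
    intro n
    induction n with
    | zero => intro u hu; omega
    | succ n ih =>
      intro u hu
      rw [pow_succ, mul_apply]
      refine hD.comul_word_ext (f := LinearMap.mul' k R ∘ₗ TensorProduct.map _ _) (f' := 0) u
        fun v w hvw => ?_
      have hl := hvw.length_eq
      rw [List.length_append] at hl
      simp only [LinearMap.comp_apply, TensorProduct.map_tmul, LinearMap.mul'_apply,
        LinearMap.zero_apply]
      cases w with
      | nil => exact mul_eq_zero_of_right _ hp1
      | cons j w =>
        simp only [List.length_cons] at hl
        exact mul_eq_zero_of_left (ih v (by omega)) _
  let e := LinearEquiv.ofBijective (DirectSum.coeLinearMap D.deg) hi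
  let s : ℕ → WithConv (R →ₗ[k] R) := fun n => ∑ i ∈ Finset.range n, p ^ i
  -- The cutoff `n + 1` depends on the degree, so the direct sum decomposition is needed to make the
  -- sum a linear map.
  let S : R →ₗ[k] R := (DirectSum.toModule k ℕ R fun n =>
    (s (n + 1)).ofConv ∘ₗ (D.deg n).subtype) ∘ₗ e.symm.toLinearMap
  have hs : ∀ u (n : ℕ), u.length ≤ n → s (n + 1) (wordProd x u) =
      s (u.length + 1) (wordProd x u) := by
    intro u n hn
    induction n, hn using Nat.le_induction with
    | base => rfl
    | succ n hn ih =>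
      rw [← ih]
      change (∑ i ∈ Finset.range (n + 1 + 1), p ^ i) (wordProd x u) = _
      rw [Finset.sum_range_succ]
      change s (n + 1) (wordProd x u) + (p ^ (n + 1)) (wordProd x u) = _
      rw [hp _ _ (by omega), add_zero]
  -- Any longer cutoff gives the same value, so one partial sum serves all the factors that occur in
  -- the comultiplication of a given word.
  have hS : ∀ u (n : ℕ), u.length ≤ n → S (wordProd x u) = s (n + 1) (wordProd x u) := by
    intro u n hn
    rw [hs u n hn]
    have : e.symm (wordProd x u) =
        DirectSum.lof k ℕ (fun n => D.deg n) u.length ⟨_, hD.word_mem_deg u⟩ := by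
      rw [LinearEquiv.symm_apply_eq]
      exact (DirectSum.coeLinearMap_lof D.deg u.length ⟨_, hD.word_mem_deg u⟩).symm
    simp only [S, LinearMap.comp_apply, LinearEquiv.coe_coe, this, DirectSum.toModule_lof]
    rfl
  have h1 : ∀ n, s n * WithConv.toConv LinearMap.id = 1 - p ^ n := fun n => by
    rw [← geom_sum_mul_neg]
    simp [s, p]
  have h2 : ∀ n, WithConv.toConv LinearMap.id * s n = 1 - p ^ n := fun n => by
    rw [← mul_neg_geom_sum]
    simp [s, p]
  have h3 : ∀ u : List J, (1 - p ^ (u.length + 1) : WithConv (R →ₗ[k] R)) (wordProd x u) =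
      algebraMap k R (D.counit (wordProd x u)) := fun u => by
    change (1 : WithConv (R →ₗ[k] R)) (wordProd x u) - (p ^ (u.length + 1)) (wordProd x u) = _
    rw [hp _ _ (by omega), one_apply, sub_zero]
  refine ⟨S, fun a => ⟨?_, ?_⟩⟩
  · suffices h : LinearMap.mul' k R ∘ₗ S.rTensor R ∘ₗ D.comul =
      Algebra.linearMap k R ∘ₗ D.counit from LinearMap.congr_fun h a
    refine hD.ext fun u => ?_
    have h4 := h3 u
    rw [← h1, mul_apply] at h4
    refine Eq.trans ?_ h4
    refine hD.comul_word_ext (f := LinearMap.mul' k R ∘ₗ S.rTensor R)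
      (f' := LinearMap.mul' k R ∘ₗ TensorProduct.map _ _) u fun v w hvw => ?_
    have hl := hvw.length_eq
    rw [List.length_append] at hl
    simp only [LinearMap.comp_apply, LinearMap.rTensor_tmul, hS v u.length (by omega)]
    rfl
  · suffices h : LinearMap.mul' k R ∘ₗ S.lTensor R ∘ₗ D.comul =
      Algebra.linearMap k R ∘ₗ D.counit from LinearMap.congr_fun h a
    refine hD.ext fun u => ?_
    have h4 := h3 u
    rw [← h2, mul_apply] at h4
    refine Eq.trans ?_ h4
    refine hD.comul_word_ext (f := LinearMap.mul' k R ∘ₗ S.lTensor R)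
      (f' := LinearMap.mul' k R ∘ₗ TensorProduct.map _ _) u fun v w hvw => ?_
    have hl := hvw.length_eq
    rw [List.length_append] at hl
    simp only [LinearMap.comp_apply, LinearMap.lTensor_tmul, hS w u.length (by omega)]
    rfl

theorem isGradedBraidedHopf (hi : DirectSum.IsInternal D.deg) : D.IsGradedBraidedHopf where
  coact_counit r := by
    suffices h : (TensorProduct.lid k R).toLinearMap ∘ₗ
      (Coalgebra.counit (R := k) (A := MonoidAlgebra k G)).rTensor R ∘ₗ D.coact = LinearMap.id from
      LinearMap.congr_fun h r
    refine hD.ext fun u => ?_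
    simp [hD.coact_word]
  coact_coassoc r := by
    suffices h : (TensorProduct.assoc k _ _ _).toLinearMap ∘ₗ
      (Coalgebra.comul (R := k) (A := MonoidAlgebra k G)).rTensor R ∘ₗ D.coact =
      D.coact.lTensor (MonoidAlgebra k G) ∘ₗ D.coact from LinearMap.congr_fun h r
    refine hD.ext fun u => ?_
    simp [hD.coact_word]
  yetterDrinfeld h r := by
    suffices hs : D.coact ∘ₗ D.act h = TensorProduct.map (LinearMap.mulLeftRight k
        (MonoidAlgebra.single h (1 : k), MonoidAlgebra.single h⁻¹ (1 : k))) (D.act h) ∘ₗ D.coact from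
      LinearMap.congr_fun hs r
    refine hD.ext fun u => ?_
    -- Conjugation by `h` fixes the degree of the word, which is central.
    simp [hD.coact_word, hD.act_word, ← E.wordG_comm]
  act_one := hD.act_one
  act_mul := hD.act_mul
  coact_one := hD.coact_one
  coact_mul := hD.coact_mul
  act_counit := hD.act_counit
  act_comul := hD.act_comul
  counit_coact r := by
    suffices hs : D.counit.lTensor (MonoidAlgebra k G) ∘ₗ D.coact =
        TensorProduct.mk k _ _ 1 ∘ₗ D.counit from LinearMap.congr_fun hs r
    refine hD.ext fun u => ?_
    cases u with
    | nil => simp [hD.coact_one, Algebra.TensorProduct.one_def]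
    | cons j u => simp [hD.coact_word, hD.counit_word]
  comul_coact := hD.comul_coact
  coassoc := hD.coassoc
  rTensor_counit := hD.rTensor_counit
  lTensor_counit := hD.lTensor_counit
  counit_one := hD.counit_one
  counit_mul := hD.counit_mul
  comul_one := hD.comul_one
  comul_mul := hD.comul_mul
  antipode := hD.exists_antipode hi
  isInternal := hi
  one_deg := hD.word_mem_deg []
  mul_deg m n a b ha hb := by
    have h : a * b ∈ D.deg m * D.deg n := Submodule.mul_mem_mul ha hb
    rw [hD.deg_eq m, hD.deg_eq n, Submodule.span_mul_span] at h
    refine Submodule.span_le.2 ?_ h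
    rintro _ ⟨_, ⟨u, rfl, rfl⟩, _, ⟨v, rfl, rfl⟩, rfl⟩
    have := hD.word_mem_deg (u ++ v)
    rw [List.length_append] at this
    simpa [wordProd] using this
  act_deg h n a ha := by
    rw [hD.deg_eq] at ha ⊢
    refine (Submodule.span_le (p := (Submodule.span k _).comap (D.act h))).2 ?_ ha
    rintro _ ⟨u, hu, rfl⟩
    rw [SetLike.mem_coe, Submodule.mem_comap, hD.act_word]
    exact Submodule.smul_mem _ _ (Submodule.subset_span ⟨u, hu, rfl⟩)
  coact_deg n a ha := by
    rw [hD.deg_eq] at ha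
    refine (Submodule.span_le (p := Submodule.comap D.coact (LinearMap.range _))).2 ?_ ha
    rintro _ ⟨u, rfl, rfl⟩
    rw [SetLike.mem_coe, Submodule.mem_comap, hD.coact_word]
    exact ⟨_ ⊗ₜ ⟨_, hD.word_mem_deg u⟩, rfl⟩
  counit_deg n a hn ha := by
    rw [hD.deg_eq] at ha
    refine (Submodule.span_le (p := LinearMap.ker D.counit)).2 ?_ ha
    rintro _ ⟨u, hu, rfl⟩
    exact hD.counit_word u (by rintro rfl; exact hn hu.symm)
  comul_deg := hD.comul_deg

variable {R' : Type*} [Ring R'] [Algebra k R'] {D' : BraidedData k G R'} {x' : J → R'}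

theorem map_act (hD' : D'.IsDiagonal E x') (f : R →ₐ[k] R') (hf : ∀ j, f (x j) = x' j)
    (h : G) (r : R) : D'.act h (f r) = f (D.act h r) := by
  suffices hs : D'.act h ∘ₗ f.toLinearMap = f.toLinearMap ∘ₗ D.act h from LinearMap.congr_fun hs r
  refine hD.ext fun u => ?_
  simp [map_wordProd f hf, hD.act_word, hD'.act_word]

/-- The rules for multiplying by a generator are the same on both sides, so agreement on generators
propagates to all words. -/
theorem isInduced (hD' : D'.IsDiagonal E x') (f : R →ₐ[k] R') (hf : ∀ j, f (x j) = x' j) :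
    D.IsInduced D' f where
  surjective r := by
    have := hD'.span_word r
    induction this using Submodule.span_induction with
    | mem r hr => obtain ⟨u, rfl⟩ := hr; exact ⟨_, map_wordProd f hf u⟩
    | zero => exact ⟨0, map_zero f⟩
    | add a b _ _ h1 h2 =>
      obtain ⟨a, rfl⟩ := h1; obtain ⟨b, rfl⟩ := h2; exact ⟨a + b, map_add f a b⟩
    | smul c a _ h => obtain ⟨a, rfl⟩ := h; exact ⟨c • a, map_smul f c a⟩
  act := hD.map_act hD' f hf
  coact r := by
    suffices hs : D'.coact ∘ₗ f.toLinearMap = f.toLinearMap.lTensor _ ∘ₗ D.coact from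
      LinearMap.congr_fun hs r
    refine hD.ext fun u => ?_
    simp [map_wordProd f hf, hD.coact_word, hD'.coact_word]
  comul r := by
    suffices hs : D'.comul ∘ₗ f.toLinearMap =
        TensorProduct.map f.toLinearMap f.toLinearMap ∘ₗ D.comul from LinearMap.congr_fun hs r
    refine hD.ext fun u => ?_
    simp only [LinearMap.comp_apply, AlgHom.toLinearMap_apply]
    induction u with
    | nil => simp [hD.comul_one, hD'.comul_one]
    | cons j u ih =>
      rw [wordProd_cons, map_mul, hf, hD'.comul_gen_mul, ih, hD.comul_gen_mul]
      generalize D.comul (wordProd x u) = X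
      induction X with
      | zero => simp
      | add a b h1 h2 => simp only [map_add, h1, h2]
      | tmul a b => simp [hD.map_act hD' f hf, hf]
  counit r := by
    suffices hs : D'.counit ∘ₗ f.toLinearMap = D.counit from LinearMap.congr_fun hs r
    refine hD.ext fun u => ?_
    cases u with
    | nil => simp [hD.counit_one, hD'.counit_one]
    | cons j u => simp [map_wordProd f hf, hD.counit_word, hD'.counit_word]
  deg n := by
    rw [hD.deg_eq, hD'.deg_eq, Submodule.map_span]
    congr 1
    ext a
    constructor
    · rintro ⟨u, hu, rfl⟩
      exact ⟨_, ⟨u, hu, rfl⟩, map_wordProd f hf u⟩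
    · rintro ⟨_, ⟨u, hu, rfl⟩, rfl⟩
      exact ⟨u, hu, (map_wordProd f hf u).symm⟩

theorem isIso (hD' : D'.IsDiagonal E x') (f : R ≃ₐ[k] R') (hf : ∀ j, f (x j) = x' j) :
    D.IsIso D' f where
  act h r := ((hD.isInduced hD' f.toAlgHom hf).act h r).symm
  coact := (hD.isInduced hD' f.toAlgHom hf).coact
  comul := (hD.isInduced hD' f.toAlgHom hf).comul
  counit := (hD.isInduced hD' f.toAlgHom hf).counit
  deg n r := by
    rw [(hD.isInduced hD' f.toAlgHom hf).deg n]
    constructor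
    · rintro ⟨s, hs, h⟩
      rwa [← f.injective h]
    · exact fun h => ⟨r, h, rfl⟩

end BraidedData.IsDiagonal

/-! ### Spans of words -/

section Words

variable {k J R : Type*} [Field k] [Ring R] [Algebra k R] (x : J → R)

theorem wordProd_append (u v : List J) : wordProd x (u ++ v) = wordProd x u * wordProd x v := by
  simp [wordProd]

theorem span_range_pow (n : ℕ) : Submodule.span k (Set.range x) ^ n =
    Submodule.span k {a | ∃ u : List J, u.length = n ∧ wordProd x u = a} := by
  induction n with
  | zero =>
    rw [pow_zero, Submodule.one_eq_span]
    congr 1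
    ext a
    simp [eq_comm]
  | succ n ih =>
    rw [pow_succ', ih, Submodule.span_mul_span]
    congr 1
    ext a
    constructor
    · rintro ⟨_, ⟨j, rfl⟩, _, ⟨u, rfl, rfl⟩, rfl⟩
      exact ⟨j :: u, rfl, wordProd_cons x j u⟩
    · rintro ⟨u, hu, rfl⟩
      cases u with
      | nil => simp at hu
      | cons j u =>
        exact ⟨_, ⟨j, rfl⟩, _, ⟨u, by simpa using hu, rfl⟩, (wordProd_cons x j u).symm⟩

theorem mem_span_wordProd {a : R} (ha : a ∈ Algebra.adjoin k (Set.range x)) :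
    a ∈ Submodule.span k (Set.range (wordProd x)) := by
  rw [← Subalgebra.mem_toSubmodule, Algebra.adjoin_eq_span] at ha
  refine Submodule.span_mono ?_ ha
  intro b hb
  induction hb using Submonoid.closure_induction with
  | mem b hb => obtain ⟨j, rfl⟩ := hb; exact ⟨[j], by simp [wordProd]⟩
  | one => exact ⟨[], rfl⟩
  | mul b c _ _ hb hc =>
    obtain ⟨u, rfl⟩ := hb
    obtain ⟨v, rfl⟩ := hc
    exact ⟨u ++ v, wordProd_append x u v⟩

end Words

/-! ### Gradings and injective linear maps -/

/-- Split `v` into its part in `A n` and a part `c` in the other components. Then `f c` lies both in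
`B n` and in the sum of the other `B i`, so `c = 0`. This turns inclusions of graded pieces into
equalities. -/
theorem mem_of_map_mem_of_iSupIndep {k ι V W : Type*} [Field k] [AddCommGroup V] [AddCommGroup W]
    [Module k V] [Module k W] {A : ι → Submodule k V} {B : ι → Submodule k W}
    (hA : ⨆ i, A i = ⊤) (hB : iSupIndep B) {f : V →ₗ[k] W} (hf : Function.Injective f)
    (hAB : ∀ i, A i ≤ (B i).comap f) {n : ι} {v : V} (hv : f v ∈ B n) : v ∈ A n := by
  have h : v ∈ A n ⊔ ⨆ (i) (_ : i ≠ n), A i := by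
    rw [← iSup_split_single, hA]; trivial
  obtain ⟨a, ha, c, hc, rfl⟩ := Submodule.mem_sup.1 h
  have h1 : f c ∈ B n := by
    have := sub_mem hv (hAB n ha)
    rwa [map_add, add_sub_cancel_left] at this
  have h2 : f c ∈ ⨆ (i) (_ : i ≠ n), B i := by
    have h3 : ⨆ (i) (_ : i ≠ n), A i ≤ (⨆ (i) (_ : i ≠ n), B i).comap f :=
      iSup₂_le fun i hi => (hAB i).trans (Submodule.comap_mono (le_iSup₂_of_le i hi le_rfl))
    exact h3 hc
  have h3 := Submodule.disjoint_def.1 (hB n) _ h1 h2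
  rw [← map_zero f] at h3
  rw [hf h3, add_zero]
  exact ha

theorem iSupIndep_comap {k ι V W : Type*} [Field k] [AddCommGroup V] [AddCommGroup W]
    [Module k V] [Module k W] {B : ι → Submodule k W} (hB : iSupIndep B) {f : V →ₗ[k] W}
    (hf : Function.Injective f) : iSupIndep fun i => (B i).comap f := by
  intro i
  rw [Submodule.disjoint_def]
  intro v h1 h2
  have h3 : ⨆ (j) (_ : j ≠ i), (B j).comap f ≤ (⨆ (j) (_ : j ≠ i), B j).comap f :=
    iSup₂_le fun j hj => Submodule.comap_mono (le_iSup₂_of_le j hj le_rfl)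
  have h4 := Submodule.disjoint_def.1 (hB i) _ h1 (h3 h2)
  rw [← map_zero f] at h4
  exact hf h4

/-! ### Quantum tensor algebras -/

namespace ESC

variable {k G J : Type*} [Field k] [Group G] (E : ESC k G J)

theorem tensorData_isDiagonal : E.tensorData.IsDiagonal E (FreeAlgebra.ι k) where
  span_word r := mem_span_wordProd _ (by rw [FreeAlgebra.adjoin_range_ι]; trivial)
  act_one h := map_one (E.tensorAct h)
  act_gen_mul h j r := by
    change E.tensorAct h _ = _ • (_ * E.tensorAct h _)
    rw [map_mul, tensorAct, FreeAlgebra.lift_ι_apply, smul_mul_assoc]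
  coact_one := map_one (FreeAlgebra.lift k _)
  coact_gen_mul j r := by simp [tensorData]
  comul_one := by simp [tensorData]
  comul_gen_mul j r := E.tensorData_comul_ι_mul j r
  counit_one := map_one (FreeAlgebra.lift k _)
  counit_gen_mul j r := by simp [tensorData]
  deg_eq n := span_range_pow _ n

end ESC

/-! ### Diagrams generated by skew primitive elements -/

namespace GradedOver

variable {k G J H : Type*} [Field k] [Group G] [Ring H] [Bialgebra k H]

/-- The elements of `G` as elements of `H`. -/
def grp (D : GradedOver k G H) : G →* H :=
  ((D.incl : MonoidAlgebra k G →ₐ[k] H) : MonoidAlgebra k G →* H).comp (MonoidAlgebra.of k G)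

theorem incl_single (D : GradedOver k G H) (g : G) :
    D.incl (MonoidAlgebra.single g 1) = D.grp g := rfl

/-- `H` is generated by `kG` and by the skew primitive elements `a j` of degree one, on which `G`
acts by the characters `χ j`. -/
structure IsGenerated (D : GradedOver k G H) (E : ESC k G J) (a : J → H) : Prop where
  comul_gen : ∀ j, Coalgebra.comul (R := k) (a j) = D.grp (E.g j) ⊗ₜ a j + a j ⊗ₜ 1
  grp_mul_gen : ∀ h j, D.grp h * a j = (E.χ j h : k) • (a j * D.grp h)
  span_word : ∀ b, b ∈ Submodule.span k
    (Set.range fun p : List J × G => wordProd a p.1 * D.grp p.2)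
  word_deg : ∀ u h, wordProd a u * D.grp h ∈ D.deg u.length
  indep : iSupIndep D.deg

section

variable (D : GradedOver k G H)

theorem proj_grp (g : G) : D.proj (D.grp g) = MonoidAlgebra.single g 1 := D.proj_incl _

theorem rcoact_grp (g : G) : D.rcoact (D.grp g) = D.grp g ⊗ₜ MonoidAlgebra.single g 1 :=
  D.rcoact_incl g

theorem comul_grp (g : G) : Coalgebra.comul (R := k) (D.grp g) = D.grp g ⊗ₜ D.grp g := by
  rw [← incl_single, ← CoalgHomClass.map_comp_comul_apply]
  simp

theorem counit_grp (g : G) : Coalgebra.counit (R := k) (D.grp g) = 1 := by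
  rw [← incl_single, CoalgHomClass.counit_comp_apply]
  simp

theorem mulAntipode_tmul' (a : H) (g : G) :
    D.mulAntipode (a ⊗ₜ MonoidAlgebra.single g 1) = a * D.grp g⁻¹ := D.mulAntipode_tmul a g

omit [Group G] in
theorem ext_tmul_single {M : Type*} [AddCommGroup M] [Module k M]
    {f f' : H ⊗[k] MonoidAlgebra k G →ₗ[k] M}
    (h : ∀ a g, f (a ⊗ₜ MonoidAlgebra.single g 1) = f' (a ⊗ₜ MonoidAlgebra.single g 1)) :
    f = f' := by
  ext a g
  simpa using h a g

/-- The right coaction is multiplicative and sends `a` to `a ⊗ 1`, so nothing of `a` reaches the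
antipode. -/
theorem omega_diag_mul {a : H} (ha : a ∈ D.diag) (h : H) : D.omega (a * h) = a * D.omega h := by
  suffices hs : D.mulAntipode ∘ₗ LinearMap.mulLeft k (a ⊗ₜ 1) =
      LinearMap.mulLeft k a ∘ₗ D.mulAntipode by
    have := LinearMap.congr_fun hs (D.rcoact h)
    simp only [LinearMap.comp_apply, LinearMap.mulLeft_apply] at this
    rw [omega, LinearMap.comp_apply, AlgHom.toLinearMap_apply, map_mul, D.mem_diag.1 ha, this]
    rfl
  refine ext_tmul_single fun c g => ?_
  simp [mulAntipode_tmul', mul_assoc]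

/-- The antipode reverses products, so the second copy of `g` comes out as `g⁻¹` on the far right.
This is the source of the adjoint action in the braided comultiplication. -/
theorem omega_grp_mul (g : G) (h : H) : D.omega (D.grp g * h) = D.grp g * D.omega h * D.grp g⁻¹ := by
  suffices hs : D.mulAntipode ∘ₗ LinearMap.mulLeft k (D.grp g ⊗ₜ MonoidAlgebra.single g 1) =
      LinearMap.mulRight k (D.grp g⁻¹) ∘ₗ LinearMap.mulLeft k (D.grp g) ∘ₗ D.mulAntipode by
    have := LinearMap.congr_fun hs (D.rcoact h)
    simp only [LinearMap.comp_apply, LinearMap.mulLeft_apply, LinearMap.mulRight_apply] at this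
    rw [omega, LinearMap.comp_apply, AlgHom.toLinearMap_apply, map_mul, rcoact_grp, this]
    rfl
  refine ext_tmul_single fun c g => ?_
  simp [mulAntipode_tmul', mul_assoc]

/-- The factor `g` meets its own inverse from the antipode. -/
theorem omega_mul_grp (h : H) (g : G) : D.omega (h * D.grp g) = D.omega h := by
  suffices hs : D.mulAntipode ∘ₗ LinearMap.mulRight k (D.grp g ⊗ₜ MonoidAlgebra.single g 1) =
      D.mulAntipode by
    have := LinearMap.congr_fun hs (D.rcoact h)
    simp only [LinearMap.comp_apply, LinearMap.mulRight_apply] at this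
    rw [omega, LinearMap.comp_apply, AlgHom.toLinearMap_apply, map_mul, rcoact_grp, this]
    rfl
  refine ext_tmul_single fun c g => ?_
  simp [mulAntipode_tmul', mul_assoc, ← map_mul]

end

namespace IsGenerated

variable {D : GradedOver k G H} {E : ESC k G J} {a : J → H} (hD : D.IsGenerated E a)
include hD

theorem gen_deg (j : J) : a j ∈ D.deg 1 := by
  have := hD.word_deg [j] 1
  simpa [wordProd] using this

theorem proj_gen (j : J) : D.proj (a j) = 0 := D.proj_deg 1 _ one_ne_zero (hD.gen_deg j)

theorem counit_gen (j : J) : Coalgebra.counit (R := k) (a j) = 0 := by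
  rw [← CoalgHomClass.counit_comp_apply D.proj, hD.proj_gen, map_zero]

theorem gen_mem (j : J) : a j ∈ D.diag := by
  rw [mem_diag, rcoact_apply, hD.comul_gen]
  have h1 : (D.proj : H →ₗ[k] MonoidAlgebra k G) (a j) = 0 := hD.proj_gen j
  have h2 : (D.proj : H →ₗ[k] MonoidAlgebra k G) 1 = 1 := map_one D.proj
  rw [map_add, LinearMap.lTensor_tmul, LinearMap.lTensor_tmul, h1, h2, TensorProduct.tmul_zero,
    zero_add]

/-- The generators as elements of the diagram. -/
def gen (j : J) : D.diag := ⟨a j, hD.gen_mem j⟩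

theorem val_word (u : List J) : ((wordProd hD.gen u : D.diag) : H) = wordProd a u :=
  map_wordProd D.diag.val (fun _ => rfl) u

/-- The map `ω` is the identity on the diagram and sends a word times a group element to the word,
while such products span `H`. -/
theorem span_diag (r : D.diag) : r ∈ Submodule.span k (Set.range (wordProd hD.gen)) := by
  have h1 : ∀ b, D.omegaR b ∈ Submodule.span k (Set.range (wordProd hD.gen)) := by
    intro b
    have := hD.span_word b
    induction this using Submodule.span_induction with
    | mem b hb =>
      obtain ⟨⟨u, g⟩, rfl⟩ := hb
      refine Submodule.subset_span ⟨u, Subtype.ext ?_⟩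
      change _ = D.omega _
      rw [omega_mul_grp, ← hD.val_word, D.omega_eq_self (wordProd hD.gen u).2]
    | zero => simp
    | add a b _ _ h1 h2 => rw [map_add]; exact add_mem h1 h2
    | smul c a _ h => rw [map_smul]; exact Submodule.smul_mem _ _ h
  have h2 : D.omegaR r = r := Subtype.ext (D.omega_eq_self r.2)
  rw [← h2]
  exact h1 r

/-- Multiply the comultiplication of `r` by `g_j ⊗ a_j + a_j ⊗ 1`. For the coaction, `π₀` kills the
second summand. For the comultiplication, left linearity of `ω` over the diagram handles `a_j`, and
the conjugation rule for `ω` turns `g_j` into the action. -/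
theorem diagData_isDiagonal : D.diagData.IsDiagonal E hD.gen where
  span_word := hD.span_diag
  act_one h := Subtype.ext <| by
    change D.grp h * 1 * D.grp h⁻¹ = 1
    rw [mul_one, ← map_mul, mul_inv_cancel, map_one]
  act_gen_mul h j r := Subtype.ext <| by
    change D.grp h * (a j * r) * D.grp h⁻¹ = (E.χ j h : k) • (a j * (D.grp h * r * D.grp h⁻¹))
    rw [← mul_assoc, hD.grp_mul_gen, smul_mul_assoc, smul_mul_assoc]
    simp only [mul_assoc]
  coact_one := by
    change TensorProduct.map _ D.omegaR (Coalgebra.comul (R := k) (1 : H)) = 1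
    have h1 : D.omegaR 1 = 1 := Subtype.ext (D.omega_eq_self (one_mem _))
    have h2 : (D.proj : H →ₗ[k] MonoidAlgebra k G) 1 = 1 := map_one D.proj
    rw [Bialgebra.comul_one, Algebra.TensorProduct.one_def, TensorProduct.map_tmul, h1, h2]
    rfl
  coact_gen_mul j r := by
    change TensorProduct.map _ D.omegaR (Coalgebra.comul (R := k) (a j * r)) =
      _ * TensorProduct.map _ D.omegaR (Coalgebra.comul (R := k) (r : H))
    rw [Bialgebra.comul_mul, hD.comul_gen]
    generalize Coalgebra.comul (R := k) (r : H) = Y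
    induction Y with
    | zero => simp
    | add a b h1 h2 => simp only [mul_add, map_add, h1, h2]
    | tmul b c =>
      have h1 : D.omegaR (a j * c) = hD.gen j * D.omegaR c :=
        Subtype.ext (D.omega_diag_mul (hD.gen_mem j) c)
      have h2 : (D.proj : H →ₗ[k] MonoidAlgebra k G) (a j * b) = 0 := by
        refine (map_mul D.proj _ _).trans ?_
        rw [hD.proj_gen, zero_mul]
      have h3 : (D.proj : H →ₗ[k] MonoidAlgebra k G) (D.grp (E.g j) * b) =
          MonoidAlgebra.single (E.g j) 1 * D.proj b := by
        refine (map_mul D.proj _ _).trans ?_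
        rw [proj_grp]
      simp only [add_mul, Algebra.TensorProduct.tmul_mul_tmul, map_add, TensorProduct.map_tmul, h1,
        h2, h3, TensorProduct.zero_tmul, add_zero]
      rfl
  comul_one := by
    change TensorProduct.map D.omegaR D.omegaR (Coalgebra.comul (R := k) (1 : H)) = _
    have h1 : D.omegaR 1 = 1 := Subtype.ext (D.omega_eq_self (one_mem _))
    rw [Bialgebra.comul_one, Algebra.TensorProduct.one_def, TensorProduct.map_tmul, h1]
  comul_gen_mul j r := by
    change TensorProduct.map D.omegaR D.omegaR (Coalgebra.comul (R := k) (a j * r)) =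
      ((LinearMap.mulLeft k (hD.gen j)).rTensor D.diag + TensorProduct.map (D.diagData.act (E.g j))
        (LinearMap.mulLeft k (hD.gen j))) (TensorProduct.map D.omegaR D.omegaR (Coalgebra.comul (R := k) (r : H)))
    rw [Bialgebra.comul_mul, hD.comul_gen]
    generalize Coalgebra.comul (R := k) (r : H) = Y
    induction Y with
    | zero => simp
    | add a b h1 h2 => simp only [mul_add, map_add, h1, h2]
    | tmul b c =>
      have h1 : ∀ c, D.omegaR (a j * c) = hD.gen j * D.omegaR c := fun c =>
        Subtype.ext (D.omega_diag_mul (hD.gen_mem j) c)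
      have h3 : D.omegaR (D.grp (E.g j) * b) = D.diagData.act (E.g j) (D.omegaR b) :=
        Subtype.ext (D.omega_grp_mul (E.g j) b)
      simp only [add_mul, Algebra.TensorProduct.tmul_mul_tmul, map_add, TensorProduct.map_tmul, h1,
        h3, one_mul, LinearMap.add_apply, LinearMap.rTensor_tmul, LinearMap.mulLeft_apply]
      rw [add_comm]
  counit_one := Bialgebra.counit_one
  counit_gen_mul j r := by
    change Coalgebra.counit (R := k) (a j * r) = 0
    rw [Bialgebra.counit_mul, hD.counit_gen, zero_mul]
  deg_eq n := by
    have hle : ∀ n, Submodule.span k {b | ∃ u : List J, u.length = n ∧ wordProd hD.gen u = b} ≤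
        D.diagData.deg n := by
      intro n
      rw [Submodule.span_le]
      rintro _ ⟨u, rfl, rfl⟩
      change ((wordProd hD.gen u : D.diag) : H) ∈ D.deg _
      have := hD.word_deg u 1
      rwa [map_one, mul_one, ← hD.val_word] at this
    refine le_antisymm (fun r hr => ?_) (hle n)
    -- The spans of words of fixed length already exhaust the diagram, so they cannot be smaller
    -- than its graded pieces.
    refine mem_of_map_mem_of_iSupIndep (A := fun n => Submodule.span k
      {b | ∃ u : List J, u.length = n ∧ wordProd hD.gen u = b})
      ?_ hD.indep (f := D.diag.val.toLinearMap) Subtype.val_injective hle hr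
    refine eq_top_iff.2 fun r _ => Submodule.span_le.2 ?_ (hD.span_diag r)
    rintro _ ⟨u, rfl⟩
    exact Submodule.mem_iSup_of_mem u.length (Submodule.subset_span ⟨u, rfl, rfl⟩)

theorem diagData_isGradedBraidedHopf : D.diagData.IsGradedBraidedHopf :=
  hD.diagData_isDiagonal.isGradedBraidedHopf <|
    DirectSum.isInternal_submodule_of_iSupIndep_of_iSup_eq_top
      (iSupIndep_comap (f := D.diag.val.toLinearMap) hD.indep Subtype.val_injective)
      hD.diagData_isDiagonal.iSup_deg

theorem grp_mul_word (h : G) (u : List J) :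
    D.grp h * wordProd a u = (E.wordχ u h : k) • (wordProd a u * D.grp h) := by
  induction u with
  | nil => simp
  | cons j u ih =>
    rw [wordProd_cons, ← mul_assoc, hD.grp_mul_gen, smul_mul_assoc, mul_assoc, ih, mul_smul_comm,
      smul_smul, E.wordχ_cons, Units.val_mul, mul_assoc]

end IsGenerated

end GradedOver

/-! ### Biproducts -/

theorem tmul_single_ext {k G A M : Type*} [Field k] [AddCommGroup A] [Module k A] [AddCommGroup M]
    [Module k M] {f f' : A ⊗[k] MonoidAlgebra k G →ₗ[k] M}
    (h : ∀ a g, f (a ⊗ₜ MonoidAlgebra.single g 1) = f' (a ⊗ₜ MonoidAlgebra.single g 1)) :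
    f = f' := by
  ext a g
  simpa using h a g

/-- Used for maps out of algebras given by generators or relations, where a spanning family is easy
to find and independence is visible only in the target. -/
theorem injective_of_linearIndependent {k ι V W : Type*} [Field k] [AddCommGroup V] [Module k V]
    [AddCommGroup W] [Module k W] {v : ι → V} (hv : ∀ x, x ∈ Submodule.span k (Set.range v))
    {f : V →ₗ[k] W} (h : LinearIndependent k (f ∘ v)) : Function.Injective f := by
  rw [← LinearMap.ker_eq_bot, LinearMap.ker_eq_bot']
  intro x hx
  obtain ⟨c, rfl⟩ := (Finsupp.mem_span_range_iff_exists_finsupp).1 (hv x)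
  rw [← Finsupp.linearCombination_apply, Finsupp.apply_linearCombination] at hx
  rw [linearIndependent_iff.1 h c hx, Finsupp.sum_zero_index]

namespace BraidedData.IsDiagonal

variable {k G J R : Type*} [Field k] [Group G] [Ring R] [Algebra k R]
  {D : BraidedData k G R} {E : ESC k G J} {x : J → R} (hD : D.IsDiagonal E x)
include hD

omit hD in
theorem biprodMul_tmul (r r' : R) (h h' : G) :
    D.biprodMul ((r ⊗ₜ MonoidAlgebra.single h 1) ⊗ₜ (r' ⊗ₜ MonoidAlgebra.single h' 1)) =
      (r * D.act h r') ⊗ₜ MonoidAlgebra.single (h * h') 1 := by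
  simp [biprodMul, actLin]

theorem ext_biprod {M : Type*} [AddCommGroup M] [Module k M]
    {f f' : R ⊗[k] MonoidAlgebra k G →ₗ[k] M}
    (h : ∀ u g, f (wordProd x u ⊗ₜ MonoidAlgebra.single g 1) =
      f' (wordProd x u ⊗ₜ MonoidAlgebra.single g 1)) : f = f' :=
  tmul_single_ext fun a g => LinearMap.congr_fun
    (hD.ext (f := f ∘ₗ (TensorProduct.mk k R _).flip (MonoidAlgebra.single g 1))
      (f' := f' ∘ₗ (TensorProduct.mk k R _).flip (MonoidAlgebra.single g 1))
      fun u => h u g) a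

theorem iSup_biprodDeg : ⨆ n, D.biprodDeg n = ⊤ := by
  refine eq_top_iff.2 fun z _ => ?_
  -- Membership is restated as the vanishing of a linear map, so that extensionality on words and
  -- group elements applies.
  suffices h : (⨆ n, D.biprodDeg n).mkQ = 0 by
    rw [← Submodule.Quotient.mk_eq_zero]
    exact LinearMap.congr_fun h z
  refine hD.ext_biprod fun u g => ?_
  rw [LinearMap.zero_apply, Submodule.mkQ_apply, Submodule.Quotient.mk_eq_zero]
  exact Submodule.mem_iSup_of_mem u.length ⟨⟨_, hD.word_mem_deg u⟩ ⊗ₜ _, rfl⟩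

variable {H : Type*} [Ring H] [Bialgebra k H] {DH : GradedOver k G H} {a : J → H}

/-- The smash product rule is the commutation relation between `G` and the words, and the smash
coproduct reproduces the skew primitive comultiplication of the generators. Any linear isomorphism
of the form `r ⊗ g ↦ F r * g` therefore respects everything. -/
theorem isBiprodIso (hH : DH.IsGenerated E a) (F : R →ₐ[k] H) (hF : ∀ j, F (x j) = a j)
    (f : (R ⊗[k] MonoidAlgebra k G) ≃ₗ[k] H)
    (hf : ∀ r g, f (r ⊗ₜ MonoidAlgebra.single g 1) = F r * DH.grp g) : DH.IsBiprodIso D f where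
  one := by rw [MonoidAlgebra.one_def, hf, map_one, map_one, one_mul]
  mul y z := by
    -- The action on `R` becomes conjugation in `H`; this relation is all that multiplicativity
    -- requires.
    have hact : ∀ h r, F (D.act h r) * DH.grp h = DH.grp h * F r := by
      intro h r
      suffices hs : LinearMap.mulRight k (DH.grp h) ∘ₗ F.toLinearMap ∘ₗ D.act h =
          LinearMap.mulLeft k (DH.grp h) ∘ₗ F.toLinearMap from LinearMap.congr_fun hs r
      refine hD.ext fun u => ?_
      simp [hD.act_word, map_wordProd F hF, hH.grp_mul_word]
    suffices hs : (LinearMap.compr₂ (TensorProduct.mk k _ _) (f.toLinearMap ∘ₗ D.biprodMul)) =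
        (LinearMap.mul k H).compl₁₂ f.toLinearMap f.toLinearMap from
      LinearMap.congr_fun (LinearMap.congr_fun hs y) z
    refine tmul_single_ext fun r h => tmul_single_ext fun r' h' => ?_
    simp only [LinearMap.compr₂_apply, TensorProduct.mk_apply, LinearMap.comp_apply,
      LinearMap.compl₁₂_apply, LinearEquiv.coe_coe, biprodMul_tmul, hf, LinearMap.mul_apply',
      map_mul, mul_assoc]
    rw [← mul_assoc (DH.grp h), ← hact]
    simp only [mul_assoc]
  comul y := by
    suffices hs : Coalgebra.comul (R := k) ∘ₗ f.toLinearMap =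
        TensorProduct.map f.toLinearMap f.toLinearMap ∘ₗ D.biprodComul from
      LinearMap.congr_fun hs y
    refine hD.ext_biprod fun u g => ?_
    have h1 : D.biprodComul (wordProd x u ⊗ₜ MonoidAlgebra.single g 1) =
        midMap ((LinearMap.mul' k (MonoidAlgebra k G)).rTensor R ∘ₗ
          (TensorProduct.rightComm k (MonoidAlgebra k G) R (MonoidAlgebra k G)).toLinearMap ∘ₗ
          D.coact.rTensor (MonoidAlgebra k G)) (D.comul (wordProd x u) ⊗ₜ
            (MonoidAlgebra.single g 1 ⊗ₜ MonoidAlgebra.single g 1)) := by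
      simp [biprodComul]
    -- With the group part fixed at `g`, the right-hand side is a linear function of the braided
    -- comultiplication of the word, which makes induction on the word possible.
    let Ψ : R ⊗[k] R →ₗ[k] H ⊗[k] H := TensorProduct.map f.toLinearMap f.toLinearMap ∘ₗ
      midMap ((LinearMap.mul' k (MonoidAlgebra k G)).rTensor R ∘ₗ
          (TensorProduct.rightComm k (MonoidAlgebra k G) R (MonoidAlgebra k G)).toLinearMap ∘ₗ
          D.coact.rTensor (MonoidAlgebra k G)) ∘ₗ
      (TensorProduct.mk k _ _).flip (MonoidAlgebra.single g 1 ⊗ₜ MonoidAlgebra.single g 1)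
    have h2 : ∀ v w, Ψ (wordProd x v ⊗ₜ wordProd x w) =
        (wordProd a v * DH.grp (E.wordG w * g)) ⊗ₜ (wordProd a w * DH.grp g) := by
      intro v w
      simp [Ψ, hD.coact_word, hf, map_wordProd F hF]
    have h4 : TensorProduct.map f.toLinearMap f.toLinearMap
        (D.biprodComul (wordProd x u ⊗ₜ MonoidAlgebra.single g 1)) = Ψ (D.comul (wordProd x u)) := by
      rw [h1]
      rfl
    clear_value Ψ
    have h3 : ∀ u, Ψ (D.comul (wordProd x u)) =
        Coalgebra.comul (R := k) (wordProd a u) * (DH.grp g ⊗ₜ DH.grp g) := by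
      intro u
      induction u with
      | nil =>
        have := h2 [] []
        simp only [wordProd_nil] at this
        simp [hD.comul_one, this]
      | cons j u ih =>
        rw [wordProd_cons, hD.comul_gen_mul, wordProd_cons, Bialgebra.comul_mul, mul_assoc, ← ih]
        refine hD.comul_word_ext 
          (f := Ψ ∘ₗ ((LinearMap.mulLeft k (x j)).rTensor R +
            TensorProduct.map (D.act (E.g j)) (LinearMap.mulLeft k (x j))))
          (f' := LinearMap.mulLeft k (Coalgebra.comul (R := k) (a j)) ∘ₗ Ψ) u fun v w _ => ?_
        simp only [LinearMap.comp_apply, LinearMap.add_apply, LinearMap.rTensor_tmul,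
          TensorProduct.map_tmul, LinearMap.mulLeft_apply, map_add, hD.act_word, ← wordProd_cons,
          ← TensorProduct.smul_tmul', map_smul, h2, hH.comul_gen, add_mul,
          Algebra.TensorProduct.tmul_mul_tmul, one_mul]
        -- Moving `g j` past the word `v` in `H` costs exactly the scalar by which `g j` acts on `v`
        -- in `R`.
        rw [← mul_assoc (DH.grp (E.g j)), hH.grp_mul_word, smul_mul_assoc, E.wordG_cons,
          mul_assoc (E.g j), map_mul _ (E.g j), ← TensorProduct.smul_tmul', wordProd_cons,
          wordProd_cons, add_comm]
        simp only [mul_assoc]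
    rw [LinearMap.comp_apply, LinearMap.comp_apply, h4, h3]
    rw [LinearEquiv.coe_coe, hf, map_wordProd F hF, Bialgebra.comul_mul, DH.comul_grp]
  counit y := by
    suffices hs : Coalgebra.counit (R := k) ∘ₗ f.toLinearMap = D.biprodCounit from
      LinearMap.congr_fun hs y
    refine hD.ext_biprod fun u g => ?_
    rw [LinearMap.comp_apply, LinearEquiv.coe_coe, hf, map_wordProd F hF, Bialgebra.counit_mul,
      DH.counit_grp]
    cases u with
    | nil => simp [biprodCounit, hD.counit_one]
    | cons j u =>
      rw [wordProd_cons, Bialgebra.counit_mul, hH.counit_gen]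
      simp [biprodCounit, hD.counit_word]
  deg n y := by
    have hle : ∀ n, D.biprodDeg n ≤ (DH.deg n).comap f.toLinearMap := by
      rintro n _ ⟨z, rfl⟩
      have h1 : ∀ r ∈ D.deg n, ∀ g, F r * DH.grp g ∈ DH.deg n := by
        intro r hr g
        rw [hD.deg_eq] at hr
        refine (Submodule.span_le (p := (DH.deg n).comap
          (LinearMap.mulRight k (DH.grp g) ∘ₗ F.toLinearMap))).2 ?_ hr
        rintro _ ⟨u, rfl, rfl⟩
        change F (wordProd x u) * DH.grp g ∈ DH.deg _
        rw [map_wordProd F hF]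
        exact hH.word_deg u g
      suffices hs : (DH.deg n).mkQ ∘ₗ f.toLinearMap ∘ₗ
          (D.deg n).subtype.rTensor (MonoidAlgebra k G) = 0 by
        have := LinearMap.congr_fun hs z
        exact (Submodule.Quotient.mk_eq_zero (DH.deg n)).1 this
      refine tmul_single_ext fun r g => ?_
      simp only [LinearMap.comp_apply, LinearMap.rTensor_tmul, LinearEquiv.coe_coe, hf,
        LinearMap.zero_apply, Submodule.mkQ_apply, Submodule.Quotient.mk_eq_zero]
      exact h1 r r.2 g
    exact ⟨fun h => mem_of_map_mem_of_iSupIndep hD.iSup_biprodDeg hH.indep (f := f.toLinearMap)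
      f.injective hle h, fun h => hle n h⟩

end BraidedData.IsDiagonal

/-! ### The semi-path Hopf algebra -/

namespace ESC.SemiPath

variable {k G J : Type*} [Field k] [Group G] (E : ESC k G J)

theorem vertex_mul_arrow (h : G) (j : J) :
    vertex E h * arrow E j = (E.inv.χ j h : k) • (arrow E j * vertex E h) := by
  rw [arrow, vertex_mul_arr, arr_mul_vertex, smul_smul, mul_one, one_mul]
  simp [ESC.inv]

theorem arr_eq (j : J) (x : G) : arr E j x = vertex E x * arrow E j := by
  rw [arrow, vertex_mul_arr, mul_one]

theorem vertex_mul_word (h : G) (u : List J) : vertex E h * wordProd (arrow E) u =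
    (E.inv.wordχ u h : k) • (wordProd (arrow E) u * vertex E h) := by
  induction u with
  | nil => simp
  | cons j u ih =>
    rw [wordProd_cons, ← mul_assoc, vertex_mul_arrow, smul_mul_assoc, mul_assoc, ih, mul_smul_comm,
      smul_smul, wordχ_cons, Units.val_mul, mul_assoc]

theorem word_mul_vertex (h : G) (u : List J) : wordProd (arrow E) u * vertex E h =
    ((E.inv.wordχ u h)⁻¹ : kˣ) • (vertex E h * wordProd (arrow E) u) := by
  rw [vertex_mul_word, Units.smul_def, smul_smul, Units.inv_mul, one_smul]

/-- The span is stable under right multiplication by vertices, which slide past words up to a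
scalar, and by arrows. As it contains `1`, it is everything. -/
theorem mem_span_vertex_mul_word (b : E.SemiPath) : b ∈ Submodule.span k
    (Set.range fun p : G × List J => vertex E p.1 * wordProd (arrow E) p.2) := by
  let V := Submodule.span k
    (Set.range fun p : G × List J => vertex E p.1 * wordProd (arrow E) p.2)
  have hV : ∀ x u, vertex E x * wordProd (arrow E) u ∈ V :=
    fun x u => Submodule.subset_span ⟨(x, u), rfl⟩
  have h1 : ∀ (c : E.SemiPath), (∀ x u, vertex E x * wordProd (arrow E) u * c ∈ V) →
      ∀ a ∈ V, a * c ∈ V := by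
    intro c hc a ha
    induction ha using Submodule.span_induction with
    | mem a h => obtain ⟨⟨x, u⟩, rfl⟩ := h; exact hc x u
    | zero => simp
    | add a b _ _ h1 h2 => rw [add_mul]; exact add_mem h1 h2
    | smul r a _ h => rw [smul_mul_assoc]; exact Submodule.smul_mem _ _ h
  have h2 : ∀ y, ∀ a ∈ V, a * vertex E y ∈ V := fun y => h1 _ fun x u => by
    rw [mul_assoc, word_mul_vertex, mul_smul_comm, ← mul_assoc, ← map_mul]
    exact Submodule.smul_mem _ (_ : k) (hV _ _)
  have h3 : ∀ j, ∀ a ∈ V, a * arrow E j ∈ V := fun j => h1 _ fun x u => by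
    have : wordProd (arrow E) [j] = arrow E j := by simp [wordProd]
    rw [mul_assoc, ← this, ← wordProd_append]
    exact hV _ _
  have h4 := mem_of_generators E
    { carrier := {c | ∀ a ∈ V, a * c ∈ V}
      mul_mem' := fun {c d} hc hd a ha => by rw [← mul_assoc]; exact hd _ (hc _ ha)
      add_mem' := fun {c d} hc hd a ha => by rw [mul_add]; exact add_mem (hc _ ha) (hd _ ha)
      algebraMap_mem' := fun r a ha => by
        rw [← Algebra.commutes, ← Algebra.smul_def]; exact Submodule.smul_mem _ _ ha }
    h2 (fun j x a ha => by rw [arr_eq, ← mul_assoc]; exact h3 _ _ (h2 _ _ ha)) b 1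
    (by simpa using hV 1 [])
  rwa [one_mul] at h4

/-- The semi-path Hopf algebra acts on the vector space with basis `G × List J`, as it does on
itself by left multiplication in terms of the basis `x * E u`. -/
def regular : E.SemiPath →ₐ[k] Module.End k ((G × List J) →₀ k) :=
  lift E
    { toFun h := Finsupp.lmapDomain k k fun p : G × List J => (h * p.1, p.2)
      map_one' := Finsupp.lhom_ext fun p b => by simp
      map_mul' h h' := Finsupp.lhom_ext fun p b => by simp [mul_assoc] }
    (fun i x => Finsupp.linearCombination k fun p : G × List J =>
      (E.χ i p.1 : k) • Finsupp.single (x * p.1, i :: p.2) 1)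
    (fun h i x => Finsupp.basisSingleOne.ext fun p => by
      rw [Finsupp.coe_basisSingleOne, Module.End.mul_apply, Finsupp.linearCombination_single,
        Finsupp.linearCombination_single]
      simp [mul_assoc])
    (fun i x h => Finsupp.basisSingleOne.ext fun p => by
      rw [Finsupp.coe_basisSingleOne, Module.End.mul_apply, LinearMap.smul_apply,
        Finsupp.linearCombination_single]
      simp [mul_assoc])

theorem regular_word (u : List J) :
    regular E (wordProd (arrow E) u) (Finsupp.single (1, []) 1) = Finsupp.single (1, u) 1 := by
  induction u with
  | nil => simp
  | cons j u ih =>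
    rw [wordProd_cons, map_mul, Module.End.mul_apply, ih, arrow, regular, lift_arr]
    simp

theorem regular_vertex_mul_word (x : G) (u : List J) :
    regular E (vertex E x * wordProd (arrow E) u) (Finsupp.single (1, []) 1) =
      Finsupp.single (x, u) 1 := by
  rw [map_mul, Module.End.mul_apply, regular_word, regular, lift_vertex]
  simp

/-- In the regular representation these elements send the base vector `(1, [])` to distinct basis
vectors. -/
theorem linearIndependent_vertex_mul_word : LinearIndependent k
    fun p : G × List J => vertex E p.1 * wordProd (arrow E) p.2 := by
  refine LinearIndependent.of_comp
    ((LinearMap.applyₗ (Finsupp.single (1, []) 1)) ∘ₗ (regular E).toLinearMap) ?_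
  have : (⇑((LinearMap.applyₗ (Finsupp.single (1, []) (1 : k))) ∘ₗ (regular E).toLinearMap) ∘
      fun p : G × List J => vertex E p.1 * wordProd (arrow E) p.2) =
      (Finsupp.basisSingleOne : Module.Basis (G × List J) k _) := by
    funext p
    rw [Finsupp.coe_basisSingleOne]
    exact regular_vertex_mul_word E p.1 p.2
  rw [this]
  exact Module.Basis.linearIndependent _

/-- The basis of the semi-path Hopf algebra. -/
def basis : Module.Basis (G × List J) k E.SemiPath :=
  Module.Basis.mk (linearIndependent_vertex_mul_word E)
    fun b _ => mem_span_vertex_mul_word E b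

theorem basis_apply (x : G) (u : List J) :
    basis E (x, u) = vertex E x * wordProd (arrow E) u := by
  simp [basis]

/-- The right-hand sides multiply like a grading and contain vertices in degree `0` and arrows in
degree `1`. They are independent as spans of disjoint parts of a basis, so the inclusion is enough
to make the given components independent. -/
theorem deg_le (n : ℕ) : (graded E).deg n ≤
    Submodule.span k (basis E '' {p | p.2.length = n}) := by
  let S : ℕ → Submodule k E.SemiPath := fun n => Submodule.span k (basis E '' {p | p.2.length = n})
  have hmul : ∀ m n, S m * S n ≤ S (m + n) := by
    intro m n
    rw [Submodule.span_mul_span, Submodule.span_le]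
    rintro _ ⟨_, ⟨⟨x, u⟩, rfl, rfl⟩, _, ⟨⟨y, v⟩, rfl, rfl⟩, rfl⟩
    simp only [basis_apply]
    rw [mul_assoc, ← mul_assoc (wordProd _ u), word_mul_vertex, smul_mul_assoc, mul_assoc,
      ← wordProd_append, mul_smul_comm, ← mul_assoc, ← map_mul, ← basis_apply]
    exact Submodule.smul_mem _ (_ : k) (Submodule.subset_span ⟨(x * y, u ++ v), by simp, rfl⟩)
  have h0 : LinearMap.range (ofAlg E).toLinearMap ≤ S 0 := by
    rintro _ ⟨b, rfl⟩
    induction b using MonoidAlgebra.induction_linear with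
    | zero => simp
    | add a b h1 h2 => rw [map_add]; exact add_mem h1 h2
    | single x c =>
      have : MonoidAlgebra.single x c = c • MonoidAlgebra.single x (1 : k) := by simp
      rw [this, map_smul]
      refine Submodule.smul_mem _ _ (Submodule.subset_span ⟨(x, []), rfl, ?_⟩)
      rw [basis_apply, wordProd_nil, mul_one]
      rfl
  have h1 : LinearMap.range (ofMod E) ≤ S 1 := by
    rintro _ ⟨m, rfl⟩
    induction m using Finsupp.induction_linear with
    | zero => simp
    | add a b h1 h2 => rw [map_add]; exact add_mem h1 h2
    | single p c =>
      have : Finsupp.single p c = c • Finsupp.single p (1 : k) := by simp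
      rw [this, map_smul]
      refine Submodule.smul_mem _ _ (Submodule.subset_span ⟨(p.2, [p.1]), rfl, ?_⟩)
      rw [basis_apply]
      exact (by simp [wordProd] : _ = vertex E p.2 * arrow E p.1).trans (arr_eq E p.1 p.2).symm
  have h2 : ∀ n, LinearMap.range (ofMod E) ^ n ≤ S n := by
    intro n
    induction n with
    | zero =>
      rw [pow_zero, Submodule.one_le]
      exact Submodule.subset_span ⟨(1, []), rfl, by simp [basis_apply]⟩
    | succ n ih => rw [pow_succ]; exact (mul_le_mul' ih h1).trans (hmul n 1)
  exact (mul_le_mul' h0 (h2 n)).trans ((hmul 0 n).trans_eq (by rw [zero_add]))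

theorem iSupIndep_span_basis {k ι V : Type*} [Field k] [AddCommGroup V] [Module k V]
    (b : Module.Basis ι k V) (d : ι → ℕ) :
    iSupIndep fun n => Submodule.span k (b '' {i | d i = n}) := by
  intro n
  have h : ⨆ (m) (_ : m ≠ n), Submodule.span k (b '' {i | d i = m}) ≤
      Submodule.span k (b '' {i | d i ≠ n}) :=
    iSup₂_le fun m hm => Submodule.span_mono (Set.image_mono fun i hi => by
      simp only [Set.mem_ofPred_eq] at hi ⊢
      rwa [hi])
  refine Disjoint.mono_right h ?_
  exact b.linearIndependent.disjoint_span_image (Set.disjoint_left.2 fun i h1 h2 => h2 h1)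

theorem graded_isGenerated : (graded E).IsGenerated E.inv (arrow E) where
  comul_gen j := by
    rw [comul_def, arrow, comulHom_arr, mul_one, map_one]
    rfl
  grp_mul_gen := vertex_mul_arrow E
  span_word b := by
    refine Submodule.span_le.2 ?_ (mem_span_vertex_mul_word E b)
    rintro _ ⟨⟨x, u⟩, rfl⟩
    simp only [vertex_mul_word]
    exact Submodule.smul_mem _ _ (Submodule.subset_span ⟨(u, x), rfl⟩)
  word_deg u h := by
    change wordProd (arrow E) u * vertex E h ∈ _
    rw [word_mul_vertex]
    refine Submodule.smul_mem _ (_ : k) (Submodule.mul_mem_mul ⟨_, rfl⟩ ?_)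
    induction u with
    | nil => rw [List.length_nil, pow_zero]; exact Submodule.one_le.1 le_rfl
    | cons j u ih =>
      rw [List.length_cons, pow_succ', wordProd_cons]
      exact Submodule.mul_mem_mul ⟨_, rfl⟩ ih
  indep := (iSupIndep_span_basis (basis E) fun p => p.2.length).mono (deg_le E)

/-- The homomorphism from the free algebra that sends the generators to the arrows. -/
def ofFree : FreeAlgebra k J →ₐ[k] E.SemiPath := FreeAlgebra.lift k (arrow E)

theorem ofFree_ι (j : J) : ofFree E (FreeAlgebra.ι k j) = arrow E j :=
  FreeAlgebra.lift_ι_apply _ _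

/-- Moving the vertex to the other side only rescales the basis vectors by units. -/
theorem linearIndependent_word_mul_vertex : LinearIndependent k
    fun p : List J × G => wordProd (arrow E) p.1 * vertex E p.2 := by
  have h := ((basis E).linearIndependent.units_smul
    fun p => (E.inv.wordχ p.2 p.1)⁻¹).comp Prod.swap Prod.swap_injective
  convert h using 1
  funext ⟨u, x⟩
  have h1 := basis_apply E x u
  simpa [word_mul_vertex] using h1.symm

/-- The isomorphism from the biproduct of the quantum tensor algebra with `kG`. -/
theorem exists_biprod_equiv : ∃ f : (FreeAlgebra k J ⊗[k] MonoidAlgebra k G) ≃ₗ[k] E.SemiPath,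
    ∀ r g, f (r ⊗ₜ MonoidAlgebra.single g 1) = ofFree E r * vertex E g := by
  let f : (FreeAlgebra k J ⊗[k] MonoidAlgebra k G) →ₗ[k] E.SemiPath :=
    LinearMap.mul' k _ ∘ₗ TensorProduct.map (ofFree E).toLinearMap (ofAlg E).toLinearMap
  have hf : ∀ r g, f (r ⊗ₜ MonoidAlgebra.single g 1) = ofFree E r * vertex E g := fun r g => rfl
  let v : List J × G → FreeAlgebra k J ⊗[k] MonoidAlgebra k G := fun p =>
    wordProd (FreeAlgebra.ι k) p.1 ⊗ₜ MonoidAlgebra.single p.2 1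
  have hfv : f ∘ v = fun p : List J × G => wordProd (arrow E) p.1 * vertex E p.2 := by
    funext p
    rw [Function.comp_apply, hf, map_wordProd _ (ofFree_ι E)]
  have hv : ∀ z, z ∈ Submodule.span k (Set.range v) := by
    intro z
    rw [← Submodule.Quotient.mk_eq_zero]
    suffices h : (Submodule.span k (Set.range v)).mkQ = 0 from LinearMap.congr_fun h z
    refine E.inv.tensorData_isDiagonal.ext_biprod fun u g => ?_
    rw [LinearMap.zero_apply, Submodule.mkQ_apply, Submodule.Quotient.mk_eq_zero]
    exact Submodule.subset_span ⟨(u, g), rfl⟩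
  -- The map carries the spanning family `v` to an independent and spanning family, so it is
  -- bijective.
  have inj : Function.Injective f := injective_of_linearIndependent hv
    (by rw [hfv]; exact linearIndependent_word_mul_vertex E)
  have surj : Function.Surjective f := by
    rw [← LinearMap.range_eq_top, eq_top_iff]
    intro b _
    refine Submodule.span_le.2 ?_ ((graded_isGenerated E).span_word b)
    rintro _ ⟨p, rfl⟩
    exact ⟨v p, congrFun hfv p⟩
  exact ⟨LinearEquiv.ofBijective f ⟨inj, surj⟩, hf⟩

/-- This is the biproduct isomorphism restricted to the tensors `r ⊗ 1`. -/
theorem ofFree_injective : Function.Injective (ofFree E) := by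
  obtain ⟨f, hf⟩ := exists_biprod_equiv E
  have h1 : (fun r : FreeAlgebra k J => r ⊗ₜ[k] (1 : MonoidAlgebra k G)).Injective :=
    Algebra.TensorProduct.includeLeft_injective (S := k)
      (FaithfulSMul.algebraMap_injective k (MonoidAlgebra k G))
  intro a b hab
  refine h1 (f.injective ?_)
  simp only [MonoidAlgebra.one_def, hf, hab]

/-- Injectivity comes from the embedding into `kQ^s`, surjectivity from the words spanning the
diagram; compatibility with the structure maps is automatic in the diagonal case. -/
theorem exists_diag_equiv : ∃ f : FreeAlgebra k J ≃ₐ[k] (graded E).diag,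
    E.inv.tensorData.IsIso (graded E).diagData f ∧
    ∀ j, (f (FreeAlgebra.ι k j) : E.SemiPath) = arrow E j := by
  let hE := graded_isGenerated E
  let F : FreeAlgebra k J →ₐ[k] (graded E).diag := FreeAlgebra.lift k hE.gen
  have hF : ∀ j, F (FreeAlgebra.ι k j) = hE.gen j := FreeAlgebra.lift_ι_apply _
  have hval : (graded E).diag.val.comp F = ofFree E := FreeAlgebra.hom_ext <| by
    funext j
    simp [hF, ofFree_ι, GradedOver.IsGenerated.gen]
  have inj : Function.Injective F := by
    refine Function.Injective.of_comp (f := (graded E).diag.val) ?_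
    rw [← AlgHom.coe_comp, hval]
    exact ofFree_injective E
  have ind := E.inv.tensorData_isDiagonal.isInduced hE.diagData_isDiagonal F hF
  let f := AlgEquiv.ofBijective F ⟨inj, ind.surjective⟩
  exact ⟨f, E.inv.tensorData_isDiagonal.isIso hE.diagData_isDiagonal f hF,
    fun j => congrArg Subtype.val (hF j)⟩

end ESC.SemiPath

/-! ### The multiple Taft algebra -/

namespace ESC

variable {k G J : Type*} [Field k] [Group G] (E : ESC k G J)

namespace CoPath

/-- The arrow `E i : 1 ⟶ g i`. -/
def arrow (i : J) : E.CoPath := path E [i] 1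

open Classical in
/-- Removal of the last arrow of a path, if it is labelled `i`. -/
def tail (i : J) : E.CoPath →ₗ[k] E.CoPath := lift E fun u x =>
  match u with
  | [] => 0
  | j :: u => if j = i then path E u x else 0

theorem tail_vertex (i : J) (x : G) : tail E i (path E [] x) = 0 := by simp [tail]

theorem tail_cons_self (i : J) (a : E.CoPath) : tail E i (cons E i a) = a := by
  suffices h : tail E i ∘ₗ cons E i = LinearMap.id from LinearMap.congr_fun h a
  exact ext fun u x => by simp [tail]

theorem tail_cons_of_ne {i j : J} (h : j ≠ i) (a : E.CoPath) : tail E i (cons E j a) = 0 := by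
  suffices h : tail E i ∘ₗ cons E j = 0 from LinearMap.congr_fun h a
  exact ext fun u x => by simp [tail, h]

theorem arrow_eq_cons (i : J) : arrow E i = cons E i (path E [] 1) := (cons_path E i [] 1).symm

theorem arrow_mul_vertex (i : J) (y : G) :
    arrow E i * path E [] y = (E.χ i y : k) • cons E i (path E [] y) := by
  rw [arrow_eq_cons, cons_mul_vertex, ← one_def, one_mul]

theorem arrow_mul_cons (i j : J) (a : E.CoPath) :
    arrow E i * cons E j a = cons E i (twist E i (cons E j a)) + cons E j (arrow E i * a) := by
  rw [arrow_eq_cons, cons_mul_cons, ← one_def, one_mul]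

theorem path_induction {P : E.CoPath → Prop} (a : E.CoPath) (h0 : P 0)
    (ha : ∀ a b, P a → P b → P (a + b)) (hs : ∀ (r : k) a, P a → P (r • a))
    (hv : ∀ x, P (path E [] x)) (hc : ∀ j u x, P (cons E j (path E u x))) : P a := by
  induction a using ind with
  | h0 => exact h0
  | ha a b h1 h2 => exact ha a b h1 h2
  | hs r a h => exact hs r a h
  | hp u x =>
    cases u with
    | nil => exact hv x
    | cons j u => rw [← cons_path]; exact hc j u x

/-- In a shuffle of `E i` with a path, the last arrow is either `E i` itself, twisted by the end
vertex of the path, or the last arrow of the path. Stripping a last arrow labelled `i` gives the two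
summands. -/
theorem tail_arrow_mul_self (i : J) (b : E.CoPath) :
    tail E i (arrow E i * b) = twist E i b + arrow E i * tail E i b := by
  induction b using path_induction with
  | h0 => simp
  | ha a b h1 h2 => simp only [mul_add, map_add, h1, h2]; abel
  | hs r a h => simp only [mul_smul_comm, map_smul, h, smul_add]
  | hv x => rw [arrow_mul_vertex, map_smul, tail_cons_self, tail_vertex, twist_path]; simp [target]
  | hc j u x =>
    rw [arrow_mul_cons, map_add, tail_cons_self]
    by_cases h : j = i
    · subst h
      rw [tail_cons_self, tail_cons_self]
    · rw [tail_cons_of_ne E h, tail_cons_of_ne E h, mul_zero]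

theorem tail_arrow_mul_of_ne {i l : J} (hl : i ≠ l) (b : E.CoPath) :
    tail E l (arrow E i * b) = arrow E i * tail E l b := by
  induction b using path_induction with
  | h0 => simp
  | ha a b h1 h2 => simp only [mul_add, map_add, h1, h2]
  | hs r a h => simp only [mul_smul_comm, map_smul, h]
  | hv x => rw [arrow_mul_vertex, map_smul, tail_cons_of_ne E hl, tail_vertex]; simp
  | hc j u x =>
    rw [arrow_mul_cons, map_add, tail_cons_of_ne E hl, zero_add]
    by_cases h : j = l
    · subst h
      rw [tail_cons_self, tail_cons_self]
    · rw [tail_cons_of_ne E h, tail_cons_of_ne E h, mul_zero]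

open Classical in
theorem coord_path (p : List J × G) (u : List J) (x : G) :
    (basis E).coord p (path E u x) = if (u, x) = p then 1 else 0 := by
  rw [path, Module.Basis.coord_apply, Module.Basis.repr_self, Finsupp.single_apply]

/-- The tails record every coordinate at a path of positive length. -/
theorem repr_cons_tail (i : J) (u : List J) (x : G) (a : E.CoPath) :
    (basis E).repr (tail E i a) (u, x) = (basis E).repr a (i :: u, x) := by
  classical
  suffices h : (basis E).coord (u, x) ∘ₗ tail E i = (basis E).coord (i :: u, x) from
    LinearMap.congr_fun h a
  refine ext fun v y => ?_
  rw [LinearMap.comp_apply, coord_path]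
  cases v with
  | nil => simp [tail_vertex]
  | cons j v =>
    rw [← cons_path]
    by_cases h : j = i
    · subst h
      rw [tail_cons_self, coord_path]
      refine if_congr ?_ rfl rfl
      simp
    · rw [tail_cons_of_ne E h]
      simp [h]

theorem repr_vertex_projLin (x : G) (a : E.CoPath) :
    (basis E).repr a ([], x) = (projLin E a).coeff x := by
  suffices h : (basis E).coord ([], x) =
      (Finsupp.lapply x) ∘ₗ (MonoidAlgebra.coeffLinearEquiv k).toLinearMap ∘ₗ projLin E from
    LinearMap.congr_fun h a
  refine ext fun v y => ?_
  rw [coord_path, LinearMap.comp_apply, LinearMap.comp_apply]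
  cases v with
  | nil =>
    classical
    rw [projLin_vertex]
    refine Eq.trans ?_ (Finsupp.single_apply (a := y) (a' := x) (b := (1 : k))).symm
    refine if_congr ?_ rfl rfl
    simp
  | cons j v => rw [← cons_path, projLin_cons]; simp

/-- The coordinates at vertices are read off the degree zero part and all other coordinates off the
tails. Relations among products of arrows are verified by this test. -/
theorem eq_zero_of_tail {a : E.CoPath} (h0 : projLin E a = 0) (h : ∀ i, tail E i a = 0) :
    a = 0 := by
  refine (basis E).ext_elem fun ⟨u, x⟩ => ?_
  cases u with
  | nil => rw [repr_vertex_projLin, h0]; simp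
  | cons i u => rw [← repr_cons_tail, h]; simp

theorem projLin_arrow_mul (i : J) (a : E.CoPath) : projLin E (arrow E i * a) = 0 := by
  rw [projLin_mul, arrow_eq_cons, projLin_cons, zero_mul]

theorem twist_arrow (i j : J) : twist E i (arrow E j) = (E.χ i (E.g j) : k) • arrow E j := by
  rw [arrow, twist_path]
  simp [target]

theorem tail_arrow_self (i : J) : tail E i (arrow E i) = 1 := by
  rw [arrow_eq_cons, tail_cons_self]; rfl

theorem tail_arrow_of_ne {i j : J} (h : j ≠ i) : tail E i (arrow E j) = 0 := by
  rw [arrow_eq_cons, tail_cons_of_ne E h]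

theorem twist_pow (i : J) (a : E.CoPath) (n : ℕ) : twist E i (a ^ n) = twist E i a ^ n := by
  induction n with
  | zero => simp [one_def, twist_path, target]
  | succ n ih => rw [pow_succ, twist_mul, ih, pow_succ]

/-- The skew Leibniz rule contributes a power `q^s` each time the twist passes `s` copies of `E i`,
so the coefficients add up to a `q`-integer. -/
theorem tail_arrow_pow_mul (i : J) {c : E.CoPath} (hc : tail E i c = 0) (m : ℕ) :
    tail E i (arrow E i ^ (m + 1) * c) =
      (∑ s ∈ Finset.range (m + 1), (E.q i : k) ^ s) • (arrow E i ^ m * twist E i c) := by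
  induction m with
  | zero => simp [tail_arrow_mul_self, hc]
  | succ m ih =>
    rw [pow_succ', mul_assoc, tail_arrow_mul_self, ih, mul_smul_comm, ← mul_assoc, ← pow_succ',
      twist_mul, twist_pow, twist_arrow, smul_pow, smul_mul_assoc, ← add_smul,
      Finset.sum_range_succ _ (m + 1), add_comm]
    rfl

theorem tail_arrow_pow_mul_of_ne {i l : J} (hl : i ≠ l) (m : ℕ) (c : E.CoPath) :
    tail E l (arrow E i ^ m * c) = arrow E i ^ m * tail E l c := by
  induction m with
  | zero => simp
  | succ m ih => rw [pow_succ', mul_assoc, tail_arrow_mul_of_ne E hl, ih, mul_assoc]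

/-- Its tail at `i` has the `q`-integer of `N i` as coefficient, its other tails vanish, and it has
no part in degree zero. -/
theorem arrow_pow_N (i : J) (h : E.N i ≠ ⊤) : arrow E i ^ (E.N i).toNat = 0 := by
  obtain ⟨m, hm⟩ : ∃ m, (E.N i).toNat = m + 1 ∧
      ∑ s ∈ Finset.range (m + 1), (E.q i : k) ^ s = 0 := by
    rw [N] at h ⊢
    split_ifs at h ⊢ with h1
    · exact absurd rfl h
    · push Not at h1
      obtain ⟨m, hm⟩ := Nat.exists_eq_succ_of_ne_zero h1.1
      refine ⟨m, by simpa using hm, ?_⟩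
      -- Finiteness of `N i` excludes `q i = 1`, so the geometric sum times `q - 1` equal to `q^N -
      -- 1 = 0` forces the sum to vanish.
      have h2 : (E.q i : k) - 1 ≠ 0 := by
        rw [sub_ne_zero]
        simpa using h1.2
      refine (mul_eq_zero.1 ?_).resolve_right h2
      rw [geom_sum_mul, ← Nat.succ_eq_add_one, ← hm, ← Units.val_pow_eq_pow_val, pow_orderOf_eq_one,
        Units.val_one, sub_self]
  rw [hm.1]
  refine eq_zero_of_tail E (by rw [pow_succ', projLin_arrow_mul]) fun l => ?_
  have h1 : tail E l (1 : E.CoPath) = 0 := tail_vertex E l 1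
  rw [← mul_one (arrow E i ^ (m + 1))]
  by_cases hl : i = l
  · subst hl
    rw [tail_arrow_pow_mul E i h1, hm.2, zero_smul]
  · rw [tail_arrow_pow_mul_of_ne E hl, h1, mul_zero]

/-- Only the tails at `i` and `j` matter. The tail at `i` forces the scalar to be `χ_i(g_j)`, the
one at `j` forces it to be `χ_j(g_i)⁻¹`, and quantum weak commutativity says that these agree. -/
theorem arrow_mul_arrow (h : E.IsQuantumWeaklyCommutative) {i j : J} (hij : i ≠ j) :
    arrow E i * arrow E j = (E.inv.χ j (E.g i) : k) • (arrow E j * arrow E i) := by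
  have hij' : (E.χ i (E.g j) : k) * (E.χ j (E.g i) : k) = 1 := by
    rw [← Units.val_mul, h i j hij, Units.val_one]
  have hinv : (E.inv.χ j (E.g i) : k) = E.χ i (E.g j) := by
    rw [inv, MonoidHom.inv_apply, eq_inv_of_mul_eq_one_left (h i j hij)]
  rw [hinv, ← sub_eq_zero]
  refine eq_zero_of_tail E (by simp [projLin_arrow_mul]) fun l => ?_
  rw [map_sub, map_smul, sub_eq_zero]
  by_cases hi : i = l
  · subst hi
    rw [tail_arrow_mul_self, tail_arrow_mul_of_ne E hij.symm, tail_arrow_of_ne E hij.symm,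
      tail_arrow_self, twist_arrow, mul_zero, add_zero, mul_one]
  · by_cases hj : j = l
    · subst hj
      rw [tail_arrow_mul_self, tail_arrow_mul_of_ne E hij, tail_arrow_of_ne E hij,
        tail_arrow_self, twist_arrow, mul_zero, add_zero, mul_one, smul_smul, hij', one_smul]
    · rw [tail_arrow_mul_of_ne E hi, tail_arrow_mul_of_ne E hj, tail_arrow_of_ne E hi,
        tail_arrow_of_ne E hj, mul_zero, mul_zero, smul_zero]

/-! ### Nonvanishing of `q`-integers and of monomials -/

/-- If `q = 1` the sum is the integer `m + 1`, nonzero in characteristic zero. Otherwise its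
vanishing would give `q^(m+1) = 1`, so the order of `q` would be at most `m + 1`. -/
theorem geom_sum_q_ne_zero (hE : CharZero k ∨ ∀ i, E.q i ≠ 1) (i : J) (m : ℕ)
    (hm : ((m + 1 : ℕ) : ℕ∞) < E.N i) : ∑ s ∈ Finset.range (m + 1), (E.q i : k) ^ s ≠ 0 := by
  by_cases hq : E.q i = 1
  · have : CharZero k := hE.resolve_right fun h => h i hq
    simp only [hq, Units.val_one, one_pow, Finset.sum_const, Finset.card_range, nsmul_eq_mul,
      mul_one]
    exact_mod_cast Nat.succ_ne_zero m
  · intro h0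
    have h1 := geom_sum_mul (E.q i : k) (m + 1)
    rw [h0, zero_mul, eq_comm, sub_eq_zero] at h1
    have h2 : E.q i ^ (m + 1) = 1 := Units.ext (by simpa using h1)
    have h3 := orderOf_dvd_of_pow_eq_one h2
    have h4 := Nat.le_of_dvd (Nat.succ_pos m) h3
    rw [N, if_neg] at hm
    · exact absurd (Nat.cast_lt.1 hm) (not_lt.2 h4)
    · rintro (h | h)
      · rw [h] at h3; simp at h3
      · exact hq h

/-- The product of the powers `E j ^ m j`, where `j` runs through the list `L`. -/
def listMonomial (L : List J) (m : J → ℕ) : E.CoPath := (L.map fun j => arrow E j ^ m j).prod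

theorem listMonomial_cons (j : J) (L : List J) (m : J → ℕ) :
    listMonomial E (j :: L) m = arrow E j ^ m j * listMonomial E L m := by simp [listMonomial]

theorem tail_listMonomial {i : J} {L : List J} (hi : i ∉ L) (m : J → ℕ) :
    tail E i (listMonomial E L m) = 0 := by
  induction L with
  | nil => exact tail_vertex E i 1
  | cons j L ih =>
    rw [List.mem_cons, not_or] at hi
    rw [listMonomial_cons, tail_arrow_pow_mul_of_ne E (Ne.symm hi.1), ih hi.2, mul_zero]

/-- The twist is multiplicative and scales each arrow; only the invertibility of the resulting
scalar matters later. -/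
theorem twist_listMonomial (i : J) (L : List J) (m : J → ℕ) :
    ∃ c : kˣ, twist E i (listMonomial E L m) = c • listMonomial E L m := by
  induction L with
  | nil => exact ⟨1, by simp [listMonomial, one_def, twist_path, target]⟩
  | cons j L ih =>
    obtain ⟨c, hc⟩ := ih
    refine ⟨E.χ i (E.g j) ^ m j * c, ?_⟩
    rw [listMonomial_cons, twist_mul, twist_pow, twist_arrow, hc, smul_pow, smul_mul_assoc,
      mul_smul_comm, mul_smul]
    simp [Units.smul_def]

/-- Apply `tail` at the first label: the remaining monomial does not contain it, so the exponent
drops by one with a nonzero coefficient. After the exponent reaches zero, continue with the shorter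
list. -/
theorem listMonomial_ne_zero (hE : CharZero k ∨ ∀ i, E.q i ≠ 1) {L : List J} (hL : L.Nodup)
    {m : J → ℕ} (hm : ∀ j, (m j : ℕ∞) < E.N j) : listMonomial E L m ≠ 0 := by
  induction L with
  | nil => exact (basis E).ne_zero ([], 1)
  | cons i L ih =>
    rw [List.nodup_cons] at hL
    have h1 : ∀ n, ((n : ℕ) : ℕ∞) < E.N i → arrow E i ^ n * listMonomial E L m ≠ 0 := by
      intro n
      induction n with
      | zero => intro _; rw [pow_zero, one_mul]; exact ih hL.2
      | succ n ihn =>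
        intro hn h0
        obtain ⟨c, hc⟩ := twist_listMonomial E i L m
        have h2 := tail_arrow_pow_mul E i (tail_listMonomial E hL.1 m) n
        rw [h0, map_zero, hc, mul_smul_comm] at h2
        have h3 := (smul_eq_zero.1 h2.symm).resolve_left (geom_sum_q_ne_zero E hE i n hn)
        rw [smul_eq_zero_iff_eq] at h3
        exact ihn (lt_trans (by exact_mod_cast Nat.lt_succ_self n) hn) h3
    rw [listMonomial_cons]
    exact h1 _ (hm i)

/-! ### Words in the arrows -/

/-- Shuffling in an arrow inserts its label somewhere in the path and leaves the start vertex alone.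
-/
theorem arrow_mul_path_mem (i : J) (v : List J) (y : G) : arrow E i * path E v y ∈
    Submodule.span k {a | ∃ w : List J, w.Perm (i :: v) ∧ path E w y = a} := by
  induction v with
  | nil =>
    rw [arrow_mul_vertex, cons_path]
    exact Submodule.smul_mem _ _ (Submodule.subset_span ⟨[i], .refl _, rfl⟩)
  | cons j v ih =>
    rw [← cons_path, arrow_mul_cons, cons_path, twist_path, map_smul, cons_path]
    refine add_mem (Submodule.smul_mem _ _ (Submodule.subset_span ⟨_, .refl _, rfl⟩)) ?_
    refine (Submodule.span_le (p := (Submodule.span k _).comap (cons E j))).2 ?_ ih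
    rintro _ ⟨w, hw, rfl⟩
    rw [SetLike.mem_coe, Submodule.mem_comap, cons_path]
    exact Submodule.subset_span ⟨j :: w, (hw.cons j).trans (.swap _ _ _), rfl⟩

theorem word_mem (u : List J) : wordProd (arrow E) u ∈
    Submodule.span k {a | ∃ w : List J, w.Perm u ∧ path E w 1 = a} := by
  induction u with
  | nil => exact Submodule.subset_span ⟨[], .refl _, rfl⟩
  | cons i u ih =>
    rw [wordProd_cons]
    refine (Submodule.span_le (p := (Submodule.span k _).comap
      (LinearMap.mulLeft k (arrow E i)))).2 ?_ ih
    rintro _ ⟨w, hw, rfl⟩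
    rw [SetLike.mem_coe, Submodule.mem_comap, LinearMap.mulLeft_apply]
    refine Submodule.span_mono ?_ (arrow_mul_path_mem E i w 1)
    rintro _ ⟨w', hw', rfl⟩
    exact ⟨w', hw'.trans (hw.cons i), rfl⟩

theorem vertex_mul_word_mem (x : G) (u : List J) : path E [] x * wordProd (arrow E) u ∈
    Submodule.span k {a | ∃ w : List J, w.Perm u ∧ path E w x = a} := by
  refine (Submodule.span_le (p := (Submodule.span k _).comap
    (LinearMap.mulLeft k (path E [] x)))).2 ?_ (word_mem E u)
  rintro _ ⟨w, hw, rfl⟩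
  rw [SetLike.mem_coe, Submodule.mem_comap, LinearMap.mulLeft_apply, vertex_mul_path, mul_one]
  exact Submodule.subset_span ⟨w, hw, rfl⟩

/-- The paths that occur in such a product remember the vertex and the multiset of letters. This
multigrading separates the monomials. -/
theorem repr_vertex_mul_word {x y : G} {u v : List J}
    (h : (basis E).repr (path E [] x * wordProd (arrow E) u) (v, y) ≠ 0) :
    v.Perm u ∧ y = x := by
  by_contra hn
  refine h ((Submodule.span_le (p := LinearMap.ker ((basis E).coord (v, y)))).2 ?_
    (vertex_mul_word_mem E x u))
  rintro _ ⟨w, hw, rfl⟩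
  rw [SetLike.mem_coe, LinearMap.mem_ker, coord_path, if_neg]
  rw [Prod.mk.injEq]
  rintro ⟨rfl, rfl⟩
  exact hn ⟨hw, rfl⟩

theorem deg_eq (n : ℕ) : deg E n = Submodule.span k (basis E '' {p | p.1.length = n}) := by
  rw [deg]
  congr 1
  ext a
  constructor
  · rintro ⟨u, x, hu, rfl⟩
    exact ⟨(u, x), hu, rfl⟩
  · rintro ⟨⟨u, x⟩, hu, rfl⟩
    exact ⟨u, x, hu, rfl⟩

theorem iSupIndep_deg : iSupIndep (deg E) := by
  have := SemiPath.iSupIndep_span_basis (basis E) fun p => p.1.length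
  convert this using 2
  exact deg_eq E _

end CoPath

/-! ### The multiple Taft algebra as an algebra generated by vertices and arrows -/

namespace Taft

open CoPath

theorem val_word (u : List J) :
    ((wordProd (arrow E) u : E.Taft) : E.CoPath) = wordProd (CoPath.arrow E) u :=
  map_wordProd E.Taft.val (fun _ => rfl) u

theorem vertex_mul_arrow (h : G) (j : J) :
    vertex E h * arrow E j = (E.inv.χ j h : k) • (arrow E j * vertex E h) := by
  refine Subtype.ext ?_
  change path E [] h * CoPath.arrow E j = _ • (CoPath.arrow E j * path E [] h)
  rw [arrow_mul_vertex, arrow_eq_cons, vertex_mul_cons, vertex_mul_path, mul_one, smul_smul]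
  simp [ESC.inv]

theorem word_deg (u : List J) (h : G) : wordProd (arrow E) u * vertex E h ∈
    (graded E).deg u.length := by
  change ((wordProd (arrow E) u * vertex E h : E.Taft) : E.CoPath) ∈ CoPath.deg E _
  rw [MulMemClass.coe_mul, val_word]
  change wordProd (CoPath.arrow E) u * path E [] h ∈ _
  -- Right multiplication by a vertex moves the start of a path and rescales it, so lengths are
  -- preserved.
  have h1 : ∀ w : List J, ∃ c : k, path E w 1 * path E [] h = c • path E w h := by
    intro w
    induction w with
    | nil => exact ⟨1, by rw [vertex_mul_path, one_mul, one_smul]⟩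
    | cons i w ih =>
      obtain ⟨c, hc⟩ := ih
      refine ⟨(E.χ i h : k) * c, ?_⟩
      rw [← cons_path, cons_mul_vertex, hc, map_smul, smul_smul, cons_path]
  refine (Submodule.span_le (p := (CoPath.deg E u.length).comap
    (LinearMap.mulRight k (path E [] h)))).2 ?_ (word_mem E u)
  rintro _ ⟨w, hw, rfl⟩
  rw [SetLike.mem_coe, Submodule.mem_comap, LinearMap.mulRight_apply]
  obtain ⟨c, hc⟩ := h1 w
  rw [hc]
  exact Submodule.smul_mem _ _ (Submodule.subset_span ⟨w, h, hw.length_eq, rfl⟩)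

/-- The span contains `1` and is stable under left multiplication by the vertices and the arrows `E
i`, hence by the subalgebra they generate. -/
theorem mem_span_word_mul_vertex (b : E.Taft) : b ∈ Submodule.span k
    (Set.range fun p : List J × G => wordProd (arrow E) p.1 * vertex E p.2) := by
  let V := Submodule.span k
    (Set.range fun p : List J × G => wordProd (arrow E) p.1 * vertex E p.2)
  have hV : ∀ u x, wordProd (arrow E) u * vertex E x ∈ V :=
    fun u x => Submodule.subset_span ⟨(u, x), rfl⟩
  have h1 : ∀ (c : E.Taft), (∀ u x, c * (wordProd (arrow E) u * vertex E x) ∈ V) →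
      ∀ a ∈ V, c * a ∈ V := by
    intro c hc a ha
    induction ha using Submodule.span_induction with
    | mem a h => obtain ⟨⟨u, x⟩, rfl⟩ := h; exact hc u x
    | zero => simp
    | add a b _ _ h1 h2 => rw [mul_add]; exact add_mem h1 h2
    | smul r a _ h => rw [mul_smul_comm]; exact Submodule.smul_mem _ _ h
  have h3 : ∀ j, ∀ a ∈ V, arrow E j * a ∈ V := fun j => h1 _ fun u x => by
    rw [← mul_assoc, ← wordProd_cons]
    exact hV _ _
  have h2 : ∀ y, ∀ a ∈ V, vertex E y * a ∈ V := fun y => h1 _ fun u x => by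
    induction u with
    | nil => rw [wordProd_nil, one_mul, ← map_mul]; simpa using hV [] (y * x)
    | cons j u ih =>
      rw [wordProd_cons, ← mul_assoc, ← mul_assoc, vertex_mul_arrow, smul_mul_assoc,
        smul_mul_assoc, mul_assoc, mul_assoc]
      exact Submodule.smul_mem _ _ (h3 j _ ih)
  let S : Subalgebra k E.Taft :=
    { carrier := {c | ∀ a ∈ V, c * a ∈ V}
      mul_mem' := fun {c d} hc hd a ha => by rw [mul_assoc]; exact hc _ (hd _ ha)
      add_mem' := fun {c d} hc hd a ha => by rw [add_mul]; exact add_mem (hc _ ha) (hd _ ha)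
      algebraMap_mem' := fun r a ha => by
        rw [← Algebra.smul_def]; exact Submodule.smul_mem _ _ ha }
  have h4 : E.Taft ≤ S.map E.Taft.val := by
    refine Algebra.adjoin_le ?_
    rintro _ (⟨x, rfl⟩ | ⟨⟨i, x⟩, rfl⟩)
    · exact ⟨vertex E x, h2 x, rfl⟩
    -- An arrow starting at `x` is the translate by `x` of the one starting at `1`.
    · refine ⟨vertex E x * arrow E i, S.mul_mem (h2 x) (h3 i), ?_⟩
      change path E [] x * CoPath.arrow E i = path E [i] x
      rw [CoPath.arrow, vertex_mul_path, mul_one]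
  obtain ⟨c, hc, hcb⟩ := h4 b.2
  have h5 : c = b := Subtype.ext hcb
  have h6 := hc 1 (by simpa using hV [] 1)
  rwa [h5, mul_one] at h6

theorem grp_graded : (graded E).grp = vertex E := by
  ext h : 1
  change MonoidAlgebra.lift k E.Taft G (vertex E) (MonoidAlgebra.single h 1) = _
  simp

/-- The right action on an arrow involves `χ j`, so moving `h` from left to right of `E j` involves
its inverse; hence `E.inv`. -/
theorem graded_isGenerated : (graded E).IsGenerated E.inv (arrow E) where
  comul_gen j := by
    refine subalgebra_map_injective E.Taft ?_
    refine (map_comul E (arrow E j)).trans ?_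
    change comulLin E (CoPath.arrow E j) = _
    rw [arrow_eq_cons, comulLin_cons_path, comulLin_vertex, LinearMap.rTensor_tmul, map_add,
      target_nil, mul_one, ← arrow_eq_cons, grp_graded]
    rfl
  grp_mul_gen h j := by
    rw [grp_graded]
    exact vertex_mul_arrow E h j
  span_word b := by
    rw [grp_graded]
    exact mem_span_word_mul_vertex E b
  word_deg u h := by
    rw [grp_graded]
    exact word_deg E u h
  indep := iSupIndep_comap (f := E.Taft.val.toLinearMap) (iSupIndep_deg E) Subtype.val_injective

end Taft

end ESC

/-! ### Primitive elements -/

namespace BraidedData.IsDiagonal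

variable {k G J R : Type*} [Field k] [Group G] [Ring R] [Algebra k R]
  {D : BraidedData k G R} {E : ESC k G J} {x : J → R} (hD : D.IsDiagonal E x)
include hD

theorem comul_of_mem_deg_one {r : R} (hr : r ∈ D.deg 1) : D.comul r = r ⊗ₜ 1 + 1 ⊗ₜ r := by
  rw [hD.deg_eq] at hr
  induction hr using Submodule.span_induction with
  | mem r h =>
    obtain ⟨u, hu, rfl⟩ := h
    obtain ⟨j, rfl⟩ := List.length_eq_one_iff.1 hu
    rw [wordProd_cons, hD.comul_gen_mul, wordProd_nil, hD.comul_one]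
    simp [hD.act_one]
  | zero => simp
  | add a b _ _ h1 h2 => rw [map_add, h1, h2, TensorProduct.add_tmul, TensorProduct.tmul_add]; abel
  | smul c a _ h =>
    rw [map_smul, h, smul_add, TensorProduct.smul_tmul', TensorProduct.tmul_smul]

theorem adjoin_deg_one : Algebra.adjoin k (D.deg 1 : Set R) = ⊤ := by
  refine eq_top_iff.2 fun r _ => ?_
  have h : Submodule.span k (Set.range (wordProd x)) ≤
      Subalgebra.toSubmodule (Algebra.adjoin k (D.deg 1 : Set R)) := by
    rw [Submodule.span_le]
    rintro _ ⟨u, rfl⟩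
    refine Subalgebra.list_prod_mem _ fun a ha => ?_
    obtain ⟨j, _, rfl⟩ := List.mem_map.1 ha
    have := hD.word_mem_deg [j]
    rw [wordProd_cons, wordProd_nil, mul_one] at this
    exact Algebra.subset_adjoin this
  exact h (hD.span_word r)

/-- Applying `ε ⊗ id` to the comultiplication gives `ε(r) 1 + r = r`, and the counit of `1` is `1`.
-/
theorem counit_eq_zero_of_primitive {r : R} (hr : D.comul r = r ⊗ₜ 1 + 1 ⊗ₜ r) :
    D.counit r = 0 := by
  have h := congrArg (TensorProduct.lid k R) (hD.rTensor_counit r)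
  rw [hr, map_add, LinearMap.rTensor_tmul, LinearMap.rTensor_tmul, hD.counit_one, map_add,
    TensorProduct.lid_tmul, TensorProduct.lid_tmul, add_eq_right] at h
  have := congrArg D.counit h
  rwa [map_smul, hD.counit_one, map_zero, smul_eq_mul, mul_one] at this

omit hD in
/-- The skew derivation `r ↦ ψ r⁽¹⁾ • r⁽²⁾`. -/
def _root_.BraidedData.skewDer (D : BraidedData k G R) (ψ : R →ₗ[k] k) : R →ₗ[k] R :=
  (TensorProduct.lid k R).toLinearMap ∘ₗ ψ.rTensor R ∘ₗ D.comul

-- The functional `ψ` sees only the one-letter word `i`. In the comultiplication of `x j * r` this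
-- letter is either the new `j`, leaving `r`, or it comes from `r`, and then `g j` has acted on it.
open Classical in
theorem skewDer_gen_mul {ψ : R →ₗ[k] k} {i : J}
    (hψ : ∀ u, ψ (wordProd x u) = if u = [i] then 1 else 0) (j : J) (r : R) :
    D.skewDer ψ (x j * r) =
      (if j = i then r else 0) + (E.χ i (E.g j) : k) • (x j * D.skewDer ψ r) := by
  suffices h : D.skewDer ψ ∘ₗ LinearMap.mulLeft k (x j) =
      (if j = i then LinearMap.id else 0) +
        (E.χ i (E.g j) : k) • (LinearMap.mulLeft k (x j) ∘ₗ D.skewDer ψ) by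
    have := LinearMap.congr_fun h r
    rw [LinearMap.comp_apply, LinearMap.mulLeft_apply] at this
    rw [this, LinearMap.add_apply]
    congr 1
    split_ifs <;> rfl
  refine hD.ext fun u => ?_
  -- By counitality, `T` writes the summand `r` as a linear function of its comultiplication. The
  -- whole identity can then be tested on pure tensors of words.
  let T : R ⊗[k] R →ₗ[k] R := if j = i then
    (TensorProduct.lid k R).toLinearMap ∘ₗ D.counit.rTensor R else 0
  have hT : T (D.comul (wordProd x u)) =
      (if j = i then (LinearMap.id : R →ₗ[k] R) else 0) (wordProd x u) := by
    by_cases hj : j = i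
    · simp [T, hj, hD.rTensor_counit]
    · simp [T, hj]
  have hT' : ∀ v w, T (wordProd x v ⊗ₜ wordProd x w) =
      if j :: v = [i] then wordProd x w else 0 := by
    intro v w
    by_cases hj : j = i
    · cases v with
      | nil => simp [T, hj, hD.counit_one]
      | cons l v => simp [T, hj, hD.counit_word]
    · simp [T, hj]
  rw [LinearMap.add_apply, ← hT, LinearMap.comp_apply, LinearMap.mulLeft_apply, skewDer,
    LinearMap.comp_apply, LinearMap.comp_apply, hD.comul_gen_mul]
  refine hD.comul_word_ext
    (f := (TensorProduct.lid k R).toLinearMap ∘ₗ ψ.rTensor R ∘ₗ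
      ((LinearMap.mulLeft k (x j)).rTensor R +
        TensorProduct.map (D.act (E.g j)) (LinearMap.mulLeft k (x j))))
    (f' := T + (E.χ i (E.g j) : k) • (LinearMap.mulLeft k (x j) ∘ₗ
      (TensorProduct.lid k R).toLinearMap ∘ₗ ψ.rTensor R)) u fun v w _ => ?_
  rw [LinearMap.add_apply, hT']
  simp only [LinearMap.comp_apply, LinearMap.add_apply, LinearMap.rTensor_tmul,
    TensorProduct.map_tmul, LinearMap.mulLeft_apply, map_add, hD.act_word, ← wordProd_cons,
    LinearEquiv.coe_coe, TensorProduct.lid_tmul, map_smul, hψ, LinearMap.smul_apply]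
  congr 1
  · rw [ite_smul, one_smul, zero_smul]
  · by_cases hv : v = [i]
    · simp [hv, wordProd_cons]
    · simp [hv]

theorem skewDer_one {ψ : R →ₗ[k] k} (hψ : ψ 1 = 0) : D.skewDer ψ 1 = 0 := by
  simp [skewDer, hD.comul_one, hψ]

omit hD in
theorem skewDer_of_primitive {ψ : R →ₗ[k] k} (hψ : ψ 1 = 0) {r : R}
    (hr : D.comul r = r ⊗ₜ 1 + 1 ⊗ₜ r) : D.skewDer ψ r = ψ r • 1 := by
  simp [skewDer, hr, hψ]

end BraidedData.IsDiagonal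

/-! ### The Nichols property of the diagram -/

namespace ESC.Taft

open CoPath

variable {k G J : Type*} [Field k] [Group G] (E : ESC k G J)

-- A product of arrows involves only permutations of its word, and a one-letter word has no other
-- permutation. So taking the coefficient of `E i` gives a functional of the kind needed for the
-- skew derivations.
open Classical in
theorem coord_word (i : J) (u : List J) :
    (CoPath.basis E).coord ([i], 1) (wordProd (CoPath.arrow E) u) = if u = [i] then 1 else 0 := by
  split_ifs with h
  · subst h
    rw [wordProd_cons, wordProd_nil, mul_one, CoPath.arrow, coord_path, if_pos rfl]
  · by_contra hn
    have := repr_vertex_mul_word (E := E) (x := 1) (y := 1) (u := u) (v := [i])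
      (by rw [← CoPath.one_def, one_mul]; exact hn)
    exact h (List.perm_singleton.1 this.1.symm)

theorem val_gen_word (u : List J) :
    (((wordProd (graded_isGenerated E).gen u : (graded E).diag) : E.Taft) : E.CoPath) =
      wordProd (CoPath.arrow E) u := by
  rw [(graded_isGenerated E).val_word, val_word]

/-- The coefficient of the arrow `E i` of an element of the diagram. -/
def coeffArrow (i : J) : (graded E).diag →ₗ[k] k :=
  (CoPath.basis E).coord ([i], 1) ∘ₗ E.Taft.val.toLinearMap ∘ₗ (graded E).diag.val.toLinearMap

open Classical in
theorem coeffArrow_word (i : J) (u : List J) :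
    coeffArrow E i (wordProd (graded_isGenerated E).gen u) = if u = [i] then 1 else 0 := by
  rw [← coord_word E i u, ← val_gen_word]
  rfl

theorem coeffArrow_one (i : J) : coeffArrow E i 1 = 0 := by
  have := coeffArrow_word E i []
  rwa [if_neg (by simp)] at this

/-- Both sides obey the same Leibniz rule for left multiplication by `E j`: the factor `χ_i(g_j)⁻¹`
of the skew derivation cancels the factor `χ_i(g_j)` produced by the twist. This links the path
coalgebra to the braided comultiplication. -/
theorem tail_eq (i : J) (r : (graded E).diag) : tail E i ((r : E.Taft) : E.CoPath) =
    twist E i (((graded E).diagData.skewDer (coeffArrow E i) r : E.Taft) : E.CoPath) := by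
  have hD := (graded_isGenerated E).diagData_isDiagonal
  suffices h : tail E i ∘ₗ E.Taft.val.toLinearMap ∘ₗ (graded E).diag.val.toLinearMap =
      twist E i ∘ₗ E.Taft.val.toLinearMap ∘ₗ (graded E).diag.val.toLinearMap ∘ₗ
        (graded E).diagData.skewDer (coeffArrow E i) from LinearMap.congr_fun h r
  refine hD.ext fun u => ?_
  induction u with
  | nil =>
    simp only [LinearMap.comp_apply, wordProd_nil, hD.skewDer_one (coeffArrow_one E i), map_zero]
    exact tail_vertex E i 1
  | cons j u ih =>
    simp only [LinearMap.comp_apply] at ih ⊢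
    rw [wordProd_cons, hD.skewDer_gen_mul (coeffArrow_word E i)]
    change tail E i (CoPath.arrow E j * _) = _
    have h1 : ∀ a : (graded E).diag, E.Taft.val.toLinearMap ((graded E).diag.val.toLinearMap
        ((graded_isGenerated E).gen j * a)) = CoPath.arrow E j *
          E.Taft.val.toLinearMap ((graded E).diag.val.toLinearMap a) := fun a => rfl
    have h2 : (E.inv.χ i (E.inv.g j) : k) * (E.χ i (E.g j) : k) = 1 := by
      rw [← Units.val_mul]
      simp [ESC.inv]
    rw [map_add, map_add, map_add, map_smul, map_smul, map_smul, h1, twist_mul, twist_arrow,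
      smul_mul_assoc, smul_smul, h2, one_smul, ← ih]
    by_cases hj : j = i
    · subst hj
      rw [if_pos rfl]
      exact tail_arrow_mul_self E j _
    · rw [if_neg hj, map_zero, map_zero, map_zero, zero_add]
      exact tail_arrow_mul_of_ne E hj _

theorem projLin_diag (r : (graded E).diag) : projLin E ((r : E.Taft) : E.CoPath) =
    (graded E).diagData.counit r • 1 := by
  let hD := (graded_isGenerated E).diagData_isDiagonal
  suffices h : projLin E ∘ₗ E.Taft.val.toLinearMap ∘ₗ (graded E).diag.val.toLinearMap =
      (LinearMap.toSpanSingleton k _ 1) ∘ₗ (graded E).diagData.counit from LinearMap.congr_fun h r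
  refine hD.ext fun u => ?_
  change projLin E ((wordProd _ u : (graded E).diag) : E.Taft) =
    (graded E).diagData.counit _ • 1
  rw [val_gen_word]
  cases u with
  | nil =>
    rw [wordProd_nil, wordProd_nil, hD.counit_one, one_smul]
    exact projLin_vertex E 1
  | cons j u =>
    rw [wordProd_cons, projLin_arrow_mul, hD.counit_word _ (by simp), zero_smul]

/-- The degree zero part of `r` is its counit, which is zero, and each tail is a multiple of the
vertex `1`. So only paths of length one have a nonzero coefficient. -/
theorem mem_deg_one_of_primitive (r : (graded E).diag)
    (hr : (graded E).diagData.comul r = r ⊗ₜ 1 + 1 ⊗ₜ r) : r ∈ (graded E).diagData.deg 1 := by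
  classical
  let hD := (graded_isGenerated E).diagData_isDiagonal
  change ((r : E.Taft) : E.CoPath) ∈ CoPath.deg E 1
  rw [deg_eq, Module.Basis.mem_span_image]
  rintro ⟨u, x⟩ hu
  rw [Finset.mem_coe, Finsupp.mem_support_iff] at hu
  cases u with
  | nil =>
    rw [repr_vertex_projLin, projLin_diag, hD.counit_eq_zero_of_primitive hr] at hu
    simp at hu
  | cons i u =>
    have h2 : twist E i (((1 : (graded E).diag) : E.Taft) : E.CoPath) = path E [] 1 := by
      change twist E i (path E [] 1) = _
      simp [twist_path, target]
    have h1 : twist E i (((coeffArrow E i r • (1 : (graded E).diag) : (graded E).diag) : E.Taft) :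
        E.CoPath) = coeffArrow E i r • path E [] 1 := by
      rw [← h2]
      exact map_smul (twist E i) _ _
    rw [← repr_cons_tail, tail_eq, BraidedData.IsDiagonal.skewDer_of_primitive
      (coeffArrow_one E i) hr, h1, map_smul, Finsupp.smul_apply] at hu
    have h3 := right_ne_zero_of_smul hu
    have h4 := coord_path E (u, x) [] 1
    rw [Module.Basis.coord_apply] at h4
    rw [h4] at h3
    have h5 : ([], 1) = (u, x) := by
      by_contra h
      exact h3 (if_neg h)
    rw [Prod.mk.injEq] at h5
    change (i :: u).length = 1
    rw [← h5.1]
    rfl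

theorem diagData_isNicholsAlgebra : (graded E).diagData.IsNicholsAlgebra where
  toIsGradedBraidedHopf := (graded_isGenerated E).diagData_isGradedBraidedHopf
  deg_zero := (graded_isGenerated E).diagData_isDiagonal.deg_zero
  primitive_iff r := ⟨mem_deg_one_of_primitive E r,
    (graded_isGenerated E).diagData_isDiagonal.comul_of_mem_deg_one⟩
  generated := (graded_isGenerated E).diagData_isDiagonal.adjoin_deg_one

end ESC.Taft

/-! ### Transport of structure -/

namespace BraidedData

variable {k G R R' : Type*} [Field k] [Group G] [Ring R] [Algebra k R] [Ring R'] [Algebra k R']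

/-- The structure maps on `R` obtained from those on `R'` along an isomorphism `R ≃ R'`. -/
def transport (D' : BraidedData k G R') (f : R ≃ₐ[k] R') : BraidedData k G R where
  act :=
    { toFun h := f.symm.toLinearMap ∘ₗ D'.act h ∘ₗ f.toLinearMap
      map_one' := LinearMap.ext fun x => by simp
      map_mul' h h' := LinearMap.ext fun x => by simp }
  coact := f.symm.toLinearMap.lTensor (MonoidAlgebra k G) ∘ₗ D'.coact ∘ₗ f.toLinearMap
  comul := TensorProduct.map f.symm.toLinearMap f.symm.toLinearMap ∘ₗ D'.comul ∘ₗ f.toLinearMap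
  counit := D'.counit ∘ₗ f.toLinearMap
  deg n := (D'.deg n).comap f.toLinearMap

theorem comp_symm_toLinearMap (f : R ≃ₐ[k] R') :
    f.toLinearMap ∘ₗ f.symm.toLinearMap = LinearMap.id :=
  LinearMap.ext f.apply_symm_apply

theorem transport_isIso (D' : BraidedData k G R') (f : R ≃ₐ[k] R') :
    (D'.transport f).IsIso D' f where
  act h x := f.apply_symm_apply _
  coact x := by
    change _ = f.toLinearMap.lTensor _ (f.symm.toLinearMap.lTensor _ (D'.coact (f x)))
    rw [← LinearMap.lTensor_comp_apply, comp_symm_toLinearMap, LinearMap.lTensor_id_apply]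
  comul x := by
    change _ = TensorProduct.map f.toLinearMap f.toLinearMap
      (TensorProduct.map f.symm.toLinearMap f.symm.toLinearMap (D'.comul (f x)))
    rw [← LinearMap.comp_apply, ← TensorProduct.map_comp, comp_symm_toLinearMap,
      TensorProduct.map_id, LinearMap.id_apply]
  counit x := rfl
  deg n x := Iff.rfl

/-- If an induced structure is reached through a quotient `π` followed by an isomorphism, pulling it
back along the isomorphism gives the structure induced along `π`. This avoids checking the relations
against each structure map. -/
theorem IsInduced.transport {R₀ : Type*} [Ring R₀] [Algebra k R₀] {D : BraidedData k G R₀}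
    {D' : BraidedData k G R'} {F : R₀ →ₐ[k] R'} (hF : D.IsInduced D' F) (f : R ≃ₐ[k] R')
    {π : R₀ →ₐ[k] R} (hπ : Function.Surjective π) (hf : ∀ a, f (π a) = F a) :
    D.IsInduced (D'.transport f) π := by
  have h1 : ∀ a, f.symm (F a) = π a := fun a => f.symm_apply_eq.2 (hf a).symm
  have h2 : f.symm.toLinearMap ∘ₗ F.toLinearMap = π.toLinearMap := LinearMap.ext h1
  refine ⟨hπ, fun h a => ?_, fun a => ?_, fun a => ?_, fun a => ?_, fun n => ?_⟩
  · change f.symm (D'.act h (f (π a))) = _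
    rw [hf, hF.act, h1]
  · change f.symm.toLinearMap.lTensor _ (D'.coact (f (π a))) = _
    rw [hf, hF.coact, ← LinearMap.lTensor_comp_apply, h2]
  · change TensorProduct.map f.symm.toLinearMap f.symm.toLinearMap (D'.comul (f (π a))) = _
    rw [hf, hF.comul, ← LinearMap.comp_apply, ← TensorProduct.map_comp, h2]
  · change D'.counit (f (π a)) = _
    rw [hf, hF.counit]
  · change (D'.deg n).comap f.toLinearMap = _
    ext x
    rw [Submodule.mem_comap, hF.deg, Submodule.mem_map, Submodule.mem_map]
    refine exists_congr fun a => and_congr_right fun _ => ?_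
    change F a = f x ↔ π a = x
    rw [← hf, f.injective.eq_iff]

end BraidedData

/-! ### Ordered monomials -/

section Monomials

variable {k J R : Type*} [Field k] [LinearOrder J] [Ring R] [Algebra k R] (x : J → R)

/-- The product of the powers `x j ^ m j`, in increasing order of `j`. -/
def sortedMonomial (m : J →₀ ℕ) : R := ((m.support.sort).map fun j => x j ^ m j).prod

omit [LinearOrder J] in
theorem prod_map_filter_of_eq_one (L : List J) (p : J → Bool) (f : J → R)
    (h : ∀ j ∈ L, p j = false → f j = 1) : ((L.filter p).map f).prod = (L.map f).prod := by
  induction L with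
  | nil => rfl
  | cons j L ih =>
    have ih' := ih fun i hi => h i (List.mem_cons_of_mem j hi)
    cases hp : p j with
    | true => rw [List.filter_cons_of_pos hp, List.map_cons, List.prod_cons, ih', List.map_cons,
        List.prod_cons]
    | false => rw [List.filter_cons_of_neg (by simp [hp]), ih', List.map_cons, List.prod_cons,
        h j List.mem_cons_self hp, one_mul]

/-- Extra indices contribute factors with exponent zero, so monomials whose supports differ can be
written over a common list. -/
theorem sortedMonomial_eq {m : J →₀ ℕ} {S : Finset J} (hS : m.support ⊆ S) :
    sortedMonomial x m = (S.sort.map fun j => x j ^ m j).prod := by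
  have h : m.support.sort = S.sort.filter (· ∈ m.support) := by
    -- Two sorted lists with the same elements and no repetitions coincide.
    refine List.Perm.eq_of_pairwise' (r := (· ≤ ·)) (Finset.pairwise_sort _ _)
      ((Finset.pairwise_sort _ _).filter _) ?_
    rw [List.perm_ext_iff_of_nodup (Finset.sort_nodup _ _) ((Finset.sort_nodup _ _).filter _)]
    intro j
    simp only [Finset.mem_sort, List.mem_filter, decide_eq_true_eq]
    exact ⟨fun h => ⟨hS h, h⟩, fun h => h.2⟩
  rw [sortedMonomial, h]
  refine prod_map_filter_of_eq_one _ _ _ fun j _ hj => ?_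
  rw [decide_eq_false_iff_not, Finsupp.notMem_support_iff] at hj
  rw [hj, pow_zero]

variable {x} {c : J → J → k} (hx : ∀ i j, i ≠ j → x i * x j = c i j • (x j * x i))
include hx

omit [LinearOrder J] in
theorem gen_mul_pow {i j : J} (hij : i ≠ j) (n : ℕ) :
    x i * x j ^ n = c i j ^ n • (x j ^ n * x i) := by
  induction n with
  | zero => simp
  | succ n ih =>
    rw [pow_succ, ← mul_assoc, ih, smul_mul_assoc, mul_assoc, hx i j hij, mul_smul_comm, smul_smul,
      ← mul_assoc, ← pow_succ]

/-- Push `x i` to the right until it meets its own power, collecting one scalar for each power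
passed. -/
theorem gen_mul_prod {i : J} {L : List J} (hL : L.Nodup) (hi : i ∈ L) {m m' : J → ℕ}
    (hm : m' i = m i + 1) (hm' : ∀ j, j ≠ i → m' j = m j) :
    ∃ d : k, x i * (L.map fun j => x j ^ m j).prod = d • (L.map fun j => x j ^ m' j).prod := by
  induction L with
  | nil => simp at hi
  | cons j L ih =>
    rw [List.nodup_cons] at hL
    simp only [List.map_cons, List.prod_cons]
    by_cases hij : i = j
    · subst hij
      refine ⟨1, ?_⟩
      have : (L.map fun j => x j ^ m j) = L.map fun j => x j ^ m' j :=
        List.map_congr_left fun l hl => by rw [hm' l (by rintro rfl; exact hL.1 hl)]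
      rw [one_smul, hm, pow_succ', mul_assoc, this]
    · obtain ⟨d, hd⟩ := ih hL.2 ((List.mem_cons.1 hi).resolve_left hij)
      refine ⟨c i j ^ m j * d, ?_⟩
      rw [← mul_assoc, gen_mul_pow hx hij, smul_mul_assoc, mul_assoc, hd, mul_smul_comm, smul_smul,
        hm' j (Ne.symm hij)]

/-- Prepending a letter to an ordered monomial raises one exponent, up to a scalar. If the exponent
reaches its bound, the power relation makes the product zero. -/
theorem wordProd_mem_span_sortedMonomial {N : J → ℕ∞} (hN : ∀ j, N j ≠ 0)
    (hpow : ∀ l, N l ≠ ⊤ → x l ^ (N l).toNat = 0) (u : List J) : wordProd x u ∈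
    Submodule.span k (Set.range fun m : {m : J →₀ ℕ // ∀ j, (m j : ℕ∞) < N j} =>
      sortedMonomial x m.1) := by
  induction u with
  | nil =>
    refine Submodule.subset_span ⟨⟨0, fun j => ?_⟩, by simp [sortedMonomial]⟩
    simpa using pos_iff_ne_zero.2 (hN j)
  | cons i u ih =>
    rw [wordProd_cons]
    refine (Submodule.span_le (p := (Submodule.span k _).comap (LinearMap.mulLeft k (x i)))).2
      ?_ ih
    rintro _ ⟨m, rfl⟩
    rw [SetLike.mem_coe, Submodule.mem_comap, LinearMap.mulLeft_apply]
    -- The support of `m'` also contains `i`, so both monomials are expanded over it.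
    let m' : J →₀ ℕ := m.1 + Finsupp.single i 1
    have hi : m' i = m.1 i + 1 := by simp [m']
    have hj : ∀ j, j ≠ i → m' j = m.1 j := fun j hj => by simp [m', hj.symm]
    have hsub : m.1.support ⊆ m'.support := by
      intro j
      simp only [Finsupp.mem_support_iff, m', Finsupp.add_apply]
      omega
    obtain ⟨d, hd⟩ := gen_mul_prod hx (L := m'.support.sort) (Finset.sort_nodup _ _)
      (i := i) (by rw [Finset.mem_sort, Finsupp.mem_support_iff, hi]; omega) hi hj
    change x i * sortedMonomial x m.1 ∈ _
    rw [sortedMonomial_eq x hsub, hd]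
    refine Submodule.smul_mem _ _ ?_
    by_cases hlt : (m' i : ℕ∞) < N i
    · refine Submodule.subset_span ⟨⟨m', fun j => ?_⟩, rfl⟩
      by_cases h : j = i
      · rwa [h]
      · rw [hj j h]; exact m.2 j
    · have hle := not_lt.1 hlt
      have htop : N i ≠ ⊤ := fun h => by rw [h] at hle; exact (ENat.natCast_ne_top _) (top_le_iff.1 hle)
      have h0 : x i ^ m' i = 0 := by
        refine pow_eq_zero_of_le ?_ (hpow i htop)
        rw [← ENat.natCast_toNat htop] at hle
        exact_mod_cast hle
      rw [List.prod_eq_zero]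
      · exact zero_mem _
      · exact List.mem_map.2 ⟨i, by rw [Finset.mem_sort, Finsupp.mem_support_iff, hi]; omega, h0⟩

end Monomials

/-- Nonzero vectors with pairwise disjoint supports in a basis: at a coordinate in the support of `v
i` no other vector contributes. -/
theorem linearIndependent_of_repr {k ι κ V : Type*} [Field k] [AddCommGroup V] [Module k V]
    (b : Module.Basis κ k V) {v : ι → V} (h0 : ∀ i, v i ≠ 0)
    (h : ∀ i j z, b.repr (v i) z ≠ 0 → b.repr (v j) z ≠ 0 → i = j) : LinearIndependent k v := by
  rw [linearIndependent_iff']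
  intro s c hc i hi
  obtain ⟨z, hz⟩ : ∃ z, b.repr (v i) z ≠ 0 := by
    by_contra hn
    push Not at hn
    exact h0 i (b.ext_elem fun z => by rw [hn z]; simp)
  have h1 := congrArg (b.coord z) hc
  rw [map_sum, map_zero, Finset.sum_eq_single i] at h1
  · rw [map_smul, smul_eq_mul] at h1
    exact (mul_eq_zero.1 h1).resolve_right hz
  · intro j _ hj
    rw [map_smul]
    by_contra hn
    exact hj (h j i z (right_ne_zero_of_smul hn) hz)
  · exact fun hn => absurd hi hn

/-! ### Counting the admissible exponents -/

namespace ESC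

variable {k G J : Type*} [Field k] [Group G] (E : ESC k G J)

/-- A finite value is the order of some `q j ≠ 1`, hence at least two. So every `E j` is itself an
admissible monomial. -/
theorem one_lt_N (j : J) : 1 < E.N j := by
  rw [N]
  split_ifs with h
  · exact ENat.one_lt_top
  · push Not at h
    have h1 : orderOf (E.q j) ≠ 1 := fun h1 => h.2 (orderOf_eq_one_iff.1 h1)
    have : 1 < orderOf (E.q j) := by have := h.1; omega
    exact_mod_cast this

theorem inv_N (j : J) : E.inv.N j = E.N j := by
  have h : E.inv.q j = (E.q j)⁻¹ := rfl
  have h0 : orderOf (E.inv.q j) = orderOf (E.q j) := by rw [h, orderOf_inv]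
  have h1 : E.inv.q j = 1 ↔ E.q j = 1 := by rw [h, inv_eq_one]
  unfold N
  rw [h0]
  congr 1
  exact propext (or_congr_right h1)

/-- The exponents concentrated at one index with value `1` embed `J`, and an infinite `N j` admits
every multiple at `j`. Conversely the exponents embed into a finite product of finite sets. -/
theorem finite_exponent_iff : Finite E.Exponent ↔ Finite J ∧ ∀ j, E.N j ≠ ⊤ := by
  classical
  have h1 : ∀ j (n : ℕ), (n : ℕ∞) < E.N j → ∀ i, ((Finsupp.single j n : J →₀ ℕ) i : ℕ∞) < E.N i := by
    intro j n hn i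
    rw [Finsupp.single_apply]
    split_ifs with h
    · rwa [← h]
    · exact lt_trans (by simp) (E.one_lt_N i)
  constructor
  · intro hfin
    refine ⟨?_, fun j hj => ?_⟩
    · refine Finite.of_injective (fun j => (⟨Finsupp.single j 1, h1 j 1 (by
        simpa using E.one_lt_N j)⟩ : E.Exponent)) fun i j hij => ?_
      exact Finsupp.single_left_injective one_ne_zero (congrArg Subtype.val hij)
    · refine not_injective_infinite_finite (fun n : ℕ => (⟨Finsupp.single j n, h1 j n (by
        rw [hj]; exact ENat.natCast_lt_top n)⟩ : E.Exponent)) fun m n hmn => ?_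
      exact Finsupp.single_injective j (congrArg Subtype.val hmn)
  · rintro ⟨hJ, hN⟩
    refine Finite.of_injective (fun m : E.Exponent => fun j => (⟨m.1 j, by
      have := m.2 j
      rw [← ENat.natCast_toNat (hN j)] at this
      exact_mod_cast this⟩ : Fin (E.N j).toNat)) fun m m' h => ?_
    refine Subtype.ext (Finsupp.ext fun j => ?_)
    exact congrArg Fin.val (congrFun h j)

theorem card_exponent [Finite J] (hN : ∀ j, E.N j ≠ ⊤) :
    Nat.card E.Exponent = ∏ᶠ j, (E.N j).toNat := by
  have := Fintype.ofFinite J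
  have hlt : ∀ j (n : ℕ), (n : ℕ∞) < E.N j ↔ n < (E.N j).toNat := fun j n => by
    conv_lhs => rw [← ENat.natCast_toNat (hN j)]
    exact Nat.cast_lt
  let e : E.Exponent ≃ ((j : J) → Fin (E.N j).toNat) :=
    { toFun m j := ⟨m.1 j, (hlt j _).1 (m.2 j)⟩
      invFun f := ⟨Finsupp.equivFunOnFinite.symm fun j => f j, fun j => (hlt j _).2 (f j).2⟩
      left_inv m := Subtype.ext (Finsupp.ext fun j => rfl)
      right_inv f := rfl }
  rw [Nat.card_congr e, Nat.card_pi, finprod_eq_prod_of_fintype]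
  simp

/-! ### Monomial bases of the multiple Taft algebra and of its diagram, and the quantum linear space
-/

namespace Taft

open CoPath

section

variable [LinearOrder J]

theorem val_monomial (m : J →₀ ℕ) :
    (monomial E m : E.CoPath) = listMonomial E m.support.sort m := by
  rw [monomial, listMonomial]
  change E.Taft.val _ = _
  rw [map_list_prod, List.map_map]
  congr 1

theorem val_gen_sortedMonomial (m : J →₀ ℕ) :
    ((sortedMonomial (graded_isGenerated E).gen m : (graded E).diag) : E.Taft) = monomial E m := by
  rw [monomial, sortedMonomial]
  change (graded E).diag.val _ = _
  rw [map_list_prod, List.map_map]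
  congr 1

/-- The word with exponents `m`, in increasing order of the letters. -/
def sortedWord (m : J →₀ ℕ) : List J := m.support.sort.flatMap fun j => List.replicate (m j) j

theorem val_monomial_eq_word (m : J →₀ ℕ) :
    (monomial E m : E.CoPath) = wordProd (CoPath.arrow E) (sortedWord m) := by
  rw [val_monomial, listMonomial, sortedWord]
  induction m.support.sort with
  | nil => rfl
  | cons j L ih =>
    rw [List.map_cons, List.prod_cons, ih, List.flatMap_cons, wordProd_append]
    congr 1
    simp [wordProd]

/-- It recovers the exponents from the multiset of letters, so words that are permutations of each
other come from equal exponents. -/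
theorem count_sortedWord (m : J →₀ ℕ) (j : J) : (sortedWord m).count j = m j := by
  have h : ∀ L : List J, L.Nodup →
      (L.flatMap fun j => List.replicate (m j) j).count j = if j ∈ L then m j else 0 := by
    intro L hL
    induction L with
    | nil => simp
    | cons i L ih =>
      rw [List.nodup_cons] at hL
      rw [List.flatMap_cons, List.count_append, ih hL.2, List.count_replicate]
      by_cases hij : i = j
      · subst hij
        simp [hL.1]
      · simp [hij, Ne.symm hij]
  rw [sortedWord, h _ (Finset.sort_nodup _ _)]
  simp only [Finset.mem_sort, Finsupp.mem_support_iff]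
  split_ifs with h0
  · rfl
  · push Not at h0; exact h0.symm

variable (hE : CharZero k ∨ ∀ i, E.q i ≠ 1)
include hE

/-- Each product is nonzero, and every path occurring in it determines the vertex as its start and
the exponents as its letter counts. So the supports are disjoint. -/
theorem linearIndependent_vertex_mul_monomial : LinearIndependent k
    fun p : G × E.Exponent => vertex E p.1 * monomial E p.2.1 := by
  refine LinearIndependent.of_comp E.Taft.val.toLinearMap ?_
  have hval : ∀ p : G × E.Exponent, E.Taft.val.toLinearMap (vertex E p.1 * monomial E p.2.1) =
      path E [] p.1 * wordProd (CoPath.arrow E) (sortedWord p.2.1) := by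
    intro p
    rw [← val_monomial_eq_word]
    rfl
  refine linearIndependent_of_repr (CoPath.basis E) (fun p h0 => ?_) fun p p' z h1 h2 => ?_
  · rw [Function.comp_apply, hval, ← val_monomial_eq_word, val_monomial] at h0
    -- The vertex is invertible, which reduces to the nonvanishing of the monomial.
    have h1 := congrArg (path E [] p.1⁻¹ * ·) h0
    simp only [mul_zero, ← mul_assoc, vertex_mul_path, inv_mul_cancel] at h1
    rw [← CoPath.one_def, one_mul] at h1
    exact listMonomial_ne_zero E hE (Finset.sort_nodup _ _) p.2.2 h1
  · rw [Function.comp_apply, hval] at h1 h2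
    obtain ⟨u, y⟩ := z
    have h3 := repr_vertex_mul_word E h1
    have h4 := repr_vertex_mul_word E h2
    refine Prod.ext (h3.2.symm.trans h4.2) (Subtype.ext (Finsupp.ext fun j => ?_))
    rw [← count_sortedWord, ← count_sortedWord]
    exact (h3.1.symm.trans h4.1).count_eq j

theorem linearIndependent_monomial : LinearIndependent k
    fun m : E.Exponent => monomial E m.1 := by
  have h := (linearIndependent_vertex_mul_monomial E hE).comp (fun m : E.Exponent => ((1 : G), m))
    fun m m' h => congrArg Prod.snd h
  convert h using 1
  funext m
  simp

end

section

variable (hc : E.IsQuantumWeaklyCommutative)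
include hc

theorem arrow_mul_arrow {i j : J} (hij : i ≠ j) :
    arrow E i * arrow E j = (E.inv.χ j (E.g i) : k) • (arrow E j * arrow E i) :=
  Subtype.ext (CoPath.arrow_mul_arrow E hc hij)

omit hc in
theorem arrow_pow_N (i : J) (h : E.N i ≠ ⊤) : arrow E i ^ (E.N i).toNat = 0 :=
  Subtype.ext (CoPath.arrow_pow_N E i h)

/-- The homomorphism from the quantum linear space to the diagram. -/
def ofQuantumLinear : E.inv.QuantumLinear →ₐ[k] (graded E).diag :=
  RingQuot.liftAlgHom k ⟨FreeAlgebra.lift k (graded_isGenerated E).gen, by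
    intro x y h
    induction h with
    | pow l h =>
      rw [map_pow, FreeAlgebra.lift_ι_apply, map_zero, inv_N]
      rw [inv_N] at h
      exact Subtype.ext (arrow_pow_N E l h)
    | comm i j h =>
      rw [map_smul, map_mul, map_mul, FreeAlgebra.lift_ι_apply, FreeAlgebra.lift_ι_apply]
      exact Subtype.ext (arrow_mul_arrow E hc h)⟩

theorem ofQuantumLinear_ι (j : J) :
    ofQuantumLinear E hc (E.inv.toQuantumLinear (FreeAlgebra.ι k j)) =
      (graded_isGenerated E).gen j := by
  rw [ofQuantumLinear, toQuantumLinear, RingQuot.liftAlgHom_mkAlgHom_apply]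
  exact FreeAlgebra.lift_ι_apply _ _

variable [LinearOrder J]

theorem word_mem_span_monomial (u : List J) : wordProd (arrow E) u ∈
    Submodule.span k (Set.range fun m : E.Exponent => monomial E m.1) :=
  wordProd_mem_span_sortedMonomial (fun _ _ h => arrow_mul_arrow E hc h)
    (fun j => (zero_lt_one.trans (E.one_lt_N j)).ne') (arrow_pow_N E) u

theorem mem_span_vertex_mul_monomial (b : E.Taft) : b ∈ Submodule.span k
    (Set.range fun p : G × E.Exponent => vertex E p.1 * monomial E p.2.1) := by
  refine Submodule.span_le.2 ?_ (mem_span_word_mul_vertex E b)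
  rintro _ ⟨⟨u, x⟩, rfl⟩
  have h1 : wordProd (arrow E) u * vertex E x =
      ((E.inv.wordχ u x)⁻¹ : kˣ) • (vertex E x * wordProd (arrow E) u) := by
    have := (graded_isGenerated E).grp_mul_word x u
    rw [grp_graded] at this
    rw [this, Units.smul_def, smul_smul, Units.inv_mul, one_smul]
  simp only [SetLike.mem_coe, h1]
  refine Submodule.smul_mem _ (_ : k) ?_
  refine (Submodule.span_le (p := (Submodule.span k _).comap
    (LinearMap.mulLeft k (vertex E x)))).2 ?_ (word_mem_span_monomial E hc u)
  rintro _ ⟨m, rfl⟩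
  exact Submodule.subset_span ⟨(x, m), rfl⟩

theorem mem_span_diag_monomial (r : (graded E).diag) : r ∈ Submodule.span k
    (Set.range fun m : E.Exponent => sortedMonomial (graded_isGenerated E).gen m.1) := by
  refine Submodule.span_le.2 ?_ ((graded_isGenerated E).span_diag r)
  rintro _ ⟨u, rfl⟩
  exact wordProd_mem_span_sortedMonomial
    (fun _ _ h => Subtype.ext (arrow_mul_arrow E hc h))
    (fun j => (zero_lt_one.trans (E.one_lt_N j)).ne')
    (fun l h => Subtype.ext (arrow_pow_N E l h)) u

-- The defining relations are those used to rewrite words, and inverting the characters leaves the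
-- orders `N j` unchanged.
omit hc in
theorem mem_span_quantumLinear_monomial (r : E.inv.QuantumLinear) : r ∈ Submodule.span k
    (Set.range fun m : E.Exponent =>
      sortedMonomial (fun j => E.inv.toQuantumLinear (FreeAlgebra.ι k j)) m.1) := by
  obtain ⟨a, rfl⟩ := RingQuot.mkAlgHom_surjective k E.inv.QuantumLinearRel r
  have h := E.inv.tensorData_isDiagonal.span_word a
  refine (Submodule.span_le (p := (Submodule.span k _).comap
    E.inv.toQuantumLinear.toLinearMap)).2 ?_ h
  rintro _ ⟨u, rfl⟩
  rw [SetLike.mem_coe, Submodule.mem_comap, AlgHom.toLinearMap_apply,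
    map_wordProd E.inv.toQuantumLinear (fun _ => rfl)]
  refine wordProd_mem_span_sortedMonomial (c := fun i j => (E.inv.χ j (E.inv.g i) : k))
    (fun i j h => ?_) (fun j => (zero_lt_one.trans (E.one_lt_N j)).ne') (fun l h => ?_) u
  · rw [← map_mul, ← map_mul, ← map_smul]
    exact RingQuot.mkAlgHom_rel k (.comm i j h)
  · rw [← map_pow, ← inv_N, ← map_zero E.inv.toQuantumLinear]
    exact RingQuot.mkAlgHom_rel k (.pow l (by rwa [inv_N]))

variable (hE : CharZero k ∨ ∀ i, E.q i ≠ 1)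
include hE

theorem exists_basis : ∃ b : Module.Basis (G × E.Exponent) k E.Taft,
    ∀ x m, b (x, m) = vertex E x * monomial E m.1 :=
  ⟨Module.Basis.mk (linearIndependent_vertex_mul_monomial E hE)
    fun b _ => mem_span_vertex_mul_monomial E hc b, fun x m => by simp⟩

omit hc in
theorem linearIndependent_gen_monomial : LinearIndependent k
    fun m : E.Exponent => sortedMonomial (graded_isGenerated E).gen m.1 := by
  refine LinearIndependent.of_comp (graded E).diag.val.toLinearMap ?_
  have h : ((graded E).diag.val.toLinearMap ∘ fun m : E.Exponent =>
      sortedMonomial (graded_isGenerated E).gen m.1) = fun m => monomial E m.1 :=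
    funext fun m => val_gen_sortedMonomial E m.1
  rw [h]
  exact linearIndependent_monomial E hE

theorem exists_diag_basis : ∃ b : Module.Basis E.Exponent k (graded E).diag,
    ∀ m, (b m : E.Taft) = monomial E m.1 :=
  ⟨Module.Basis.mk (linearIndependent_gen_monomial E hE)
    fun b _ => mem_span_diag_monomial E hc b, fun m => by
      rw [Module.Basis.mk_apply, val_gen_sortedMonomial]⟩

/-- The ordered monomials span the quantum linear space and go to the independent ordered monomials
of the diagram. -/
theorem ofQuantumLinear_injective : Function.Injective (ofQuantumLinear E hc) := by
  refine injective_of_linearIndependent (f := (ofQuantumLinear E hc).toLinearMap)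
    (mem_span_quantumLinear_monomial E) ?_
  have h : ((ofQuantumLinear E hc).toLinearMap ∘ fun m : E.Exponent =>
      sortedMonomial (fun j => E.inv.toQuantumLinear (FreeAlgebra.ι k j)) m.1) =
      fun m => sortedMonomial (graded_isGenerated E).gen m.1 := by
    funext m
    rw [Function.comp_apply, sortedMonomial, AlgHom.toLinearMap_apply, map_list_prod, List.map_map,
      sortedMonomial]
    congr 1
    refine List.map_congr_left fun j _ => ?_
    rw [Function.comp_apply, map_pow, ofQuantumLinear_ι]
  rw [h]
  exact linearIndependent_gen_monomial E hE

theorem finite_iff : Module.Finite k E.Taft ↔ Finite G ∧ Finite J ∧ ∀ j, E.N j ≠ ⊤ := by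
  obtain ⟨b, -⟩ := exists_basis E hc hE
  -- A product is finite exactly when both factors are only if neither is empty; the zero exponent
  -- is always admissible.
  have hne : Nonempty E.Exponent :=
    ⟨⟨0, fun j => by simpa using zero_lt_one.trans (E.one_lt_N j)⟩⟩
  have h : Module.Finite k E.Taft ↔ Finite (G × E.Exponent) :=
    ⟨fun _ => Module.Finite.finite_basis b, fun _ => Module.Finite.of_basis b⟩
  rw [h, ← finite_exponent_iff]
  exact ⟨fun _ => ⟨Finite.prod_left E.Exponent, Finite.prod_right G⟩,
    fun ⟨_, _⟩ => inferInstance⟩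

theorem finrank_eq (hfin : Module.Finite k E.Taft) :
    Module.finrank k E.Taft = Nat.card G * ∏ᶠ j, (E.N j).toNat := by
  obtain ⟨b, -⟩ := exists_basis E hc hE
  obtain ⟨_, _, hN⟩ := (finite_iff E hc hE).1 hfin
  rw [Module.finrank_eq_nat_card_basis b, Nat.card_prod, card_exponent E hN]

/-- The composite from the free algebra to the diagram induces the structure maps there. As it
factors through the quantum linear space by an isomorphism, these maps can be pulled back to the
quotient. -/
theorem exists_quantumLinear_equiv : ∃ (D : BraidedData k G E.inv.QuantumLinear)
    (f : E.inv.QuantumLinear ≃ₐ[k] (graded E).diag),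
    E.inv.tensorData.IsInduced D E.inv.toQuantumLinear ∧ D.IsIso (graded E).diagData f ∧
    ∀ j, (f (E.inv.toQuantumLinear (FreeAlgebra.ι k j)) : E.Taft) = arrow E j := by
  let hG := graded_isGenerated E
  let D' := (graded E).diagData
  have hD' : D'.IsDiagonal E.inv hG.gen := hG.diagData_isDiagonal
  let F := (ofQuantumLinear E hc).comp E.inv.toQuantumLinear
  have hF : ∀ j, F (FreeAlgebra.ι k j) = hG.gen j := ofQuantumLinear_ι E hc
  have hind := E.inv.tensorData_isDiagonal.isInduced hD' F hF
  have surj : Function.Surjective (ofQuantumLinear E hc) :=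
    Function.Surjective.of_comp (g := E.inv.toQuantumLinear) hind.surjective
  let f := AlgEquiv.ofBijective (ofQuantumLinear E hc) ⟨ofQuantumLinear_injective E hc hE, surj⟩
  exact ⟨D'.transport f, f,
    hind.transport f (RingQuot.mkAlgHom_surjective k _) fun _ => rfl, D'.transport_isIso f,
    fun j => congrArg Subtype.val (ofQuantumLinear_ι E hc j)⟩

end

end Taft

end ESC

end

/-! ### The main theorem -/

theorem theorem6 {k G J : Type*} [Field k] [Group G] [LinearOrder J] (E : ESC k G J) :
    (E.IsQuantumWeaklyCommutative →
      (ESC.Taft.graded E).diagData.IsNicholsAlgebra ∧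
      ((CharZero k ∨ ∀ i, E.q i ≠ 1) →
        ((∃ b : Module.Basis (G × E.Exponent) k E.Taft,
            ∀ x m, b (x, m) = ESC.Taft.vertex E x * ESC.Taft.monomial E m.1) ∧
          (Module.Finite k E.Taft ↔ Finite G ∧ Finite J ∧ ∀ j, E.N j ≠ ⊤) ∧
          (Module.Finite k E.Taft →
            Module.finrank k E.Taft = Nat.card G * ∏ᶠ j, (E.N j).toNat)) ∧
        (∃ b : Module.Basis E.Exponent k (ESC.Taft.graded E).diag,
          ∀ m, (b m : E.Taft) = ESC.Taft.monomial E m.1) ∧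
        (∃ (D : BraidedData k G E.inv.QuantumLinear)
            (f : E.inv.QuantumLinear ≃ₐ[k] (ESC.Taft.graded E).diag),
            E.inv.tensorData.IsInduced D E.inv.toQuantumLinear ∧
            D.IsIso (ESC.Taft.graded E).diagData f ∧
            ∀ j, (f (E.inv.toQuantumLinear (FreeAlgebra.ι k j)) : E.Taft) =
              ESC.Taft.arrow E j))) ∧
    ((ESC.SemiPath.graded E).diagData.IsGradedBraidedHopf ∧
      ∃ f : FreeAlgebra k J ≃ₐ[k] (ESC.SemiPath.graded E).diag,
        E.inv.tensorData.IsIso (ESC.SemiPath.graded E).diagData f ∧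
        ∀ j, (f (FreeAlgebra.ι k j) : E.SemiPath) = ESC.SemiPath.arrow E j) ∧
    ((∃ f : (FreeAlgebra k J ⊗[k] MonoidAlgebra k G) ≃ₗ[k] E.SemiPath,
        (ESC.SemiPath.graded E).IsBiprodIso E.inv.tensorData f) ∧
      ∃ b : Module.Basis (G × List J) k E.SemiPath,
        ∀ x u, b (x, u) = ESC.SemiPath.vertex E x * (u.map (ESC.SemiPath.arrow E)).prod) := by
  refine ⟨fun hc => ⟨ESC.Taft.diagData_isNicholsAlgebra E, fun hE =>
    ⟨⟨ESC.Taft.exists_basis E hc hE, ESC.Taft.finite_iff E hc hE, ESC.Taft.finrank_eq E hc hE⟩,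
      ESC.Taft.exists_diag_basis E hc hE, ESC.Taft.exists_quantumLinear_equiv E hc hE⟩⟩,
    ⟨(ESC.SemiPath.graded_isGenerated E).diagData_isGradedBraidedHopf,
      ESC.SemiPath.exists_diag_equiv E⟩, ?_, ESC.SemiPath.basis E, ESC.SemiPath.basis_apply E⟩
  obtain ⟨f, hf⟩ := ESC.SemiPath.exists_biprod_equiv E
  exact ⟨f, E.inv.tensorData_isDiagonal.isBiprodIso (ESC.SemiPath.graded_isGenerated E)
    (ESC.SemiPath.ofFree E) (ESC.SemiPath.ofFree_ι E) f hf⟩
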